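/- Let $n\ge 1$; functions are real- or complex-valued on $\mathbb{R}^n$ and $B=B(x_0,r)$ denotes a ball of radius $r>0$. For $b\in L^1_{\rm loc}(\mathbb{R}^n)$ put $c_B:=\frac1{|B|}\int_B b$ if $r<1$ and $c_B:=0$ if $r\ge 1$, and for $1\le p<\infty$ let $$\|b\|_{\mathrm{bmo},p}:=\Big(\sup_B \frac1{|B|}\int_B|b-c_B|^p\,dx\Big)^{1/p},\qquad \|b\|_{\mathrm{bmo}}:=\|b\|_{\mathrm{bmo},1}.$$ We say $b\in\mathrm{bmo}(\mathbb{R}^n)$ if $b\in L^1_{\rm loc}$ and $\|b\|_{\mathrm{bmo}}<\infty$. An inhomogeneous singular integral operator is a bounded linear operator $T$ on $L^2(\mathbb{R}^n)$ for which there are $\delta\in(0,1]$, $\varepsilon>0$, $C_K$ and a locally integrable function $K$ on $\{(x,y)\in\mathbb{R}^{2n}: x\ne y\}$ such that 1. $|K(x,y)|\le C_K\min\{|x-y|^{-n},|x-y|^{-n-\varepsilon}\}$ for $x\neq y$; 2. $|K(x,y)-K(x,z)|+|K(y,x)-K(z,x)|\le C_K|y-z|^{\delta}|x-y|^{-n-\delta}$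 whenever $x\ne y$ and $2|y-z|\le|x-y|$; 3. $Tf(x)=\int K(x,y)f(y)\,dy$ for every $f\in C_c^\infty(\mathbb{R}^n)$ and almost every $x\notin\operatorname{supp} f$. For $b\in\mathrm{bmo}(\mathbb{R}^n)$, an approximate $h^1_b$ atom is a function $a\in L^2(\mathbb{R}^n)$ for which there is a ball $B=B(x_0,r)$ with $a=0$ a.e. outside $B$, $\|a\|_{L^2}\le|B|^{-1/2}$, $$\Big|\int a\Big|\le\frac1{[\log(1+r^{-1})]^2}\quad\text{and}\quad\Big|\int a\,(b-c_B)\Big|\le\frac{\|b\|_{\mathrm{bmo},2}}{\log(1+r^{-1})}.$$ Let $h^1_{\mathrm{finite},b}(\mathbb{R}^n)$ be the space of finite linear combinations of approximate $h^1_b$ atoms. The commutator is $[b,T]f:=b\,T(f)-T(bf)$, where $T(bf)$ is the value at $bf\in L^p$, for some $1<p<\infty$, of the bounded operator on $L^p(\mathbb{R}^n)$ that agrees with $T$ on $L^2\cap L^p$. **Theorem.** Let $T$ be an inhomogeneous singular integral operator on $\mathbb{R}^n$. There is a constant $C$, depending only on $T$ and $n$, such that for every $b\in\mathrm{bmo}(\mathbb{R}^n)$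 and every approximate $h^1_b$ atom $a$, the commutator $[b,T]a$ is well defined (for some $1<p<\infty$ we have $ba\in L^p$ and $T$ extends boundedly to $L^p$), belongs to $L^1(\mathbb{R}^n)$, and $$\|[b,T]a\|_{L^1}\le C\,\|b\|_{\mathrm{bmo}}.$$ Consequently, for every $b\in\mathrm{bmo}(\mathbb{R}^n)$ and every $f\in h^1_{\mathrm{finite},b}(\mathbb{R}^n)$, $[b,T]f$ is well defined and belongs to $L^1(\mathbb{R}^n)$. -/

import Mathlib

open MeasureTheory Metric
open scoped ENNReal NNReal ContDiff

namespace LocalHardy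

noncomputable section

/-- `ℝⁿ` with the Euclidean norm; its `volume` is Lebesgue measure. -/
abbrev Rn (n : ℕ) : Type := EuclideanSpace ℝ (Fin n)

/-! ### The space bmo -/

/-- The number `c_B` for the ball `B = B(x₀, r)`: the average of `b` over `B` if `r < 1`,
and `0` if `r ≥ 1`. -/
def ballConst {n : ℕ} {𝕜 : Type*} [RCLike 𝕜] (b : Rn n → 𝕜) (x₀ : Rn n) (r : ℝ) : 𝕜 :=
  if r < 1 then ⨍ y in ball x₀ r, b y else 0

/-- `‖b‖_bmo = sup_B ⨍_B |b - c_B|`, the supremum being over all balls; it takes values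
in `[0, ∞]`. -/
def bmoNorm {n : ℕ} {𝕜 : Type*} [RCLike 𝕜] (b : Rn n → 𝕜) : ℝ≥0∞ :=
  ⨆ (x₀ : Rn n) (r : ℝ) (_ : 0 < r), ⨍⁻ y in ball x₀ r, ‖b y - ballConst b x₀ r‖ₑ ∂volume

/-- `‖b‖_{bmo,p} = (sup_B ⨍_B |b - c_B|^p)^{1/p}`, with values in `[0, ∞]`. -/
def bmoNormP {n : ℕ} {𝕜 : Type*} [RCLike 𝕜] (p : ℝ) (b : Rn n → 𝕜) : ℝ≥0∞ :=
  (⨆ (x₀ : Rn n) (r : ℝ) (_ : 0 < r),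
    ⨍⁻ y in ball x₀ r, ‖b y - ballConst b x₀ r‖ₑ ^ p ∂volume) ^ (1 / p)

/-- Membership in `bmo(ℝⁿ)`. -/
def MemBmo {n : ℕ} {𝕜 : Type*} [RCLike 𝕜] (b : Rn n → 𝕜) : Prop :=
  LocallyIntegrable b volume ∧ bmoNorm b < ⊤

/-! ### Inhomogeneous singular integral operators -/

/-- `K` is an inhomogeneous `δ`-kernel: it is locally integrable off the diagonal and there are
`ε > 0` and `C` for which the size and the smoothness estimates hold. -/
def IsInhomogeneousKernel {n : ℕ} {𝕜 : Type*} [RCLike 𝕜] (δ : ℝ) (K : Rn n → Rn n → 𝕜) : Prop :=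
  LocallyIntegrableOn (fun z : Rn n × Rn n => K z.1 z.2) {z | z.1 ≠ z.2} volume ∧
  ∃ ε : ℝ, 0 < ε ∧ ∃ C : ℝ,
    (∀ x y : Rn n, x ≠ y →
      ‖K x y‖ ≤ C * min (‖x - y‖ ^ (-(n : ℝ))) (‖x - y‖ ^ (-(n : ℝ) - ε))) ∧
    (∀ x y z : Rn n, x ≠ y → 2 * ‖y - z‖ ≤ ‖x - y‖ →
      ‖K x y - K x z‖ + ‖K y x - K z x‖ ≤ C * ‖y - z‖ ^ δ * ‖x - y‖ ^ (-(n : ℝ) - δ))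

/-- The bounded operator `T` on `L²(ℝⁿ)` is an inhomogeneous singular integral operator: for some
`δ ∈ (0,1]` there is an inhomogeneous `δ`-kernel `K` such that
`T f (x) = ∫ K(x,y) f(y) dy` for `f ∈ C_c^∞(ℝⁿ)` and (almost every) `x ∉ supp f`. -/
def IsInhomogeneousSIO {n : ℕ} {𝕜 : Type*} [RCLike 𝕜]
    (T : Lp 𝕜 2 (volume : Measure (Rn n)) →L[𝕜] Lp 𝕜 2 (volume : Measure (Rn n))) : Prop :=
  ∃ (δ : ℝ) (K : Rn n → Rn n → 𝕜), 0 < δ ∧ δ ≤ 1 ∧ IsInhomogeneousKernel δ K ∧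
    ∀ (f : Rn n → 𝕜) (hf : ContDiff ℝ ∞ f) (hc : HasCompactSupport f),
      ∀ᵐ x ∂(volume : Measure (Rn n)), x ∉ tsupport f →
        T ((hf.continuous.memLp_of_hasCompactSupport (p := 2) hc).toLp f) x = ∫ y, K x y * f y

/-! ### The commutator -/

/-- The bounded operator `Tp` on `L^p(ℝⁿ)` agrees with `T` on `L² ∩ L^p`. For `1 ≤ p < ⊤` there is
at most one such `Tp`, because `L² ∩ L^p` is dense in `L^p`. -/
def IsLpExtension {n : ℕ} {𝕜 : Type*} [RCLike 𝕜]
    (T : Lp 𝕜 2 (volume : Measure (Rn n)) →L[𝕜] Lp 𝕜 2 (volume : Measure (Rn n)))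
    (p : ℝ≥0∞) [Fact (1 ≤ p)]
    (Tp : Lp 𝕜 p (volume : Measure (Rn n)) →L[𝕜] Lp 𝕜 p (volume : Measure (Rn n))) : Prop :=
  ∀ (f : Rn n → 𝕜) (h2 : MemLp f 2 volume) (hp : MemLp f p volume),
    Tp (hp.toLp f) =ᵐ[volume] T (h2.toLp f)

/-- `h` is (a representative of) `[b,T]f = b T(f) - T(b f)`, for `f ∈ L²` and `b f` in some `L^p`,
`1 < p < ⊤`, where `T(b f)` is the value at `b f` of the bounded extension of `T` to `L^p`
(whose existence is part of the assertion). The values for different `p` agree almost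
everywhere. -/
def IsCommutator {n : ℕ} {𝕜 : Type*} [RCLike 𝕜] (b : Rn n → 𝕜)
    (T : Lp 𝕜 2 (volume : Measure (Rn n)) →L[𝕜] Lp 𝕜 2 (volume : Measure (Rn n)))
    (f h : Rn n → 𝕜) : Prop :=
  ∃ (p : ℝ≥0∞) (_ : Fact (1 ≤ p))
    (Tp : Lp 𝕜 p (volume : Measure (Rn n)) →L[𝕜] Lp 𝕜 p (volume : Measure (Rn n)))
    (hf : MemLp f 2 volume) (hbf : MemLp (fun x => b x * f x) p volume),
    1 < p ∧ p < ⊤ ∧ IsLpExtension T p Tp ∧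
    h =ᵐ[volume] fun x => b x * T (hf.toLp f) x - Tp (hbf.toLp (fun x => b x * f x)) x

/-! ### Atoms -/

/-- `a` is an approximate `h¹_b` atom. The second cancellation condition is an inequality in
`[0, ∞]`; its right-hand side is `‖b‖_{bmo,2} / log(1 + 1/r)`. -/
def IsApproxAtom {n : ℕ} {𝕜 : Type*} [RCLike 𝕜] (b a : Rn n → 𝕜) : Prop :=
  ∃ (x₀ : Rn n) (r : ℝ), 0 < r ∧
    (∀ᵐ x ∂(volume : Measure (Rn n)), x ∉ ball x₀ r → a x = 0) ∧
    MemLp a 2 volume ∧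
    eLpNorm a 2 volume ≤ volume (ball x₀ r) ^ (-(1 / 2 : ℝ)) ∧
    ‖∫ x, a x‖ ≤ 1 / Real.log (1 + r⁻¹) ^ 2 ∧
    ‖∫ x, a x * (b x - ballConst b x₀ r)‖ₑ
      ≤ bmoNormP 2 b / ENNReal.ofReal (Real.log (1 + r⁻¹))

/-- The space `h¹_{finite,b}(ℝⁿ)` of finite linear combinations of approximate `h¹_b` atoms. -/
def finiteAtomic {n : ℕ} {𝕜 : Type*} [RCLike 𝕜] (b : Rn n → 𝕜) : Submodule 𝕜 (Rn n → 𝕜) :=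
  Submodule.span 𝕜 {a | IsApproxAtom b a}

end

end LocalHardy

/-! Constants commute with T, so for an atom a on B = B(x₀,r) the symbol b may be replaced by g = b
- c_B, and the function to integrate is g·T(a) - T(g·a).

On the ball of radius 4r Hölder's inequality suffices: T is bounded on L², its extension is bounded
on L^{4/3}, and John–Nirenberg bounds the L² and L⁴ means of g by ‖b‖_bmo
(`IsAtomOn.lintegral_near_mul_apply_le`, `IsAtomOn.lintegral_near_apply_mul_le`).

Away from that ball the kernel is frozen at the centre: T(a)(x) is K(x,x₀)∫a plus an error of size
r^δ|x-x₀|^{-n-δ}, and likewise for T(g·a) (`HasKernel.norm_sub_le`). The errors are summable over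
dyadic annuli even against |g|, whose mean over the ball of radius 2^k r grows only linearly in k.
In the main terms |K(·,x₀)| decays integrably only beyond the unit scale, so about log(1+1/r) annuli
count in full: integrating |K(·,x₀)| costs one logarithm, integrating |g||K(·,x₀)| costs two. These
are exactly the powers provided by the bounds on ∫ g·a and ∫ a in the definition of an atom
(`IsAtomOn.lintegral_far_le`).

The classical input is proved along the way. Vitali-type stopping balls (`exists_stopping_balls`)
give a Calderón–Zygmund decomposition, hence weak type (1,1), and interpolation with L² then gives
the extension to L^{4/3} (`exists_isLpExtension`). The same balls drive the John–Nirenberg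
inequality (`lintegral_oscillation_pow_le`). With one extension fixed, the commutator is linear in
f, which settles finite combinations of atoms; `IsCommutator.ae_eq` makes the conclusion independent
of the extension chosen. -/

namespace LocalHardy

open Filter Topology Set

/-! ### Volumes of balls and the stopping-ball selection. -/

section Balls

variable {n : ℕ}

theorem volume_closedBall_of_pos (x : Rn n) {r : ℝ} (hr : 0 < r) :
    volume (closedBall x r) = ENNReal.ofReal (r ^ n) * volume (closedBall (0 : Rn n) 1) := by
  have h := Measure.addHaar_closedBall_mul_of_pos (volume : Measure (Rn n)) x hr 1
  simpa using h

theorem volume_closedBall_mul_le (x y : Rn n) {c : ℝ} (hc : 0 < c) (r : ℝ) :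
    volume (closedBall x (c * r)) ≤ ENNReal.ofReal (c ^ n) * volume (closedBall y r) := by
  have h := Measure.addHaar_closedBall_mul_of_pos (volume : Measure (Rn n)) x hc r
  rw [h, Measure.addHaar_closedBall_center volume y r]
  simp

theorem volume_closedBall_pos (x : Rn n) {r : ℝ} (hr : 0 < r) : 0 < volume (closedBall x r) :=
  measure_closedBall_pos _ _ hr

theorem volume_closedBall_ne_top (x : Rn n) (r : ℝ) : volume (closedBall x r) ≠ ⊤ :=
  measure_closedBall_lt_top.ne

/-- Spheres are null. The definitions use open balls, the covering and annulus arguments closed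
ones; this passes between them. -/
theorem ball_ae_eq_closedBall [Nontrivial (Rn n)] (x : Rn n) (r : ℝ) :
    (ball x r : Set (Rn n)) =ᵐ[volume] closedBall x r := by
  rw [← ball_union_sphere]
  exact (union_ae_eq_left_of_ae_eq_empty
    (ae_eq_empty.2 (Measure.addHaar_sphere volume x r))).symm

theorem volume_closedBall_of_nonpos [Nontrivial (Rn n)] (x : Rn n) {r : ℝ} (hr : r ≤ 0) :
    volume (closedBall x r) = 0 := by
  rw [← measure_congr (ball_ae_eq_closedBall x r), ball_eq_empty.2 hr, measure_empty]

/-- Radii of balls on which a fixed lower bound for the volume fails are bounded. -/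
theorem exists_radius_bound [Nontrivial (Rn n)] {A : ℝ≥0∞} (hA : A ≠ ⊤) :
    ∃ R : ℝ, ∀ (x : Rn n) (r : ℝ), volume (closedBall x r) ≤ A → r ≤ R := by
  set v := volume (closedBall (0 : Rn n) 1) with hv
  have hv0 : v ≠ 0 := (volume_closedBall_pos _ one_pos).ne'
  have hvt : v ≠ ⊤ := volume_closedBall_ne_top _ _
  refine ⟨max 1 (A / v).toReal, fun x r h => ?_⟩
  rcases le_or_gt r 1 with h1 | h1
  · exact h1.trans (le_max_left _ _)
  have hr0 : 0 < r := one_pos.trans h1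
  rw [volume_closedBall_of_pos x hr0] at h
  have h2 : ENNReal.ofReal (r ^ n) ≤ A / v := (ENNReal.le_div_iff_mul_le (.inl hv0) (.inl hvt)).2 h
  have h3 : r ^ n ≤ (A / v).toReal :=
    (ENNReal.ofReal_le_iff_le_toReal (ENNReal.div_ne_top hA hv0)).1 h2
  have hn : n ≠ 0 := by
    rintro rfl
    exact not_subsingleton (Rn 0) inferInstance
  exact ((le_self_pow₀ h1.le hn).trans h3).trans (le_max_right _ _)

/-- Calderón–Zygmund selection: disjoint balls on which the average of `F` is at least `t`, such
that the average over the five times larger balls is at most `t` and these cover `{F > t}` up to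
a null set. Balls of negative radius serve as padding. -/
theorem exists_stopping_balls [Nontrivial (Rn n)] {F : Rn n → ℝ≥0∞} (hF : AEMeasurable F volume)
    (hFi : ∫⁻ y, F y ≠ ⊤) {t : ℝ≥0∞} (ht0 : t ≠ 0) (ht : t ≠ ⊤) :
    ∃ (x : ℕ → Rn n) (ρ : ℕ → ℝ),
      Pairwise (Function.onFun Disjoint fun i => closedBall (x i) (ρ i)) ∧
      (∀ i, t * volume (closedBall (x i) (ρ i)) ≤ ∫⁻ y in closedBall (x i) (ρ i), F y) ∧
      (∀ i, ∫⁻ y in closedBall (x i) (5 * ρ i), F y ≤ t * volume (closedBall (x i) (5 * ρ i))) ∧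
      ∀ᵐ y ∂(volume : Measure (Rn n)), y ∉ ⋃ i, closedBall (x i) (5 * ρ i) → F y ≤ t := by
  obtain ⟨R, hR⟩ := exists_radius_bound (n := n) (ENNReal.div_ne_top hFi ht0)
  let S : Rn n → Set ℝ := fun x =>
    {r | 0 < r ∧ t * volume (closedBall x r) < ∫⁻ y in closedBall x r, F y}
  have hSR : ∀ x, ∀ r ∈ S x, r ≤ R := fun x r hr => hR x r <| by
    rw [ENNReal.le_div_iff_mul_le (.inl ht0) (.inl ht), mul_comm]
    exact hr.2.le.trans (setLIntegral_le_lintegral _ _)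
  let E : Set (Rn n) := {x | (S x).Nonempty}
  -- Any radius in `S x` beyond half of the supremum will do: five times it exceeds the supremum, so
  -- the enlarged ball is not in `S x` and its average is at most `t`.
  have hsel : ∀ x, ∃ r, x ∈ E → r ∈ S x ∧ ∀ s ∈ S x, s < 5 * r := by
    intro x
    by_cases hx : x ∈ E
    swap
    · exact ⟨0, fun h => absurd h hx⟩
    have hb : BddAbove (S x) := ⟨R, fun r hr => hSR x r hr⟩
    obtain ⟨s, hs⟩ := id hx
    have hpos : 0 < sSup (S x) := hs.1.trans_le (le_csSup hb hs)
    obtain ⟨r, hr, hr2⟩ := exists_lt_of_lt_csSup hx (half_lt_self hpos)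
    refine ⟨r, fun _ => ⟨hr, fun s hs => ?_⟩⟩
    have := le_csSup hb hs
    have := hr.1
    linarith
  choose rad hrad using hsel
  obtain ⟨u, huE, hdisj, hcov⟩ := Vitali.exists_disjoint_subfamily_covering_enlargement_closedBall
    E (fun x => x) rad R (fun x hx => hSR x _ (hrad x hx).1) 5 (by norm_num)
  have hcount : u.Countable := hdisj.countable_of_nonempty_interior fun x hx => by
    have hp := (hrad x (huE hx)).1.1
    exact ⟨x, ball_subset_interior_closedBall (mem_ball_self hp)⟩
  obtain ⟨f, hf⟩ := hcount.to_subtype.exists_injective_nat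
  classical
  let x : ℕ → Rn n := fun i => if h : ∃ a : u, f a = i then (h.choose : Rn n) else 0
  -- The default must be negative, not zero: the padding balls and their dilates are then empty,
  -- whereas radius zero would repeat one singleton and break disjointness.
  let ρ : ℕ → ℝ := fun i => if h : ∃ a : u, f a = i then rad h.choose else -1
  have hneg : ∀ i, (¬ ∃ a : u, f a = i) → ρ i = -1 := fun i h => by simp only [ρ, dif_neg h]
  have hval : ∀ a : u, x (f a) = a ∧ ρ (f a) = rad a := by
    intro a
    have h : ∃ b : u, f b = f a := ⟨a, rfl⟩
    have h2 : h.choose = a := hf h.choose_spec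
    simp only [x, ρ, dif_pos h, h2, and_self]
  refine ⟨x, ρ, ?_, ?_, ?_, ?_⟩
  · intro i j hij
    by_cases hi : ∃ a : u, f a = i
    · by_cases hj : ∃ a : u, f a = j
      · obtain ⟨a, rfl⟩ := hi
        obtain ⟨b, rfl⟩ := hj
        simp only [Function.onFun, (hval a).1, (hval a).2, (hval b).1, (hval b).2]
        exact hdisj a.2 b.2 fun h => hij (by rw [Subtype.ext h])
      · simp [Function.onFun, hneg j hj]
    · simp [Function.onFun, hneg i hi]
  · intro i
    by_cases hi : ∃ a : u, f a = i
    · obtain ⟨a, rfl⟩ := hi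
      rw [(hval a).1, (hval a).2]
      exact (hrad a (huE a.2)).1.2.le
    · simp [hneg i hi]
  · intro i
    by_cases hi : ∃ a : u, f a = i
    · obtain ⟨a, rfl⟩ := hi
      rw [(hval a).1, (hval a).2]
      have ha := hrad a (huE a.2)
      by_contra! hcon
      exact lt_irrefl _ (ha.2 _ ⟨mul_pos (by norm_num) ha.1.1, hcon⟩)
    · simp [hneg i hi]
  · have hEsub : ∀ y ∈ E, y ∈ ⋃ i, closedBall (x i) (5 * ρ i) := by
      intro y hy
      obtain ⟨b, hb, hsub⟩ := hcov y hy
      refine mem_iUnion.2 ⟨f ⟨b, hb⟩, ?_⟩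
      rw [(hval ⟨b, hb⟩).1, (hval ⟨b, hb⟩).2]
      exact hsub (mem_closedBall_self (hrad y hy).1.1.le)
    -- Lebesgue differentiation: off `E` every ball average is at most `t`, so almost everywhere its
    -- limit `F y` is too.
    filter_upwards [VitaliFamily.ae_tendsto_lintegral_div
      (Besicovitch.vitaliFamily (volume : Measure (Rn n))) hF hFi] with y hy hyu
    have hyE : y ∉ E := fun h => hyu (hEsub y h)
    have hy' := hy.comp (Besicovitch.tendsto_filterAt volume y)
    refine le_of_tendsto hy' ?_
    filter_upwards [self_mem_nhdsWithin] with r (hr : 0 < r)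
    have h1 : ∫⁻ z in closedBall y r, F z ≤ t * volume (closedBall y r) := by
      by_contra! hcon
      exact hyE ⟨r, hr, hcon⟩
    exact ENNReal.div_le_of_le_mul h1

end Balls

/-! ### Kernel estimates and the off-diagonal representation. -/

section Kernel

variable {n : ℕ} {𝕜 : Type*} [RCLike 𝕜]

/-- The kernel estimates that are used, with explicit constants. -/
structure KernelBounds (δ ε C : ℝ) (K : Rn n → Rn n → 𝕜) : Prop where
  delta_pos : 0 < δ
  eps_pos : 0 < ε
  const_nonneg : 0 ≤ C
  size : ∀ x y, x ≠ y → ‖K x y‖ ≤ C * ‖x - y‖ ^ (-(n : ℝ))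
  decay : ∀ x y, x ≠ y → ‖K x y‖ ≤ C * ‖x - y‖ ^ (-(n : ℝ) - ε)
  smooth : ∀ x y z, x ≠ y → 2 * ‖y - z‖ ≤ ‖x - y‖ →
    ‖K x y - K x z‖ ≤ C * ‖y - z‖ ^ δ * ‖x - y‖ ^ (-(n : ℝ) - δ)

theorem IsInhomogeneousKernel.exists_kernelBounds {δ : ℝ} (hδ : 0 < δ) {K : Rn n → Rn n → 𝕜}
    (hK : IsInhomogeneousKernel δ K) : ∃ ε C, KernelBounds δ ε C K := by
  obtain ⟨-, ε, hε, C, h1, h2⟩ := hK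
  -- The definition prescribes no sign for the constant, hence the absolute value.
  refine ⟨ε, |C|, hδ, hε, abs_nonneg C, fun x y hxy => (h1 x y hxy).trans ?_,
    fun x y hxy => (h1 x y hxy).trans ?_, fun x y z hxy hyz => ?_⟩
  · exact mul_le_mul (le_abs_self C) (min_le_left _ _) (by positivity) (abs_nonneg C)
  · exact mul_le_mul (le_abs_self C) (min_le_right _ _) (by positivity) (abs_nonneg C)
  · calc ‖K x y - K x z‖ ≤ ‖K x y - K x z‖ + ‖K y x - K z x‖ :=
          le_add_of_nonneg_right (norm_nonneg _)
      _ ≤ _ := h2 x y z hxy hyz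
      _ ≤ _ := by
        gcongr
        exact le_abs_self C

/-- `S` acts on test functions by integration against `K` off the support. -/
def HasKernel (K : Rn n → Rn n → 𝕜) (s : ℝ≥0∞) [Fact (1 ≤ s)]
    (S : Lp 𝕜 s (volume : Measure (Rn n)) →L[𝕜] Lp 𝕜 s (volume : Measure (Rn n))) : Prop :=
  ∀ (f : Rn n → 𝕜) (hf : ContDiff ℝ ∞ f) (hc : HasCompactSupport f),
    ∀ᵐ x ∂(volume : Measure (Rn n)), x ∉ tsupport f →
      S ((hf.continuous.memLp_of_hasCompactSupport (p := s) hc).toLp f) x = ∫ y, K x y * f y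

/-- The representation is tested only on smooth compactly supported functions, which lie in both L²
and L^p, where the two operators agree. -/
theorem HasKernel.of_extension {K : Rn n → Rn n → 𝕜}
    {T : Lp 𝕜 2 (volume : Measure (Rn n)) →L[𝕜] Lp 𝕜 2 (volume : Measure (Rn n))}
    (hT : HasKernel K 2 T) {p : ℝ≥0∞} [Fact (1 ≤ p)]
    {Tp : Lp 𝕜 p (volume : Measure (Rn n)) →L[𝕜] Lp 𝕜 p (volume : Measure (Rn n))}
    (h : IsLpExtension T p Tp) : HasKernel K p Tp := by
  intro f hf hc
  filter_upwards [hT f hf hc, h f (hf.continuous.memLp_of_hasCompactSupport hc)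
    (hf.continuous.memLp_of_hasCompactSupport hc)] with x hx h2 hxs
  rw [h2, hx hxs]

variable {δ ε C : ℝ} {K : Rn n → Rn n → 𝕜}

/-- The smoothness estimate is Hölder continuity in the second variable away from the diagonal. It
makes `K x y * f y` continuous with compact support off `tsupport f`, so that the integral in the
representation converges and is linear in its integrand. -/
theorem KernelBounds.continuousAt (hK : KernelBounds δ ε C K) {x y : Rn n} (hxy : x ≠ y) :
    ContinuousAt (K x) y := by
  have hpos : 0 < ‖x - y‖ := norm_pos_iff.2 (sub_ne_zero.2 hxy)
  refine tendsto_iff_norm_sub_tendsto_zero.2 ?_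
  have hlim : Tendsto (fun z => C * ‖y - z‖ ^ δ * ‖x - y‖ ^ (-(n : ℝ) - δ)) (𝓝 y) (𝓝 0) := by
    have h1 : Tendsto (fun z => ‖y - z‖) (𝓝 y) (𝓝 0) := by
      have : Continuous fun z => ‖y - z‖ := by fun_prop
      simpa using this.tendsto y
    have h2 := (h1.rpow_const (p := δ) (.inr hK.delta_pos.le))
    rw [Real.zero_rpow hK.delta_pos.ne'] at h2
    simpa using (h2.const_mul C).mul_const (‖x - y‖ ^ (-(n : ℝ) - δ))
  refine squeeze_zero' (.of_forall fun _ => norm_nonneg _) ?_ hlim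
  filter_upwards [ball_mem_nhds y (half_pos hpos)] with z hz
  rw [mem_ball, dist_comm, dist_eq_norm] at hz
  rw [norm_sub_rev]
  exact hK.smooth x y z hxy (by linarith)

theorem KernelBounds.continuous_mul (hK : KernelBounds δ ε C K) {f : Rn n → 𝕜}
    (hf : Continuous f) {x : Rn n} (hx : x ∉ tsupport f) : Continuous fun y => K x y * f y := by
  refine continuous_iff_continuousAt.2 fun y => ?_
  by_cases hxy : x = y
  · subst hxy
    have : (fun y => K x y * f y) =ᶠ[𝓝 x] fun _ => 0 := by
      filter_upwards [notMem_tsupport_iff_eventuallyEq.1 hx] with y hy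
      simp [hy]
    exact this.continuousAt
  · exact (hK.continuousAt hxy).mul hf.continuousAt

/-- Replace `K x y` by `K x x₀` under the integral. Since the support lies in the ball of radius 2r
and |x - x₀| is at least 4r, the smoothness estimate applies to every y in the support. -/
theorem norm_integral_kernel_sub_le (hK : KernelBounds δ ε C K) {f : Rn n → 𝕜}
    (hf : Continuous f) (hc : HasCompactSupport f) {x₀ : Rn n} {r : ℝ} (hr : 0 < r)
    (hs : tsupport f ⊆ closedBall x₀ (2 * r)) {x : Rn n} (hx : 4 * r ≤ ‖x - x₀‖) :
    ‖(∫ y, K x y * f y) - K x x₀ * ∫ y, f y‖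
      ≤ C * (2 * r) ^ δ * ‖x - x₀‖ ^ (-(n : ℝ) - δ) * ∫ y, ‖f y‖ := by
  have hxx : x ≠ x₀ := by
    rintro rfl
    rw [sub_self, norm_zero] at hx
    linarith
  have hxs : x ∉ tsupport f := fun h => by
    have := hs h
    rw [mem_closedBall, dist_eq_norm] at this
    linarith
  have hfi : Integrable f := hf.integrable_of_hasCompactSupport hc
  have hi : Integrable fun y => K x y * f y :=
    (hK.continuous_mul hf hxs).integrable_of_hasCompactSupport hc.mul_left
  rw [← integral_const_mul, ← integral_sub hi (hfi.const_mul _), ← integral_const_mul]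
  refine norm_integral_le_of_norm_le (hfi.norm.const_mul _) (.of_forall fun y => ?_)
  by_cases hy : y ∈ tsupport f
  · have h1 : ‖x₀ - y‖ ≤ 2 * r := by
      have := hs hy
      rwa [mem_closedBall, dist_comm, dist_eq_norm] at this
    rw [← sub_mul, norm_mul, norm_sub_rev (K x y)]
    have h2 := hK.smooth x x₀ y hxx (by linarith)
    have := hK.const_nonneg
    have := hK.delta_pos
    refine mul_le_mul_of_nonneg_right (h2.trans ?_) (norm_nonneg _)
    gcongr
  · simp [image_eq_zero_of_notMem_tsupport hy]

/-- Smooth approximation in `L^s` of functions supported in a ball by functions supported in the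
double ball. -/
theorem exists_smooth_approx {s : ℝ≥0∞} (hs1 : 1 ≤ s) (hst : s ≠ ⊤) {f : Rn n → 𝕜}
    (hf : MemLp f s volume) {x₀ : Rn n} {r : ℝ} (hr : 0 < r)
    (hsupp : ∀ᵐ x ∂(volume : Measure (Rn n)), x ∉ closedBall x₀ r → f x = 0) {η : ℝ}
    (hη : 0 < η) :
    ∃ g : Rn n → 𝕜, ContDiff ℝ ∞ g ∧ HasCompactSupport g ∧ tsupport g ⊆ closedBall x₀ (2 * r) ∧
      eLpNorm (f - g) s volume ≤ ENNReal.ofReal η := by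
  obtain ⟨φ, hφc, hφ, hle⟩ := hf.exist_eLpNorm_sub_le hst hs1 hη
  let χ : ContDiffBump x₀ := ⟨r, 2 * r, hr, by linarith⟩
  have hsm : ContDiff ℝ ∞ fun x => (χ x : ℝ) • φ x := χ.contDiff.smul hφ
  have hcs : HasCompactSupport fun x => (χ x : ℝ) • φ x := hφc.smul_left (f := fun x => (χ x : ℝ))
  have hts : tsupport (fun x => (χ x : ℝ) • φ x) ⊆ closedBall x₀ (2 * r) :=
    (tsupport_smul_subset_left (fun x => (χ x : ℝ)) φ).trans χ.tsupport_eq.subset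
  refine ⟨fun x => (χ x : ℝ) • φ x, hsm, hcs, hts, le_trans (eLpNorm_mono_ae ?_) hle⟩
  filter_upwards [hsupp] with x hx
  have h1 : f x = (χ x : ℝ) • f x := by
    by_cases h : x ∈ closedBall x₀ r
    · rw [χ.one_of_mem_closedBall h, one_smul]
    · simp [hx h]
  have h2 : (f - fun x => (χ x : ℝ) • φ x) x = (χ x : ℝ) • (f - φ) x := by
    rw [Pi.sub_apply, Pi.sub_apply, smul_sub, ← h1]
  rw [h2, norm_smul]
  refine mul_le_of_le_one_left (norm_nonneg _) ?_
  rw [Real.norm_of_nonneg χ.nonneg]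
  exact χ.le_one

/-- Hölder's inequality on the common ball, which has finite measure. -/
theorem tendsto_eLpNorm_one_of_support {s : ℝ≥0∞} (hs1 : 1 ≤ s) {g : ℕ → Rn n → 𝕜}
    (hg : ∀ k, AEStronglyMeasurable (g k) volume) {x₀ : Rn n} {r : ℝ}
    (hsupp : ∀ k, ∀ᵐ x ∂(volume : Measure (Rn n)), x ∉ closedBall x₀ r → g k x = 0)
    (hlim : Tendsto (fun k => eLpNorm (g k) s volume) atTop (𝓝 0)) :
    Tendsto (fun k => eLpNorm (g k) 1 volume) atTop (𝓝 0) := by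
  set c := volume (closedBall x₀ r) ^ (1 / (1 : ℝ≥0∞).toReal - 1 / s.toReal) with hc
  have hct : c ≠ ⊤ := by
    refine ENNReal.rpow_ne_top_of_nonneg ?_ (volume_closedBall_ne_top _ _)
    rcases eq_or_ne s ⊤ with rfl | hst
    · simp
    · have : 1 ≤ s.toReal := by simpa using (ENNReal.toReal_le_toReal (by simp) hst).2 hs1
      simp only [ENNReal.toReal_one, div_one, one_div, sub_nonneg]
      exact inv_le_one_of_one_le₀ this
  have hb : ∀ k, eLpNorm (g k) 1 volume ≤ eLpNorm (g k) s volume * c := fun k => by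
    have he : eLpNorm (g k) 1 volume = eLpNorm (g k) 1 (volume.restrict (closedBall x₀ r)) := by
      rw [← eLpNorm_indicator_eq_eLpNorm_restrict measurableSet_closedBall]
      refine eLpNorm_congr_ae ?_
      filter_upwards [hsupp k] with x hx
      by_cases h : x ∈ closedBall x₀ r
      · rw [indicator_of_mem h]
      · rw [indicator_of_notMem h, hx h]
    rw [he]
    refine (eLpNorm_le_eLpNorm_mul_rpow_measure_univ hs1 (hg k).restrict).trans ?_
    rw [Measure.restrict_apply_univ]
    gcongr
    exact Measure.restrict_le_self
  have h0 : Tendsto (fun k => eLpNorm (g k) s volume * c) atTop (𝓝 0) := by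
    simpa using ENNReal.Tendsto.mul_const hlim (.inr hct)
  exact tendsto_of_tendsto_of_tendsto_of_le_of_le tendsto_const_nhds h0 (fun _ => zero_le) hb

/-- The off-diagonal estimate for an operator with kernel `K` on a function supported in a ball. -/
theorem HasKernel.norm_sub_le (hK : KernelBounds δ ε C K) {s : ℝ≥0∞} [Fact (1 ≤ s)] (hst : s ≠ ⊤)
    {S : Lp 𝕜 s (volume : Measure (Rn n)) →L[𝕜] Lp 𝕜 s (volume : Measure (Rn n))}
    (hS : HasKernel K s S) {f : Rn n → 𝕜} (hf : MemLp f s volume) {x₀ : Rn n} {r : ℝ} (hr : 0 < r)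
    (hsupp : ∀ᵐ x ∂(volume : Measure (Rn n)), x ∉ closedBall x₀ r → f x = 0) :
    ∀ᵐ x ∂(volume : Measure (Rn n)), 4 * r ≤ ‖x - x₀‖ →
      ‖S (hf.toLp f) x - K x x₀ * ∫ y, f y‖
        ≤ C * (2 * r) ^ δ * ‖x - x₀‖ ^ (-(n : ℝ) - δ) * ∫ y, ‖f y‖ := by
  have hs1 : 1 ≤ s := Fact.out
  have hη : ∀ k : ℕ, (0 : ℝ) < 1 / ((k : ℝ) + 1) := fun k => Nat.one_div_pos_of_nat
  choose g hgd hgc hgs hgle using fun k : ℕ => exists_smooth_approx hs1 hst hf hr hsupp (hη k)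
  have hgm : ∀ k, MemLp (g k) s volume := fun k =>
    (hgd k).continuous.memLp_of_hasCompactSupport (hgc k)
  have hlim : Tendsto (fun k => eLpNorm (g k - f) s volume) atTop (𝓝 0) := by
    have h0 : Tendsto (fun k : ℕ => ENNReal.ofReal (1 / ((k : ℝ) + 1))) atTop (𝓝 0) := by
      simpa using ENNReal.tendsto_ofReal tendsto_one_div_add_atTop_nhds_zero_nat
    refine tendsto_of_tendsto_of_tendsto_of_le_of_le tendsto_const_nhds h0 (fun _ => zero_le)
      fun k => ?_
    simp only
    rw [eLpNorm_sub_comm]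
    exact hgle k
  have hsub : ∀ k, ∀ᵐ x ∂(volume : Measure (Rn n)),
      x ∉ closedBall x₀ (2 * r) → (g k - f) x = 0 := fun k => by
    filter_upwards [hsupp] with x hx hx2
    have h1 : x ∉ closedBall x₀ r := fun h => hx2 (closedBall_subset_closedBall (by linarith) h)
    have h2 : g k x = 0 := image_eq_zero_of_notMem_tsupport fun h => hx2 (hgs k h)
    simp [hx h1, h2]
  have hlim1 := tendsto_eLpNorm_one_of_support hs1
    (fun k => ((hgm k).sub hf).aestronglyMeasurable) hsub hlim
  have hgi : ∀ k, Integrable (g k) := fun k =>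
    (hgd k).continuous.integrable_of_hasCompactSupport (hgc k)
  have hfi : Integrable f := by
    obtain ⟨k, hk⟩ := (hlim1.eventually (gt_mem_nhds ENNReal.zero_lt_top)).exists
    have h1 : MemLp (g k - f) 1 volume := ⟨((hgm k).sub hf).aestronglyMeasurable, hk⟩
    have h2 := (hgi k).sub (memLp_one_iff_integrable.1 h1)
    simpa using h2
  have hI : Tendsto (fun k => ∫ y, g k y) atTop (𝓝 (∫ y, f y)) :=
    tendsto_integral_of_L1' f hfi.1 (.of_forall hgi) hlim1
  have hN : Tendsto (fun k => ∫ y, ‖g k y‖) atTop (𝓝 (∫ y, ‖f y‖)) := by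
    refine tendsto_integral_of_L1' (F := fun k y => ‖g k y‖) (fun y => ‖f y‖) hfi.norm.1
      (.of_forall fun k => (hgi k).norm) ?_
    refine tendsto_of_tendsto_of_tendsto_of_le_of_le tendsto_const_nhds hlim1 (fun _ => zero_le)
      fun k => ?_
    refine eLpNorm_mono fun y => ?_
    exact abs_norm_sub_norm_le _ _
  have hLp : Tendsto (fun k => (hgm k).toLp (g k)) atTop (𝓝 (hf.toLp f)) :=
    (Lp.tendsto_Lp_iff_tendsto_eLpNorm'' _ hgm f hf).2 hlim
  have hSlim := (S.continuous.tendsto _).comp hLp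
  obtain ⟨φ, hφ, hae⟩ := (tendstoInMeasure_of_tendsto_Lp hSlim).exists_seq_tendsto_ae
  have hall : ∀ᵐ x ∂(volume : Measure (Rn n)), ∀ k, x ∉ tsupport (g k) →
      S ((hgm k).toLp (g k)) x = ∫ y, K x y * g k y := ae_all_iff.2 fun k => hS _ (hgd k) (hgc k)
  -- The inequality for test functions involves only `S g` at x, the integral of `g` and that of its
  -- norm. Each converges along the subsequence, so no limit has to be taken under the kernel.
  filter_upwards [hae, hall] with x hx hxk h4
  have hlhs : Tendsto (fun k => ‖S ((hgm (φ k)).toLp (g (φ k))) x - K x x₀ * ∫ y, g (φ k) y‖)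
      atTop (𝓝 ‖S (hf.toLp f) x - K x x₀ * ∫ y, f y‖) :=
    (hx.sub ((hI.comp hφ.tendsto_atTop).const_mul _)).norm
  refine le_of_tendsto_of_tendsto' hlhs
    ((hN.comp hφ.tendsto_atTop).const_mul (C * (2 * r) ^ δ * ‖x - x₀‖ ^ (-(n : ℝ) - δ)))
    fun k => ?_
  have hxs : x ∉ tsupport (g (φ k)) := fun h => by
    have := hgs _ h
    rw [mem_closedBall, dist_eq_norm] at this
    linarith
  rw [hxk _ hxs]
  exact norm_integral_kernel_sub_le hK (hgd _).continuous (hgc _) hr (hgs _) h4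

end Kernel

/-! ### Sums over dyadic annuli. -/

section Annuli

variable {n : ℕ}

/-- On each dyadic annulus the decreasing weight is at most its value at the inner radius, and the
annulus lies in the ball of its outer radius. -/
theorem setLIntegral_le_tsum_annuli {v : ℝ → ℝ≥0∞} (hv : AntitoneOn v (Ioi 0))
    (hvt : ∀ t, v t ≠ ⊤) (F : Rn n → ℝ≥0∞) (x₀ : Rn n) {R : ℝ} (hR : 0 < R) :
    ∫⁻ x in {x | R ≤ ‖x - x₀‖}, F x * v ‖x - x₀‖
      ≤ ∑' k : ℕ, v (2 ^ k * R) * ∫⁻ x in closedBall x₀ (2 ^ (k + 1) * R), F x := by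
  let A : ℕ → Set (Rn n) := fun k => {x | 2 ^ k * R ≤ ‖x - x₀‖ ∧ ‖x - x₀‖ < 2 ^ (k + 1) * R}
  have hA : {x | R ≤ ‖x - x₀‖} ⊆ ⋃ k, A k := by
    intro x (hx : R ≤ ‖x - x₀‖)
    obtain ⟨k, hk1, hk2⟩ := exists_nat_pow_near ((one_le_div hR).2 hx) one_lt_two
    exact mem_iUnion.2 ⟨k, (le_div_iff₀ hR).1 hk1, (div_lt_iff₀ hR).1 hk2⟩
  have hAm : ∀ k, MeasurableSet (A k) := fun k =>
    (measurableSet_le measurable_const (by fun_prop : Measurable fun x => ‖x - x₀‖)).inter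
      (measurableSet_lt (by fun_prop : Measurable fun x => ‖x - x₀‖) measurable_const)
  refine (lintegral_mono_set hA).trans ((lintegral_iUnion_le _ _).trans ?_)
  refine ENNReal.tsum_le_tsum fun k => ?_
  have hpos : 0 < 2 ^ k * R := by positivity
  calc ∫⁻ x in A k, F x * v ‖x - x₀‖ ≤ ∫⁻ x in A k, v (2 ^ k * R) * F x := by
        refine setLIntegral_mono' (hAm k) fun x hx => ?_
        rw [mul_comm]
        gcongr
        exact hv hpos (hpos.trans_le hx.1) hx.1
    _ ≤ ∫⁻ x in closedBall x₀ (2 ^ (k + 1) * R), v (2 ^ k * R) * F x := by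
        refine lintegral_mono_set fun x hx => ?_
        rw [mem_closedBall, dist_eq_norm]
        exact hx.2.le
    _ ≤ v (2 ^ k * R) * ∫⁻ x in closedBall x₀ (2 ^ (k + 1) * R), F x := by
        rw [lintegral_const_mul' _ _ (hvt _)]

/-- The dominating series for sums over dyadic annuli. -/
noncomputable def geomSum (q : ℝ≥0∞) : ℝ≥0∞ := ∑' j : ℕ, ((j : ℝ≥0∞) + 2) * q ^ j

theorem tsum_natCast_pow_mul_geometric_ne_top (m : ℕ) {q : ℝ≥0∞} (hq : q < 1) :
    ∑' j : ℕ, (j : ℝ≥0∞) ^ m * q ^ j ≠ ⊤ := by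
  lift q to ℝ≥0 using hq.ne_top
  have hq1 : ‖(q : ℝ)‖ < 1 := by
    rw [Real.norm_of_nonneg q.coe_nonneg]
    exact_mod_cast hq
  have h := summable_pow_mul_geometric_of_norm_lt_one m hq1
  have h2 : Summable fun j : ℕ => ((j : ℝ≥0) ^ m * q ^ j) := by
    rw [← NNReal.summable_coe]
    simpa using h
  have h3 := ENNReal.tsum_coe_ne_top_iff_summable.2 h2
  simpa using h3

theorem geomSum_ne_top {q : ℝ≥0∞} (hq : q < 1) : geomSum q ≠ ⊤ := by
  have h1 := tsum_natCast_pow_mul_geometric_ne_top 1 hq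
  have h0 := tsum_natCast_pow_mul_geometric_ne_top 0 hq
  have : geomSum q = ∑' j : ℕ, (j : ℝ≥0∞) ^ 1 * q ^ j + 2 * ∑' j : ℕ, (j : ℝ≥0∞) ^ 0 * q ^ j := by
    rw [geomSum, ← ENNReal.tsum_mul_left, ← ENNReal.tsum_add]
    refine tsum_congr fun j => ?_
    ring
  rw [this]
  exact ENNReal.add_ne_top.2 ⟨h1, ENNReal.mul_ne_top (by simp) h0⟩

theorem ofReal_two_rpow_neg_lt_one {δ : ℝ} (hδ : 0 < δ) : ENNReal.ofReal (2 ^ (-δ)) < 1 := by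
  rw [ENNReal.ofReal_lt_one]
  exact Real.rpow_lt_one_of_one_lt_of_neg one_lt_two (neg_neg_of_pos hδ)

/-- The constant in the estimates over dyadic annuli. -/
noncomputable def annulusConst (n : ℕ) (δ : ℝ) : ℝ≥0∞ :=
  ENNReal.ofReal (2 ^ n) * volume (closedBall (0 : Rn n) 1) *
    (4 * (1 + geomSum (ENNReal.ofReal (2 ^ (-δ)))))

theorem annulusConst_ne_top (n : ℕ) {δ : ℝ} (hδ : 0 < δ) : annulusConst n δ ≠ ⊤ := by
  refine ENNReal.mul_ne_top (ENNReal.mul_ne_top (by simp) (volume_closedBall_ne_top _ _)) ?_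
  refine ENNReal.mul_ne_top (by simp) ?_
  exact ENNReal.add_ne_top.2 ⟨by simp, geomSum_ne_top (ofReal_two_rpow_neg_lt_one hδ)⟩

theorem antitoneOn_ofReal_rpow {a : ℝ} (ha : a ≤ 0) :
    AntitoneOn (fun t : ℝ => ENNReal.ofReal (t ^ a)) (Ioi 0) := fun _ hs _ _ hst =>
  ENNReal.ofReal_le_ofReal (Real.rpow_le_rpow_of_nonpos hs hst ha)

/-- The factor |x - x₀|^{-n} cancels the volume of the k-th ball up to 2^n, leaving R^{-δ} 2^{-kδ},
whose sum converges in spite of the linear growth allowed to `F`. -/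
theorem setLIntegral_mul_rpow_le {δ : ℝ} (hδ : 0 < δ) {F : Rn n → ℝ≥0∞} {x₀ : Rn n} {R : ℝ}
    (hR : 0 < R) {D : ℝ≥0∞}
    (hF : ∀ k : ℕ, ∫⁻ x in closedBall x₀ (2 ^ k * R), F x
      ≤ ((k : ℝ≥0∞) + 1) * D * volume (closedBall x₀ (2 ^ k * R))) :
    ∫⁻ x in {x | R ≤ ‖x - x₀‖}, F x * ENNReal.ofReal (‖x - x₀‖ ^ (-(n : ℝ) - δ))
      ≤ annulusConst n δ * ENNReal.ofReal (R ^ (-δ)) * D := by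
  have hn : (0 : ℝ) ≤ n := n.cast_nonneg
  set V := volume (closedBall (0 : Rn n) 1) with hV
  set q := ENNReal.ofReal (2 ^ (-δ)) with hq
  refine (setLIntegral_le_tsum_annuli (antitoneOn_ofReal_rpow (by linarith))
    (fun _ => ENNReal.ofReal_ne_top) F x₀ hR).trans ?_
  have hterm : ∀ k : ℕ, ENNReal.ofReal ((2 ^ k * R) ^ (-(n : ℝ) - δ)) *
      ∫⁻ x in closedBall x₀ (2 ^ (k + 1) * R), F x
      ≤ ENNReal.ofReal (2 ^ n) * V * ENNReal.ofReal (R ^ (-δ)) * D *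
        (((k : ℝ≥0∞) + 2) * q ^ k) := fun k => by
    have hp : 0 < 2 ^ k * R := by positivity
    have h1 : ENNReal.ofReal ((2 ^ k * R) ^ (-(n : ℝ) - δ)) *
        ENNReal.ofReal ((2 ^ (k + 1) * R) ^ n)
        = ENNReal.ofReal (2 ^ n) * ENNReal.ofReal (R ^ (-δ)) * q ^ k := by
      rw [hq, ← ENNReal.ofReal_pow (by positivity), ← ENNReal.ofReal_mul (by positivity),
        ← ENNReal.ofReal_mul (by positivity), ← ENNReal.ofReal_mul (by positivity)]
      congr 1
      rw [sub_eq_add_neg, Real.rpow_add hp, Real.rpow_neg hp.le, Real.rpow_natCast,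
        show (2 : ℝ) ^ (k + 1) * R = 2 * (2 ^ k * R) by ring, mul_pow 2 (2 ^ k * R),
        Real.mul_rpow (by positivity : (0 : ℝ) ≤ 2 ^ k) hR.le, ← Real.rpow_natCast 2 k,
        ← Real.rpow_mul (by norm_num : (0 : ℝ) ≤ 2), ← Real.rpow_natCast (2 ^ (-δ)) k,
        ← Real.rpow_mul (by norm_num : (0 : ℝ) ≤ 2), mul_comm (k : ℝ) (-δ)]
      have : (2 ^ (k : ℝ) * R) ^ n ≠ 0 := by positivity
      field_simp
    calc _ ≤ ENNReal.ofReal ((2 ^ k * R) ^ (-(n : ℝ) - δ)) *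
          ((((k + 1 : ℕ) : ℝ≥0∞) + 1) * D * volume (closedBall x₀ (2 ^ (k + 1) * R))) := by
          gcongr
          exact hF (k + 1)
      _ = (ENNReal.ofReal ((2 ^ k * R) ^ (-(n : ℝ) - δ)) *
          ENNReal.ofReal ((2 ^ (k + 1) * R) ^ n)) * (((k : ℝ≥0∞) + 2) * D * V) := by
          rw [volume_closedBall_of_pos x₀ (by positivity : 0 < 2 ^ (k + 1) * R)]
          push_cast
          ring
      _ ≤ _ := by
          rw [h1]
          exact le_of_eq (by ring)
  refine (ENNReal.tsum_le_tsum hterm).trans ?_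
  rw [ENNReal.tsum_mul_left]
  change _ * geomSum q ≤ _
  rw [annulusConst, ← hV, ← hq]
  have : geomSum q ≤ 4 * (1 + geomSum q) := by
    calc geomSum q ≤ 1 + geomSum q := le_add_self
      _ ≤ 4 * (1 + geomSum q) := le_mul_of_one_le_left' (by norm_num)
  calc _ ≤ ENNReal.ofReal (2 ^ n) * V * ENNReal.ofReal (R ^ (-δ)) * D *
        (4 * (1 + geomSum q)) := by gcongr
    _ = _ := by ring

/-- The number of dyadic scales between `R` and `1` is at most logarithmic. -/
theorem exists_scale {R : ℝ} (hR : 0 < R) :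
    ∃ N : ℕ, 1 ≤ 2 ^ N * R ∧ (N : ℝ) + 1 ≤ 2 * (1 + Real.log (1 + R⁻¹)) := by
  have hL : 0 ≤ Real.log (1 + R⁻¹) := Real.log_nonneg (by simp [hR.le])
  have hl2 : 1 / 2 < Real.log 2 := by linarith [Real.log_two_gt_d9]
  -- The least N with 2^N ≥ 1 + 1/R. The factor 2 in the bound comes from log 2 > 1/2.
  refine ⟨⌈Real.log (1 + R⁻¹) / Real.log 2⌉₊, ?_, ?_⟩
  · have h1 := Nat.le_ceil (Real.log (1 + R⁻¹) / Real.log 2)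
    rw [div_le_iff₀ (by linarith), ← Real.log_pow] at h1
    have h2 := (Real.log_le_log_iff (by positivity) (by positivity)).1 h1
    calc 1 = R⁻¹ * R := by field_simp
      _ ≤ _ := by
        gcongr
        linarith
  · have h1 := Nat.ceil_lt_add_one (div_nonneg hL (by linarith : 0 ≤ Real.log 2))
    have h2 : Real.log (1 + R⁻¹) / Real.log 2 ≤ 2 * Real.log (1 + R⁻¹) := by
      rw [div_le_iff₀ (by linarith)]
      nlinarith
    linarith

/-- Below the unit scale, k < N, the minimum is only bounded by 1 and the terms contribute N·M; from
N on, 2^N R ≥ 1 makes the minimum at most 2^{-jε}, and the rest is a convergent series. -/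
theorem tsum_mul_min_le {ε R : ℝ} (hε : 0 < ε) {d : ℕ → ℝ≥0∞} {M : ℝ≥0∞} {N : ℕ}
    (hN : 1 ≤ 2 ^ N * R) (h1 : ∀ k < N, d k ≤ M) (h2 : ∀ j, d (j + N) ≤ M * ((j : ℝ≥0∞) + 2)) :
    ∑' k, d k * ENNReal.ofReal (min 1 ((2 ^ k * R) ^ (-ε)))
      ≤ (N + geomSum (ENNReal.ofReal (2 ^ (-ε)))) * M := by
  set q := ENNReal.ofReal (2 ^ (-ε)) with hq
  rw [← Summable.sum_add_tsum_nat_add' (k := N) ENNReal.summable, add_mul]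
  refine add_le_add ?_ ?_
  · calc _ ≤ ∑ k ∈ Finset.range N, M := by
          refine Finset.sum_le_sum fun k hk => ?_
          calc _ ≤ M * 1 := by
                gcongr
                · exact h1 k (Finset.mem_range.1 hk)
                · rw [ENNReal.ofReal_le_one]
                  exact min_le_left _ _
            _ = M := mul_one M
      _ = N * M := by simp
  · rw [geomSum, ← ENNReal.tsum_mul_right]
    refine ENNReal.tsum_le_tsum fun j => ?_
    have h3 : ENNReal.ofReal (min 1 ((2 ^ (j + N) * R) ^ (-ε))) ≤ q ^ j := by
      rw [hq, ← ENNReal.ofReal_pow (by positivity)]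
      refine ENNReal.ofReal_le_ofReal ((min_le_right _ _).trans ?_)
      rw [← Real.rpow_natCast (2 ^ (-ε)) j, ← Real.rpow_mul zero_le_two, mul_comm (-ε),
        Real.rpow_mul zero_le_two, Real.rpow_natCast]
      refine Real.rpow_le_rpow_of_nonpos (by positivity) ?_ (by linarith)
      rw [pow_add, mul_assoc]
      exact le_mul_of_one_le_right (by positivity) hN
    calc _ ≤ M * ((j : ℝ≥0∞) + 2) * q ^ j := by
          gcongr
          exact h2 j
      _ = _ := by ring

/-- After the n-th powers cancel against the volumes, what is left of the kernel bound on the k-th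
annulus is min(1, (2^k R)^{-ε}). -/
theorem setLIntegral_mul_min_le_tsum {ε : ℝ} (hε : 0 < ε) {F : Rn n → ℝ≥0∞} {x₀ : Rn n} {R : ℝ}
    (hR : 0 < R) {d : ℕ → ℝ≥0∞} {D : ℝ≥0∞}
    (hF : ∀ k : ℕ, ∫⁻ x in closedBall x₀ (2 ^ (k + 1) * R), F x
      ≤ d k * D * volume (closedBall x₀ (2 ^ (k + 1) * R))) :
    ∫⁻ x in {x | R ≤ ‖x - x₀‖}, F x *
        ENNReal.ofReal (min (‖x - x₀‖ ^ (-(n : ℝ))) (‖x - x₀‖ ^ (-(n : ℝ) - ε)))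
      ≤ ENNReal.ofReal (2 ^ n) * volume (closedBall (0 : Rn n) 1) * D *
        ∑' k, d k * ENNReal.ofReal (min 1 ((2 ^ k * R) ^ (-ε))) := by
  have hn : (0 : ℝ) ≤ n := n.cast_nonneg
  have hanti : AntitoneOn (fun t : ℝ =>
      ENNReal.ofReal (min (t ^ (-(n : ℝ))) (t ^ (-(n : ℝ) - ε)))) (Ioi 0) := fun s hs t _ hst =>
    ENNReal.ofReal_le_ofReal (min_le_min (Real.rpow_le_rpow_of_nonpos hs hst (by linarith))
      (Real.rpow_le_rpow_of_nonpos hs hst (by linarith)))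
  refine (setLIntegral_le_tsum_annuli hanti (fun _ => ENNReal.ofReal_ne_top) F x₀ hR).trans ?_
  rw [← ENNReal.tsum_mul_left]
  refine ENNReal.tsum_le_tsum fun k => ?_
  have hp : 0 < 2 ^ k * R := by positivity
  have h1 : ENNReal.ofReal (min ((2 ^ k * R) ^ (-(n : ℝ))) ((2 ^ k * R) ^ (-(n : ℝ) - ε))) *
      ENNReal.ofReal ((2 ^ (k + 1) * R) ^ n)
      = ENNReal.ofReal (2 ^ n) * ENNReal.ofReal (min 1 ((2 ^ k * R) ^ (-ε))) := by
    rw [← ENNReal.ofReal_mul (by positivity), ← ENNReal.ofReal_mul (by positivity)]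
    congr 1
    have h3 : min ((2 ^ k * R) ^ (-(n : ℝ))) ((2 ^ k * R) ^ (-(n : ℝ) - ε))
        = (2 ^ k * R) ^ (-(n : ℝ)) * min 1 ((2 ^ k * R) ^ (-ε)) := by
      rw [mul_min_of_nonneg _ _ (by positivity), mul_one, sub_eq_add_neg, Real.rpow_add hp]
    rw [h3, show (2 : ℝ) ^ (k + 1) * R = 2 * (2 ^ k * R) by ring, mul_pow 2 (2 ^ k * R),
      Real.rpow_neg hp.le, Real.rpow_natCast]
    have : (2 ^ k * R) ^ n ≠ 0 := by positivity
    field_simp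
  calc _ ≤ ENNReal.ofReal (min ((2 ^ k * R) ^ (-(n : ℝ))) ((2 ^ k * R) ^ (-(n : ℝ) - ε))) *
        (d k * D * volume (closedBall x₀ (2 ^ (k + 1) * R))) := by
        gcongr
        exact hF k
    _ = (ENNReal.ofReal (min ((2 ^ k * R) ^ (-(n : ℝ))) ((2 ^ k * R) ^ (-(n : ℝ) - ε))) *
        ENNReal.ofReal ((2 ^ (k + 1) * R) ^ n)) *
          (d k * D * volume (closedBall (0 : Rn n) 1)) := by
        rw [volume_closedBall_of_pos x₀ (by positivity : 0 < 2 ^ (k + 1) * R)]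
        ring
    _ = _ := by
        rw [h1]
        ring

/-- For uniformly bounded means each of the roughly log(1+1/R) scales below one costs the same
amount: one logarithm in total. -/
theorem setLIntegral_mul_min_le {ε : ℝ} (hε : 0 < ε) {F : Rn n → ℝ≥0∞} {x₀ : Rn n} {R : ℝ}
    (hR : 0 < R) {D : ℝ≥0∞}
    (hF : ∀ k : ℕ, ∫⁻ x in closedBall x₀ (2 ^ k * R), F x
      ≤ D * volume (closedBall x₀ (2 ^ k * R))) :
    ∫⁻ x in {x | R ≤ ‖x - x₀‖}, F x *
        ENNReal.ofReal (min (‖x - x₀‖ ^ (-(n : ℝ))) (‖x - x₀‖ ^ (-(n : ℝ) - ε)))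
      ≤ annulusConst n ε * ENNReal.ofReal (1 + Real.log (1 + R⁻¹)) * D := by
  obtain ⟨N, hN, hN2⟩ := exists_scale hR
  have hNe : (N : ℝ≥0∞) + 1 ≤ 2 * ENNReal.ofReal (1 + Real.log (1 + R⁻¹)) := by
    have := ENNReal.ofReal_le_ofReal hN2
    rw [ENNReal.ofReal_mul (by norm_num), ENNReal.ofReal_add (by positivity) one_pos.le] at this
    simpa using this
  refine (setLIntegral_mul_min_le_tsum (d := fun _ => 1) (D := D) hε hR
    fun k => by simpa using hF (k + 1)).trans ?_
  have h := tsum_mul_min_le (d := fun _ => 1) (M := 1) hε hN (fun _ _ => le_rfl)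
    (fun j => by
      rw [one_mul]
      exact one_le_two.trans le_add_self)
  set q := ENNReal.ofReal (2 ^ (-ε)) with hq
  have h3 : (N + geomSum q) * 1 ≤ 4 * (1 + geomSum q) *
      ENNReal.ofReal (1 + Real.log (1 + R⁻¹)) := by
    calc (N + geomSum q) * 1 ≤ (N + 1) * (1 + geomSum q) := by
          rw [mul_one, add_mul, one_mul, mul_add, mul_one, add_assoc]
          gcongr
          exact le_add_self.trans le_add_self
      _ ≤ 2 * ENNReal.ofReal (1 + Real.log (1 + R⁻¹)) * (1 + geomSum q) := by gcongr
      _ ≤ 4 * ENNReal.ofReal (1 + Real.log (1 + R⁻¹)) * (1 + geomSum q) := by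
          gcongr
          norm_num
      _ = _ := by ring
  calc _ ≤ ENNReal.ofReal (2 ^ n) * volume (closedBall (0 : Rn n) 1) * D *
        (4 * (1 + geomSum q) * ENNReal.ofReal (1 + Real.log (1 + R⁻¹))) := by
        gcongr
        exact h.trans h3
    _ = _ := by
        rw [annulusConst, ← hq]
        ring

/-- The k-th scale may now cost a multiple of k, so the scales below one add up to the square of
their number: two logarithms. -/
theorem setLIntegral_mul_min_le_of_linear {ε : ℝ} (hε : 0 < ε) {F : Rn n → ℝ≥0∞} {x₀ : Rn n}
    {R : ℝ} (hR : 0 < R) {D : ℝ≥0∞}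
    (hF : ∀ k : ℕ, ∫⁻ x in closedBall x₀ (2 ^ k * R), F x
      ≤ ((k : ℝ≥0∞) + 1) * D * volume (closedBall x₀ (2 ^ k * R))) :
    ∫⁻ x in {x | R ≤ ‖x - x₀‖}, F x *
        ENNReal.ofReal (min (‖x - x₀‖ ^ (-(n : ℝ))) (‖x - x₀‖ ^ (-(n : ℝ) - ε)))
      ≤ annulusConst n ε * ENNReal.ofReal (1 + Real.log (1 + R⁻¹)) ^ 2 * D := by
  obtain ⟨N, hN, hN2⟩ := exists_scale hR
  have hNe : (N : ℝ≥0∞) + 1 ≤ 2 * ENNReal.ofReal (1 + Real.log (1 + R⁻¹)) := by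
    have := ENNReal.ofReal_le_ofReal hN2
    rw [ENNReal.ofReal_mul (by norm_num), ENNReal.ofReal_add (by positivity) one_pos.le] at this
    simpa using this
  refine (setLIntegral_mul_min_le_tsum (d := fun k => (k : ℝ≥0∞) + 2) (D := D) hε hR
    fun k => (hF (k + 1)).trans (le_of_eq (by push_cast; ring))).trans ?_
  -- One M serves both ranges: k + 2 ≤ N + 1 for k < N, and j + N + 2 ≤ (N + 1)(j + 2) beyond.
  have h := tsum_mul_min_le (d := fun k => (k : ℝ≥0∞) + 2) (M := N + 1) hε hN
    (fun k hk => by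
      have : k + 2 ≤ N + 1 := by omega
      exact_mod_cast this)
    (fun j => by
      have : j + N + 2 ≤ (N + 1) * (j + 2) := by nlinarith [Nat.zero_le (N * j)]
      exact_mod_cast this)
  set q := ENNReal.ofReal (2 ^ (-ε)) with hq
  have h3 : (N + geomSum q) * ((N : ℝ≥0∞) + 1) ≤ 4 * (1 + geomSum q) *
      ENNReal.ofReal (1 + Real.log (1 + R⁻¹)) ^ 2 := by
    calc (N + geomSum q) * ((N : ℝ≥0∞) + 1) ≤ ((N + 1) * (1 + geomSum q)) * (N + 1) := by
          refine mul_le_mul_left ?_ _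
          rw [add_mul, one_mul, mul_add, mul_one, add_assoc]
          gcongr
          exact le_add_self.trans le_add_self
      _ ≤ (2 * ENNReal.ofReal (1 + Real.log (1 + R⁻¹)) * (1 + geomSum q)) *
          (2 * ENNReal.ofReal (1 + Real.log (1 + R⁻¹))) := by gcongr
      _ = _ := by ring
  calc _ ≤ ENNReal.ofReal (2 ^ n) * volume (closedBall (0 : Rn n) 1) * D *
        (4 * (1 + geomSum q) * ENNReal.ofReal (1 + Real.log (1 + R⁻¹)) ^ 2) := by
        gcongr
        exact h.trans h3
    _ = _ := by
        rw [annulusConst, ← hq]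
        ring

end Annuli

/-! ### Norm bounds for the operators and the off-diagonal majorant. -/

section Operators

variable {n : ℕ} {𝕜 : Type*} [RCLike 𝕜]

theorem eLpNorm_apply_toLp_le {s : ℝ≥0∞} [Fact (1 ≤ s)]
    (S : Lp 𝕜 s (volume : Measure (Rn n)) →L[𝕜] Lp 𝕜 s (volume : Measure (Rn n)))
    {f : Rn n → 𝕜} (hf : MemLp f s volume) :
    eLpNorm (S (hf.toLp f)) s volume ≤ ‖S‖ₑ * eLpNorm f s volume := by
  rw [← Lp.enorm_def, ← Lp.enorm_toLp hf]
  exact S.le_opENorm _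

theorem eLpNorm_two_sq {α E : Type*} [MeasurableSpace α] {μ : Measure α} [NormedAddCommGroup E]
    (f : α → E) : eLpNorm f 2 μ ^ 2 = ∫⁻ x, ‖f x‖ₑ ^ 2 ∂μ := by
  have h := eLpNorm_nnreal_pow_eq_lintegral (μ := μ) (f := f) (p := 2) two_ne_zero
  simpa using h

theorem lintegral_enorm_apply_sq_le
    (T : Lp 𝕜 2 (volume : Measure (Rn n)) →L[𝕜] Lp 𝕜 2 (volume : Measure (Rn n)))
    {f : Rn n → 𝕜} (hf : MemLp f 2 volume) :
    ∫⁻ x, ‖T (hf.toLp f) x‖ₑ ^ 2 ≤ ‖T‖ₑ ^ 2 * ∫⁻ x, ‖f x‖ₑ ^ 2 := by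
  rw [← eLpNorm_two_sq, ← eLpNorm_two_sq, ← mul_pow]
  exact pow_le_pow_left' (eLpNorm_apply_toLp_le T hf) 2

theorem ofReal_integral_norm_le_lintegral {α E : Type*} [MeasurableSpace α] {μ : Measure α}
    [NormedAddCommGroup E] (f : α → E) : ENNReal.ofReal (∫ x, ‖f x‖ ∂μ) ≤ ∫⁻ x, ‖f x‖ₑ ∂μ := by
  rw [← Real.enorm_of_nonneg (integral_nonneg fun x => norm_nonneg (f x))]
  refine (enorm_integral_le_lintegral_enorm _).trans (le_of_eq ?_)
  simp

theorem measurableSet_far (x₀ : Rn n) (R : ℝ) : MeasurableSet {x : Rn n | R ≤ ‖x - x₀‖} :=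
  measurableSet_le measurable_const (by fun_prop : Measurable fun x => ‖x - x₀‖)

/-- Weighted integral of the majorant in the off-diagonal estimate. -/
theorem setLIntegral_mul_offDiagonal_le {δ C : ℝ} (hδ : 0 < δ) (hC : 0 ≤ C) {x₀ : Rn n} {r : ℝ}
    (hr : 0 < r) {w : Rn n → ℝ≥0∞} {D : ℝ≥0∞}
    (hw : ∀ k : ℕ, ∫⁻ x in closedBall x₀ (2 ^ k * (4 * r)), w x
      ≤ ((k : ℝ≥0∞) + 1) * D * volume (closedBall x₀ (2 ^ k * (4 * r)))) :
    ∫⁻ x in {x | 4 * r ≤ ‖x - x₀‖},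
        w x * ENNReal.ofReal (C * (2 * r) ^ δ * ‖x - x₀‖ ^ (-(n : ℝ) - δ))
      ≤ ENNReal.ofReal C * annulusConst n δ * D := by
  calc _ = ∫⁻ x in {x | 4 * r ≤ ‖x - x₀‖}, ENNReal.ofReal (C * (2 * r) ^ δ) *
          (w x * ENNReal.ofReal (‖x - x₀‖ ^ (-(n : ℝ) - δ))) := by
        refine lintegral_congr fun x => ?_
        rw [ENNReal.ofReal_mul (by positivity)]
        ring
    _ = ENNReal.ofReal (C * (2 * r) ^ δ) *
          ∫⁻ x in {x | 4 * r ≤ ‖x - x₀‖}, w x * ENNReal.ofReal (‖x - x₀‖ ^ (-(n : ℝ) - δ)) :=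
        lintegral_const_mul' _ _ ENNReal.ofReal_ne_top
    _ ≤ ENNReal.ofReal (C * (2 * r) ^ δ) *
          (annulusConst n δ * ENNReal.ofReal ((4 * r) ^ (-δ)) * D) := by
        gcongr
        exact setLIntegral_mul_rpow_le hδ (by positivity) hw
    _ = (ENNReal.ofReal (C * (2 * r) ^ δ) * ENNReal.ofReal ((4 * r) ^ (-δ))) *
          (annulusConst n δ * D) := by ring
    _ ≤ ENNReal.ofReal C * (annulusConst n δ * D) := by
        gcongr
        rw [← ENNReal.ofReal_mul (by positivity)]
        refine ENNReal.ofReal_le_ofReal ?_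
        rw [mul_assoc]
        refine mul_le_of_le_one_right hC ?_
        rw [Real.rpow_neg (by positivity), ← div_eq_mul_inv, div_le_one (by positivity)]
        gcongr
        norm_num
    _ = _ := by ring

theorem HasKernel.enorm_sub_le {δ ε C : ℝ} {K : Rn n → Rn n → 𝕜} (hK : KernelBounds δ ε C K)
    {s : ℝ≥0∞} [Fact (1 ≤ s)] (hst : s ≠ ⊤)
    {S : Lp 𝕜 s (volume : Measure (Rn n)) →L[𝕜] Lp 𝕜 s (volume : Measure (Rn n))}
    (hS : HasKernel K s S) {f : Rn n → 𝕜} (hf : MemLp f s volume) {x₀ : Rn n} {r : ℝ} (hr : 0 < r)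
    (hsupp : ∀ᵐ x ∂(volume : Measure (Rn n)), x ∉ closedBall x₀ r → f x = 0) :
    ∀ᵐ x ∂(volume : Measure (Rn n)), 4 * r ≤ ‖x - x₀‖ →
      ‖S (hf.toLp f) x - K x x₀ * ∫ y, f y‖ₑ
        ≤ ENNReal.ofReal (C * (2 * r) ^ δ * ‖x - x₀‖ ^ (-(n : ℝ) - δ)) * ∫⁻ y, ‖f y‖ₑ := by
  have hC := hK.const_nonneg
  filter_upwards [hS.norm_sub_le hK hst hf hr hsupp] with x hx hx4
  have h1 := ENNReal.ofReal_le_ofReal (hx hx4)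
  rw [ofReal_norm, ENNReal.ofReal_mul (by positivity)] at h1
  exact h1.trans (by gcongr; exact ofReal_integral_norm_le_lintegral f)

end Operators

/-! ### The Calderón–Zygmund decomposition. -/

section CalderonZygmund

variable {n : ℕ} {𝕜 : Type*} [RCLike 𝕜]

/-- Calderón–Zygmund decomposition at height `t` of an integrable function in `L²`, with finitely
many bad parts, supported in balls whose shrunken copies have small total measure. -/
theorem exists_calderonZygmund_decomposition [Nontrivial (Rn n)] {f : Rn n → 𝕜}
    (hf : MemLp f 2 volume) (hfi : Integrable f) {t : ℝ≥0∞} (ht0 : t ≠ 0) (ht : t ≠ ⊤) :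
    ∃ (N : ℕ) (x : ℕ → Rn n) (ρ : ℕ → ℝ) (b : ℕ → Rn n → 𝕜) (g : Rn n → 𝕜),
      MemLp g 2 volume ∧ (∀ i, MemLp (b i) 2 volume) ∧
      f = g + ∑ i ∈ Finset.range N, b i ∧
      (∀ i, ∀ y ∉ closedBall (x i) (5 * ρ i), b i y = 0) ∧
      (∀ i, ∫ y, b i y = 0) ∧
      ∑ i ∈ Finset.range N, ∫⁻ y, ‖b i y‖ₑ ≤ 2 * ∫⁻ y, ‖f y‖ₑ ∧
      t * ∑' i, volume (closedBall (x i) (ρ i)) ≤ ∫⁻ y, ‖f y‖ₑ ∧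
      ∫⁻ y, ‖g y‖ₑ ^ 2 ≤ (4 * ENNReal.ofReal (5 ^ n) + 6) * t * ∫⁻ y, ‖f y‖ₑ := by
  set I := ∫⁻ y, ‖f y‖ₑ with hI
  have hIt : I ≠ ⊤ := hfi.2.ne
  obtain ⟨x, ρ, hdisj, havg, havg5, hout⟩ :=
    exists_stopping_balls (F := fun y => ‖f y‖ₑ) hf.1.enorm hIt ht0 ht
  set B : ℕ → Set (Rn n) := fun i => closedBall (x i) (ρ i) with hB
  set B' : ℕ → Set (Rn n) := fun i => closedBall (x i) (5 * ρ i) with hB'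
  set Q : ℕ → Set (Rn n) := disjointed B' with hQ
  have hBm : ∀ i, MeasurableSet (B i) := fun i => measurableSet_closedBall
  have hBB : ∀ i, B i ⊆ B' i := fun i => by
    rcases lt_or_ge (ρ i) 0 with h | h
    · simp [hB, closedBall_eq_empty.2 h]
    · exact closedBall_subset_closedBall (by linarith)
  have hQm : ∀ i, MeasurableSet (Q i) := MeasurableSet.disjointed fun i => measurableSet_closedBall
  have hQB : ∀ i, Q i ⊆ B' i := disjointed_subset B'
  have hQd : Pairwise (Function.onFun Disjoint Q) := disjoint_disjointed B'
  have hQU : ⋃ i, Q i = ⋃ i, B' i := iUnion_disjointed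
  have hQsum : ∀ F : Rn n → ℝ≥0∞, ∑' i, ∫⁻ y in Q i, F y ≤ ∫⁻ y, F y := fun F => by
    rw [← lintegral_iUnion hQm hQd]
    exact setLIntegral_le_lintegral _ _
  have hBt : ∀ i, volume (B i) ≠ ⊤ := fun i => volume_closedBall_ne_top _ _
  -- The cells `Q i` partition the union of the enlarged balls but may be arbitrarily small, so the
  -- mass of f on `Q i` is spread over the stopping ball `B i` instead. The `B i` are disjoint and
  -- comparable in volume to `B' i`, so the constants `c i` are at most 5^n t and do not pile up.
  set c : ℕ → 𝕜 := fun i => ((volume (B i)).toReal⁻¹ : ℝ) • ∫ y in Q i, f y with hc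
  have hcV : ∀ i, ‖c i‖ₑ * volume (B i) ≤ ∫⁻ y in Q i, ‖f y‖ₑ := fun i => by
    rcases eq_or_ne (volume (B i)) 0 with h0 | h0
    · simp [h0]
    · have h1 : ‖((volume (B i)).toReal⁻¹ : ℝ)‖ₑ = (volume (B i))⁻¹ := by
        rw [Real.enorm_of_nonneg (by positivity), ENNReal.ofReal_inv_of_pos
          (ENNReal.toReal_pos h0 (hBt i)), ENNReal.ofReal_toReal (hBt i)]
      rw [hc]
      simp only
      rw [enorm_smul, h1, mul_right_comm, ENNReal.inv_mul_cancel h0 (hBt i), one_mul]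
      exact enorm_integral_le_lintegral_enorm _
  have hct : ∀ i, ‖c i‖ₑ ≤ ENNReal.ofReal (5 ^ n) * t := fun i => by
    rcases eq_or_ne (volume (B i)) 0 with h0 | h0
    · simp [hc, h0]
    · have h1 : ‖c i‖ₑ * volume (B i) ≤ ENNReal.ofReal (5 ^ n) * t * volume (B i) := by
        calc _ ≤ ∫⁻ y in Q i, ‖f y‖ₑ := hcV i
          _ ≤ ∫⁻ y in B' i, ‖f y‖ₑ := lintegral_mono_set (hQB i)
          _ ≤ t * volume (B' i) := havg5 i
          _ ≤ t * (ENNReal.ofReal (5 ^ n) * volume (B i)) := by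
            gcongr
            exact volume_closedBall_mul_le _ _ (by norm_num) _
          _ = _ := by ring
      exact (ENNReal.mul_le_mul_iff_left h0 (hBt i)).1 h1
  set b : ℕ → Rn n → 𝕜 := fun i => (Q i).indicator f - (B i).indicator (fun _ => c i) with hb
  have hbm : ∀ i, MemLp (b i) 2 volume := fun i =>
    (hf.indicator (hQm i)).sub (memLp_indicator_const 2 (hBm i) (c i) (.inr (hBt i)))
  have hbi : ∀ i, ∫⁻ y, ‖b i y‖ₑ ≤ 2 * ∫⁻ y in Q i, ‖f y‖ₑ := fun i => by
    calc ∫⁻ y, ‖b i y‖ₑ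
        ≤ ∫⁻ y, ((Q i).indicator (fun y => ‖f y‖ₑ) y + (B i).indicator (fun _ => ‖c i‖ₑ) y) := by
          refine lintegral_mono fun y => ?_
          rw [hb]
          simp only [Pi.sub_apply]
          refine (enorm_sub_le).trans (le_of_eq ?_)
          rw [enorm_indicator_eq_indicator_enorm, enorm_indicator_eq_indicator_enorm]
      _ = (∫⁻ y in Q i, ‖f y‖ₑ) + ‖c i‖ₑ * volume (B i) := by
          rw [lintegral_add_right _ (measurable_const.indicator (hBm i)),
            lintegral_indicator (hQm i), lintegral_indicator_const (hBm i)]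
      _ ≤ _ := by
          rw [two_mul]
          gcongr
          exact hcV i
  have hsupp : ∀ i, ∀ y ∉ B' i, b i y = 0 := fun i y hy => by
    have h1 : y ∉ Q i := fun h => hy (hQB i h)
    have h2 : y ∉ B i := fun h => hy (hBB i h)
    simp [hb, h1, h2]
  have hint : ∀ i, ∫ y, b i y = 0 := fun i => by
    have h1 : Integrable ((B i).indicator fun _ => c i) :=
      (integrable_indicator_iff (hBm i)).2 (integrableOn_const (hBt i))
    rw [hb]
    simp only [Pi.sub_apply]
    rw [integral_sub (hfi.indicator (hQm i)) h1, integral_indicator (hQm i),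
      integral_indicator (hBm i), setIntegral_const, hc, Measure.real, smul_smul]
    rcases eq_or_ne (volume (B i)) 0 with h0 | h0
    · have h2 : volume (Q i) = 0 := by
        refine measure_mono_null (hQB i) ?_
        refine nonpos_iff_eq_zero.1 ?_
        refine (volume_closedBall_mul_le _ (x i) (by norm_num) _).trans ?_
        change ENNReal.ofReal (5 ^ n) * volume (B i) ≤ 0
        simp [h0]
      rw [Measure.restrict_eq_zero.2 h2]
      simp
    · rw [mul_inv_cancel₀ (ENNReal.toReal_pos h0 (hBt i)).ne', one_smul, sub_self]
  -- the number of bad parts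
  obtain ⟨N, hN⟩ : ∃ N : ℕ, ∑' i, ∫⁻ y in Q (i + N), ‖f y‖ₑ ^ 2 ≤ t * I := by
    have h2t : ∫⁻ y, ‖f y‖ₑ ^ 2 ≠ ⊤ := by
      rw [← eLpNorm_two_sq]
      exact ENNReal.pow_ne_top hf.2.ne
    rcases eq_or_ne I 0 with h0 | h0
    · refine ⟨0, ?_⟩
      have h1 := (lintegral_eq_zero_iff' hf.1.enorm).1 h0
      have h2 : ∫⁻ y, ‖f y‖ₑ ^ 2 = 0 := by
        rw [lintegral_congr_ae (g := fun _ => 0) (by filter_upwards [h1] with y hy; simp [hy])]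
        simp
      exact ((hQsum _).trans h2.le).trans zero_le
    · have h1 := ENNReal.tendsto_sum_nat_add _ (((hQsum fun y => ‖f y‖ₑ ^ 2).trans_lt
        h2t.lt_top).ne)
      exact (h1.eventually (ge_mem_nhds (pos_iff_ne_zero.2 (mul_ne_zero ht0 h0)))).exists
  set Ω : Set (Rn n) := ⋃ i, Q i with hΩ
  have hΩm : MeasurableSet Ω := .iUnion hQm
  -- The cells from N on are left in the good part. By the choice of N their L² mass is harmless,
  -- and only finitely many bad parts remain, so linearity of T needs no infinite sum.
  set e : Rn n → 𝕜 := (⋃ i, Q (i + N)).indicator f with he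
  set h : Rn n → 𝕜 := Ωᶜ.indicator f + ∑ i ∈ Finset.range N, (B i).indicator (fun _ => c i) with hh
  have hem : MemLp e 2 volume := hf.indicator (.iUnion fun i => hQm _)
  have hhm : MemLp h 2 volume := (hf.indicator hΩm.compl).add
    (memLp_finsetSum' _ fun i _ => memLp_indicator_const 2 (hBm i) (c i) (.inr (hBt i)))
  have hfe : f = (h + e) + ∑ i ∈ Finset.range N, b i := by
    have h1 : f = Ωᶜ.indicator f + e + ∑ i ∈ Finset.range N, (Q i).indicator f := by
      funext y
      simp only [Pi.add_apply, Finset.sum_apply]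
      by_cases hy : y ∈ Ω
      · obtain ⟨j, hj⟩ := mem_iUnion.1 hy
        have huniq : ∀ i, y ∈ Q i → i = j := fun i hi => by
          by_contra hij
          exact disjoint_left.1 (hQd hij) hi hj
        rw [indicator_of_notMem (notMem_compl_iff.2 hy), zero_add]
        rcases lt_or_ge j N with hjN | hjN
        · have h2 : y ∉ ⋃ i, Q (i + N) := fun h => by
            obtain ⟨i, hi⟩ := mem_iUnion.1 h
            have := huniq _ hi
            omega
          rw [he, indicator_of_notMem h2, zero_add, Finset.sum_eq_single_of_mem j
            (Finset.mem_range.2 hjN) fun i _ hij =>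
              indicator_of_notMem (fun h => hij (huniq i h)) _, indicator_of_mem hj]
        · have h2 : y ∈ ⋃ i, Q (i + N) := mem_iUnion.2 ⟨j - N, by rwa [Nat.sub_add_cancel hjN]⟩
          rw [he, indicator_of_mem h2, Finset.sum_eq_zero, add_zero]
          intro i hi
          refine indicator_of_notMem (fun h => ?_) _
          have := huniq i h
          have := Finset.mem_range.1 hi
          omega
      · have h2 : ∀ i, y ∉ Q i := fun i hi => hy (mem_iUnion.2 ⟨i, hi⟩)
        have h3 : y ∉ ⋃ i, Q (i + N) := fun h => by
          obtain ⟨i, hi⟩ := mem_iUnion.1 h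
          exact h2 _ hi
        rw [indicator_of_mem (show y ∈ Ωᶜ from hy), he, indicator_of_notMem h3]
        simp [h2]
    have h2 : ∑ i ∈ Finset.range N, b i = ∑ i ∈ Finset.range N, (Q i).indicator f -
        ∑ i ∈ Finset.range N, (B i).indicator (fun _ => c i) := by
      rw [hb, ← Finset.sum_sub_distrib]
    rw [h2, hh]
    conv_lhs => rw [h1]
    abel
  have hhb : ∀ᵐ y, ‖h y‖ₑ ≤ t + ENNReal.ofReal (5 ^ n) * t := by
    filter_upwards [hout] with y hy
    rw [hh, Pi.add_apply, Finset.sum_apply]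
    refine (enorm_add_le _ _).trans (add_le_add ?_ ?_)
    · by_cases hyΩ : y ∈ Ω
      · rw [indicator_of_notMem (notMem_compl_iff.2 hyΩ)]
        simp
      · rw [indicator_of_mem (show y ∈ Ωᶜ from hyΩ)]
        rw [hQU] at hyΩ
        exact hy hyΩ
    · by_cases hyB : ∃ j ∈ Finset.range N, y ∈ B j
      · obtain ⟨j, hjN, hj⟩ := hyB
        rw [Finset.sum_eq_single_of_mem j hjN, indicator_of_mem hj]
        · exact hct j
        · intro i _ hij
          exact indicator_of_notMem (fun h => disjoint_left.1 (hdisj hij) h hj) _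
      · push Not at hyB
        rw [Finset.sum_eq_zero fun i hi => indicator_of_notMem (hyB i hi) _]
        simp
  have hh1 : ∫⁻ y, ‖h y‖ₑ ≤ 2 * I := by
    calc ∫⁻ y, ‖h y‖ₑ ≤ ∫⁻ y, (‖f y‖ₑ + ∑ i ∈ Finset.range N,
          (B i).indicator (fun _ => ‖c i‖ₑ) y) := by
          refine lintegral_mono fun y => ?_
          rw [hh, Pi.add_apply, Finset.sum_apply]
          refine (enorm_add_le _ _).trans (add_le_add (enorm_indicator_le_enorm_self _ _) ?_)
          refine (enorm_sum_le _ _).trans (le_of_eq ?_)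
          refine Finset.sum_congr rfl fun i _ => ?_
          rw [enorm_indicator_eq_indicator_enorm]
      _ = I + ∑ i ∈ Finset.range N, ‖c i‖ₑ * volume (B i) := by
          rw [lintegral_add_left' hf.1.enorm, lintegral_finsetSum _
            fun i _ => measurable_const.indicator (hBm i)]
          simp only [lintegral_indicator_const (hBm _)]
          rfl
      _ ≤ I + ∑ i ∈ Finset.range N, ∫⁻ y in Q i, ‖f y‖ₑ := by
          gcongr with i _
          exact hcV i
      _ ≤ I + I := by
          gcongr
          exact (ENNReal.sum_le_tsum _).trans (hQsum _)
      _ = _ := (two_mul I).symm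
  have hh2 : ∫⁻ y, ‖h y‖ₑ ^ 2 ≤ (t + ENNReal.ofReal (5 ^ n) * t) * (2 * I) := by
    calc ∫⁻ y, ‖h y‖ₑ ^ 2 ≤ ∫⁻ y, (t + ENNReal.ofReal (5 ^ n) * t) * ‖h y‖ₑ := by
          refine lintegral_mono_ae ?_
          filter_upwards [hhb] with y hy
          rw [sq]
          gcongr
      _ = (t + ENNReal.ofReal (5 ^ n) * t) * ∫⁻ y, ‖h y‖ₑ := by
          refine lintegral_const_mul' _ _ (ENNReal.add_ne_top.2 ⟨ht, ?_⟩)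
          exact ENNReal.mul_ne_top ENNReal.ofReal_ne_top ht
      _ ≤ _ := by gcongr
  have he2 : ∫⁻ y, ‖e y‖ₑ ^ 2 ≤ t * I := by
    refine le_trans (le_of_eq ?_) hN
    rw [← lintegral_iUnion (s := fun i => Q (i + N)) (fun i => hQm _)
      fun i j hij => hQd fun h => hij (by omega), ← lintegral_indicator (.iUnion fun i => hQm _)]
    refine lintegral_congr fun y => ?_
    by_cases hy : y ∈ ⋃ i, Q (i + N)
    · rw [he, indicator_of_mem hy, indicator_of_mem hy]
    · rw [he, indicator_of_notMem hy, indicator_of_notMem hy]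
      simp
  refine ⟨N, x, ρ, b, h + e, hhm.add hem, hbm, hfe, hsupp, hint, ?_, ?_, ?_⟩
  · calc _ ≤ ∑ i ∈ Finset.range N, 2 * ∫⁻ y in Q i, ‖f y‖ₑ := Finset.sum_le_sum fun i _ => hbi i
      _ = 2 * ∑ i ∈ Finset.range N, ∫⁻ y in Q i, ‖f y‖ₑ := by rw [Finset.mul_sum]
      _ ≤ 2 * I := by
        gcongr
        exact (ENNReal.sum_le_tsum _).trans (hQsum _)
  · rw [← ENNReal.tsum_mul_left]
    calc _ ≤ ∑' i, ∫⁻ y in B i, ‖f y‖ₑ := ENNReal.tsum_le_tsum havg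
      _ = ∫⁻ y in ⋃ i, B i, ‖f y‖ₑ := (lintegral_iUnion hBm hdisj _).symm
      _ ≤ I := setLIntegral_le_lintegral _ _
  -- The constant: `h` is bounded by (1 + 5^n)t with L¹ norm at most 2I, and the square integral of
  -- `e` is at most tI; expanding the square gives 4(1 + 5^n) + 2 = 4·5^n + 6.
  · calc ∫⁻ y, ‖(h + e) y‖ₑ ^ 2 ≤ ∫⁻ y, (2 * ‖h y‖ₑ ^ 2 + 2 * ‖e y‖ₑ ^ 2) := by
          refine lintegral_mono fun y => ?_
          have h1 : ‖(h + e) y‖ₑ ≤ ‖h y‖ₑ + ‖e y‖ₑ := enorm_add_le _ _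
          calc _ ≤ (‖h y‖ₑ + ‖e y‖ₑ) ^ 2 := by gcongr
            _ ≤ _ := by
              have := ENNReal.rpow_add_le_mul_rpow_add_rpow ‖h y‖ₑ ‖e y‖ₑ (p := 2) (by norm_num)
              norm_num at this
              rwa [mul_add] at this
      _ = (2 * ∫⁻ y, ‖h y‖ₑ ^ 2) + 2 * ∫⁻ y, ‖e y‖ₑ ^ 2 := by
          rw [lintegral_add_left' ((hhm.1.enorm.pow_const 2).const_mul 2),
            lintegral_const_mul' _ _ (by simp), lintegral_const_mul' _ _ (by simp)]
      _ ≤ 2 * ((t + ENNReal.ofReal (5 ^ n) * t) * (2 * I)) + 2 * (t * I) := by gcongr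
      _ = _ := by ring

end CalderonZygmund

/-! ### The weak type (1,1) estimate. -/

section WeakType

variable {n : ℕ} {𝕜 : Type*} [RCLike 𝕜]

theorem apply_toLp_add_sum {s : ℝ≥0∞} [Fact (1 ≤ s)]
    (S : Lp 𝕜 s (volume : Measure (Rn n)) →L[𝕜] Lp 𝕜 s (volume : Measure (Rn n)))
    {N : ℕ} {f g : Rn n → 𝕜} {b : ℕ → Rn n → 𝕜} (hf : MemLp f s volume) (hg : MemLp g s volume)
    (hb : ∀ i, MemLp (b i) s volume) (h : f = g + ∑ i ∈ Finset.range N, b i) :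
    ∀ᵐ y ∂(volume : Measure (Rn n)), S (hf.toLp f) y
      = S (hg.toLp g) y + ∑ i ∈ Finset.range N, S ((hb i).toLp (b i)) y := by
  induction N generalizing f with
  | zero =>
    have : f = g := by simpa using h
    subst this
    simp
  | succ N ih =>
    have hf' : MemLp (g + ∑ i ∈ Finset.range N, b i) s volume :=
      hg.add (memLp_finsetSum' _ fun i _ => hb i)
    have h1 : hf.toLp f = hf'.toLp _ + (hb N).toLp (b N) := by
      rw [← MemLp.toLp_add]
      refine MemLp.toLp_congr _ _ (.of_eq ?_)
      rw [h, Finset.sum_range_succ, add_assoc]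
    rw [h1, map_add]
    filter_upwards [ih hf' rfl, Lp.coeFn_add (S (hf'.toLp _)) (S ((hb N).toLp (b N)))] with y h2 h3
    rw [h3, Pi.add_apply, h2, Finset.sum_range_succ, add_assoc]

/-- The constant in the weak type `(1,1)` estimate. -/
noncomputable def weakConst (n : ℕ) (δ C : ℝ) (M : ℝ≥0∞) : ℝ≥0∞ :=
  ENNReal.ofReal (20 ^ n) + 4 * M ^ 2 * (4 * ENNReal.ofReal (5 ^ n) + 6) +
    4 * (ENNReal.ofReal C * annulusConst n δ)

theorem weakConst_ne_top (n : ℕ) {δ : ℝ} (hδ : 0 < δ) (C : ℝ) {M : ℝ≥0∞} (hM : M ≠ ⊤) :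
    weakConst n δ C M ≠ ⊤ := by
  have := annulusConst_ne_top n hδ
  unfold weakConst
  finiteness

/-- The vanishing mean removes the frozen-kernel term and only the integrable error is left. A ball
of nonpositive radius is null, so there `f` is zero almost everywhere. -/
theorem lintegral_far_le_of_integral_eq_zero [Nontrivial (Rn n)] {δ ε C : ℝ}
    {K : Rn n → Rn n → 𝕜} (hK : KernelBounds δ ε C K)
    {T : Lp 𝕜 2 (volume : Measure (Rn n)) →L[𝕜] Lp 𝕜 2 (volume : Measure (Rn n))}
    (hT : HasKernel K 2 T) {f : Rn n → 𝕜} (hf : MemLp f 2 volume) (hfi : Integrable f)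
    {x₀ : Rn n} {r : ℝ} (hsupp : ∀ y ∉ closedBall x₀ r, f y = 0) (hf0 : ∫ y, f y = 0) :
    ∫⁻ y in {y | 4 * r ≤ ‖y - x₀‖}, ‖T (hf.toLp f) y‖ₑ
      ≤ ENNReal.ofReal C * annulusConst n δ * ∫⁻ y, ‖f y‖ₑ := by
  rcases lt_or_ge 0 r with hr | hr
  · have h := setLIntegral_mul_offDiagonal_le hK.delta_pos hK.const_nonneg hr (x₀ := x₀)
      (w := fun _ => 1) (D := 1) (fun k => by
        rw [setLIntegral_one, mul_one]
        exact le_mul_of_one_le_left' le_add_self)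
    simp only [one_mul, mul_one] at h
    calc _ ≤ ∫⁻ y in {y | 4 * r ≤ ‖y - x₀‖},
          ENNReal.ofReal (C * (2 * r) ^ δ * ‖y - x₀‖ ^ (-(n : ℝ) - δ)) * ∫⁻ y, ‖f y‖ₑ := by
          refine lintegral_mono_ae ?_
          filter_upwards [ae_restrict_mem (measurableSet_far x₀ (4 * r)), ae_restrict_of_ae
            (hT.enorm_sub_le hK (by simp) hf hr (.of_forall hsupp))] with y hy hy2
          simpa [hf0] using hy2 hy
      _ = (∫⁻ y in {y | 4 * r ≤ ‖y - x₀‖},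
          ENNReal.ofReal (C * (2 * r) ^ δ * ‖y - x₀‖ ^ (-(n : ℝ) - δ))) * ∫⁻ y, ‖f y‖ₑ :=
          lintegral_mul_const' _ _ hfi.2.ne
      _ ≤ _ := by gcongr
  · have h0 : f =ᵐ[volume] 0 := by
      have h1 : ∀ᵐ y ∂(volume : Measure (Rn n)), y ∉ closedBall x₀ r :=
        measure_eq_zero_iff_ae_notMem.1 (volume_closedBall_of_nonpos x₀ hr)
      filter_upwards [h1] with y hy using hsupp y hy
    have h2 : hf.toLp f = 0 := by
      rw [Lp.eq_zero_iff_ae_eq_zero]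
      exact hf.coeFn_toLp.trans h0
    rw [h2, map_zero]
    refine le_trans (setLIntegral_le_lintegral _ _) (le_trans (le_of_eq ?_) zero_le)
    rw [lintegral_congr_ae (g := fun _ => 0)
      (by filter_upwards [Lp.coeFn_zero 𝕜 2 (volume : Measure (Rn n))] with y _; simp)]
    simp

/-- The weak type `(1,1)` estimate. -/
theorem weak_type_one_one [Nontrivial (Rn n)] {δ ε C : ℝ}
    {K : Rn n → Rn n → 𝕜} (hK : KernelBounds δ ε C K)
    {T : Lp 𝕜 2 (volume : Measure (Rn n)) →L[𝕜] Lp 𝕜 2 (volume : Measure (Rn n))}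
    (hT : HasKernel K 2 T) {f : Rn n → 𝕜} (hf : MemLp f 2 volume) (hfi : Integrable f)
    {t : ℝ≥0∞} (ht0 : t ≠ 0) (ht : t ≠ ⊤) :
    t * volume {y | t < ‖T (hf.toLp f) y‖ₑ} ≤ weakConst n δ C ‖T‖ₑ * ∫⁻ y, ‖f y‖ₑ := by
  obtain ⟨N, x, ρ, b, g, hgm, hbm, hfg, hsupp, hint, hbsum, hvol, hg2⟩ :=
    exists_calderonZygmund_decomposition hf hfi ht0 ht
  set I := ∫⁻ y, ‖f y‖ₑ with hI
  -- The bad parts live in balls of radius 5ρ, and the off-diagonal estimate starts at four times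
  -- that radius, hence 20ρ.
  set Ω : Set (Rn n) := ⋃ i, closedBall (x i) (20 * ρ i) with hΩ
  have hΩm : MeasurableSet Ω := .iUnion fun i => measurableSet_closedBall
  have hbi : ∀ i, Integrable (b i) := fun i => by
    have h1 : IntegrableOn (b i) (closedBall (x i) (5 * ρ i)) :=
      ((hbm i).locallyIntegrable one_le_two).integrableOn_isCompact (isCompact_closedBall _ _)
    exact (integrableOn_iff_integrable_of_support_subset fun y hy => by
      by_contra h
      exact hy (hsupp i y h)).1 h1
  have h1 : t * volume Ω ≤ ENNReal.ofReal (20 ^ n) * I := by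
    calc t * volume Ω ≤ t * ∑' i, volume (closedBall (x i) (20 * ρ i)) := by
          gcongr
          exact measure_iUnion_le _
      _ ≤ t * ∑' i, ENNReal.ofReal (20 ^ n) * volume (closedBall (x i) (ρ i)) := by
          gcongr with i
          exact volume_closedBall_mul_le _ _ (by norm_num) _
      _ = ENNReal.ofReal (20 ^ n) * (t * ∑' i, volume (closedBall (x i) (ρ i))) := by
          rw [ENNReal.tsum_mul_left]
          ring
      _ ≤ _ := by gcongr
  -- Chebyshev in L² gives t² on the left, while the bound for `g` carries a factor t on the right;
  -- one t cancels.
  have h2 : t * volume {y | t / 2 ≤ ‖T (hgm.toLp g) y‖ₑ}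
      ≤ 4 * ‖T‖ₑ ^ 2 * (4 * ENNReal.ofReal (5 ^ n) + 6) * I := by
    have hch := mul_meas_ge_le_lintegral₀ (μ := volume)
      (f := fun y => ‖T (hgm.toLp g) y‖ₑ ^ 2) ((Lp.aestronglyMeasurable _).enorm.pow_const 2)
      ((t / 2) ^ 2)
    have hset : {y | (t / 2) ^ 2 ≤ ‖T (hgm.toLp g) y‖ₑ ^ 2}
        = {y | t / 2 ≤ ‖T (hgm.toLp g) y‖ₑ} := by
      ext y
      exact ENNReal.pow_le_pow_left_iff two_ne_zero
    rw [hset] at hch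
    have h3 : t * (t * volume {y | t / 2 ≤ ‖T (hgm.toLp g) y‖ₑ})
        ≤ t * (4 * ‖T‖ₑ ^ 2 * (4 * ENNReal.ofReal (5 ^ n) + 6) * I) := by
      calc _ = 4 * ((t / 2) ^ 2 * volume {y | t / 2 ≤ ‖T (hgm.toLp g) y‖ₑ}) := by
            have h4 : t = 2 * (t / 2) := (ENNReal.mul_div_cancel (by simp) (by simp)).symm
            generalize volume {y | t / 2 ≤ ‖T (hgm.toLp g) y‖ₑ} = v
            conv_lhs => rw [h4]
            ring
        _ ≤ 4 * (‖T‖ₑ ^ 2 * ((4 * ENNReal.ofReal (5 ^ n) + 6) * t * I)) := by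
            refine mul_le_mul_right (hch.trans ((lintegral_enorm_apply_sq_le T hgm).trans ?_)) _
            gcongr
        _ = _ := by ring
    exact (ENNReal.mul_le_mul_iff_right ht0 ht).1 h3
  have h3 : t * volume ({y | t / 2 ≤ ∑ i ∈ Finset.range N, ‖T ((hbm i).toLp (b i)) y‖ₑ} ∩ Ωᶜ)
      ≤ 4 * (ENNReal.ofReal C * annulusConst n δ) * I := by
    have hm : ∀ i, AEMeasurable (fun y => ‖T ((hbm i).toLp (b i)) y‖ₑ)
        ((volume : Measure (Rn n)).restrict Ωᶜ) := fun i =>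
      (Lp.aestronglyMeasurable _).restrict.enorm
    have hch := mul_meas_ge_le_lintegral₀ (μ := (volume : Measure (Rn n)).restrict Ωᶜ)
      (f := fun y => ∑ i ∈ Finset.range N, ‖T ((hbm i).toLp (b i)) y‖ₑ)
      (Finset.aemeasurable_fun_sum _ fun i _ => hm i) (t / 2)
    rw [Measure.restrict_apply' hΩm.compl] at hch
    calc _ = 2 * (t / 2 * volume ({y | t / 2 ≤ ∑ i ∈ Finset.range N,
            ‖T ((hbm i).toLp (b i)) y‖ₑ} ∩ Ωᶜ)) := by
          rw [← mul_assoc, ENNReal.mul_div_cancel (by simp) (by simp)]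
      _ ≤ 2 * ∫⁻ y in Ωᶜ, ∑ i ∈ Finset.range N, ‖T ((hbm i).toLp (b i)) y‖ₑ := by gcongr
      _ = 2 * ∑ i ∈ Finset.range N, ∫⁻ y in Ωᶜ, ‖T ((hbm i).toLp (b i)) y‖ₑ := by
          rw [lintegral_finsetSum' _ fun i _ => hm i]
      _ ≤ 2 * ∑ i ∈ Finset.range N, ENNReal.ofReal C * annulusConst n δ * ∫⁻ y, ‖b i y‖ₑ := by
          gcongr with i _
          refine le_trans (lintegral_mono_set fun y hy => ?_)
            (lintegral_far_le_of_integral_eq_zero hK hT (hbm i) (hbi i) (hsupp i) (hint i))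
          by_contra hcon
          refine hy (mem_iUnion.2 ⟨i, ?_⟩)
          rw [mem_closedBall, dist_eq_norm]
          simp only [mem_ofPred_eq, not_le] at hcon
          linarith
      _ = 2 * (ENNReal.ofReal C * annulusConst n δ) *
            ∑ i ∈ Finset.range N, ∫⁻ y, ‖b i y‖ₑ := by
          rw [← Finset.mul_sum]
          ring
      _ ≤ 2 * (ENNReal.ofReal C * annulusConst n δ) * (2 * I) := by gcongr
      _ = _ := by ring
  have hsub : volume {y | t < ‖T (hf.toLp f) y‖ₑ} ≤ volume (Ω ∪
      {y | t / 2 ≤ ‖T (hgm.toLp g) y‖ₑ} ∪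
      ({y | t / 2 ≤ ∑ i ∈ Finset.range N, ‖T ((hbm i).toLp (b i)) y‖ₑ} ∩ Ωᶜ)) := by
    refine measure_mono_ae ?_
    filter_upwards [apply_toLp_add_sum T hf hgm hbm hfg] with y hy (hty : t < _)
    by_cases hyΩ : y ∈ Ω
    · exact .inl (.inl hyΩ)
    rcases le_or_gt (t / 2) ‖T (hgm.toLp g) y‖ₑ with hc | hc
    · exact .inl (.inr hc)
    refine .inr ⟨?_, hyΩ⟩
    by_contra! hcon
    simp only [mem_ofPred_eq, not_le] at hcon
    rw [hy] at hty
    refine lt_irrefl t (hty.trans_le ?_)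
    calc _ ≤ ‖T (hgm.toLp g) y‖ₑ + ∑ i ∈ Finset.range N, ‖T ((hbm i).toLp (b i)) y‖ₑ :=
          (enorm_add_le _ _).trans (by gcongr; exact enorm_sum_le _ _)
      _ ≤ t / 2 + t / 2 := add_le_add hc.le hcon.le
      _ = t := ENNReal.add_halves t
  calc _ ≤ t * (volume Ω + volume {y | t / 2 ≤ ‖T (hgm.toLp g) y‖ₑ} + volume
        ({y | t / 2 ≤ ∑ i ∈ Finset.range N, ‖T ((hbm i).toLp (b i)) y‖ₑ} ∩ Ωᶜ)) := by
        gcongr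
        exact hsub.trans ((measure_union_le _ _).trans (by gcongr; exact measure_union_le _ _))
    _ ≤ ENNReal.ofReal (20 ^ n) * I + 4 * ‖T‖ₑ ^ 2 * (4 * ENNReal.ofReal (5 ^ n) + 6) * I +
        4 * (ENNReal.ofReal C * annulusConst n δ) * I := by
        rw [mul_add, mul_add]
        gcongr
    _ = _ := by
        rw [weakConst]
        ring

end WeakType

/-! ### Interpolation between weak type (1,1) and L². -/

section Marcinkiewicz

theorem setLIntegral_rpow_lt_le {a y : ℝ} (ha : -1 < a) (hy : 0 ≤ y) :
    ∫⁻ t in Ioi (0 : ℝ), (Iio y).indicator (fun t => ENNReal.ofReal (t ^ a)) t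
      ≤ ENNReal.ofReal (y ^ (a + 1) / (a + 1)) := by
  have hi : IntegrableOn (fun t : ℝ => t ^ a) (Ioc 0 y) := by
    rw [← intervalIntegrable_iff_integrableOn_Ioc_of_le hy]
    exact intervalIntegral.intervalIntegrable_rpow' ha
  have hval : ∫ t in Ioc 0 y, t ^ a = y ^ (a + 1) / (a + 1) := by
    rw [← intervalIntegral.integral_of_le hy, integral_rpow (.inl ha),
      Real.zero_rpow (by linarith), sub_zero]
  rw [← hval, ofReal_integral_eq_lintegral_ofReal hi
    (by filter_upwards [ae_restrict_mem measurableSet_Ioc] with t ht using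
      Real.rpow_nonneg ht.1.le a), ← lintegral_indicator measurableSet_Ioi,
    ← lintegral_indicator measurableSet_Ioc]
  refine lintegral_mono fun t => ?_
  by_cases h0 : t ∈ Ioi (0 : ℝ)
  · by_cases h1 : t ∈ Iio y
    · rw [indicator_of_mem h0, indicator_of_mem h1, 
        indicator_of_mem (show t ∈ Ioc 0 y from ⟨h0, le_of_lt h1⟩)]
    · rw [indicator_of_mem h0, indicator_of_notMem h1]
      exact zero_le
  · rw [indicator_of_notMem h0]
    exact zero_le

theorem setLIntegral_rpow_ge_le {a y : ℝ} (ha : a < -1) (hy : 0 < y) :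
    ∫⁻ t in Ioi (0 : ℝ), (Ici y).indicator (fun t => ENNReal.ofReal (t ^ a)) t
      ≤ ENNReal.ofReal (-y ^ (a + 1) / (a + 1)) := by
  rw [← integral_Ioi_rpow_of_lt ha hy, ofReal_integral_eq_lintegral_ofReal
    (integrableOn_Ioi_rpow_of_lt ha hy)
    (by filter_upwards [ae_restrict_mem measurableSet_Ioi] with t ht using
      Real.rpow_nonneg (hy.trans ht).le a), 
      setLIntegral_congr (s := Ioi y) (t := Ici y) Ioi_ae_eq_Ici,
    ← lintegral_indicator measurableSet_Ici]
  exact setLIntegral_le_lintegral _ _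

variable {α : Type*} [MeasurableSpace α] {μ : Measure α} [SFinite μ]

/-- By Tonelli the inner integral becomes that of t^{p-2} from 0 to φ(x), which is φ(x)^{p-1}/(p-1);
convergence at zero needs p > 1. -/
theorem lintegral_truncation_large_le {φ : α → ℝ} (hφ : Measurable φ) (hφ0 : ∀ x, 0 ≤ φ x) {p : ℝ}
    (hp : 1 < p) :
    ∫⁻ t in Ioi (0 : ℝ), ENNReal.ofReal (t ^ (p - 2)) *
        ∫⁻ x in {x | t < φ x}, ENNReal.ofReal (φ x) ∂μ
      ≤ ENNReal.ofReal (1 / (p - 1)) * ∫⁻ x, ENNReal.ofReal (φ x ^ p) ∂μ := by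
  have hS : MeasurableSet {z : ℝ × α | z.1 < φ z.2} :=
    measurableSet_lt measurable_fst (hφ.comp measurable_snd)
  have hrw : ∀ t : ℝ, ENNReal.ofReal (t ^ (p - 2)) *
      ∫⁻ x in {x | t < φ x}, ENNReal.ofReal (φ x) ∂μ = ∫⁻ x,
        {z : ℝ × α | z.1 < φ z.2}.indicator
          (fun z => ENNReal.ofReal (z.1 ^ (p - 2)) * ENNReal.ofReal (φ z.2)) (t, x) ∂μ := fun t => by
    rw [← lintegral_const_mul' _ _ ENNReal.ofReal_ne_top,
      ← lintegral_indicator (measurableSet_lt measurable_const hφ)]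
    rfl
  have hG : Measurable ({z : ℝ × α | z.1 < φ z.2}.indicator
      fun z => ENNReal.ofReal (z.1 ^ (p - 2)) * ENNReal.ofReal (φ z.2)) :=
    Measurable.indicator (by fun_prop) hS
  simp_rw [hrw]
  rw [lintegral_lintegral_swap (f := fun t x => {z : ℝ × α | z.1 < φ z.2}.indicator
      (fun z => ENNReal.ofReal (z.1 ^ (p - 2)) * ENNReal.ofReal (φ z.2)) (t, x))
      hG.aemeasurable,
    ← lintegral_const_mul' _ _ ENNReal.ofReal_ne_top]
  refine lintegral_mono fun x => ?_
  calc _ = ∫⁻ t in Ioi (0 : ℝ), ENNReal.ofReal (φ x) *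
        (Iio (φ x)).indicator (fun t => ENNReal.ofReal (t ^ (p - 2))) t := by
        refine lintegral_congr fun t => ?_
        by_cases h : t < φ x
        · rw [indicator_of_mem (show (t, x) ∈ {z : ℝ × α | z.1 < φ z.2} from h),
            indicator_of_mem (show t ∈ Iio (φ x) from h), mul_comm]
        · rw [indicator_of_notMem (show (t, x) ∉ {z : ℝ × α | z.1 < φ z.2} from h),
            indicator_of_notMem (show t ∉ Iio (φ x) from h), mul_zero]
    _ = ENNReal.ofReal (φ x) * ∫⁻ t in Ioi (0 : ℝ),
        (Iio (φ x)).indicator (fun t => ENNReal.ofReal (t ^ (p - 2))) t :=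
        lintegral_const_mul' _ _ ENNReal.ofReal_ne_top
    _ ≤ ENNReal.ofReal (φ x) * ENNReal.ofReal (φ x ^ (p - 2 + 1) / (p - 2 + 1)) := by
        gcongr
        exact setLIntegral_rpow_lt_le (by linarith) (hφ0 x)
    _ = _ := by
        rw [← ENNReal.ofReal_mul (hφ0 x), ← ENNReal.ofReal_mul (by
          rw [one_div, inv_nonneg]
          linarith)]
        congr 1
        rw [show p - 2 + 1 = p - 1 by ring]
        rcases (hφ0 x).eq_or_lt with h0 | h0
        · rw [← h0, Real.zero_rpow (by linarith : p ≠ 0)]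
          simp
        · rw [Real.rpow_sub_one h0.ne']
          field_simp

/-- The companion of `lintegral_truncation_large_le`: t^{p-3} is integrated from φ(x) to infinity,
which gives φ(x)^{p-2}/(2-p) and needs p < 2. -/
theorem lintegral_truncation_small_le {φ : α → ℝ} (hφ : Measurable φ) (hφ0 : ∀ x, 0 ≤ φ x) {p : ℝ}
    (hp : p < 2) :
    ∫⁻ t in Ioi (0 : ℝ), ENNReal.ofReal (t ^ (p - 3)) *
        ∫⁻ x in {x | φ x ≤ t}, ENNReal.ofReal (φ x) ^ 2 ∂μ
      ≤ ENNReal.ofReal (1 / (2 - p)) * ∫⁻ x, ENNReal.ofReal (φ x ^ p) ∂μ := by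
  have hS : MeasurableSet {z : ℝ × α | φ z.2 ≤ z.1} :=
    measurableSet_le (hφ.comp measurable_snd) measurable_fst
  have hrw : ∀ t : ℝ, ENNReal.ofReal (t ^ (p - 3)) *
      ∫⁻ x in {x | φ x ≤ t}, ENNReal.ofReal (φ x) ^ 2 ∂μ = ∫⁻ x,
        {z : ℝ × α | φ z.2 ≤ z.1}.indicator
          (fun z => ENNReal.ofReal (z.1 ^ (p - 3)) * ENNReal.ofReal (φ z.2) ^ 2) (t, x) ∂μ :=
    fun t => by
      rw [← lintegral_const_mul' _ _ ENNReal.ofReal_ne_top,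
        ← lintegral_indicator (measurableSet_le hφ measurable_const)]
      rfl
  have hG : Measurable ({z : ℝ × α | φ z.2 ≤ z.1}.indicator
      fun z => ENNReal.ofReal (z.1 ^ (p - 3)) * ENNReal.ofReal (φ z.2) ^ 2) :=
    Measurable.indicator (by fun_prop) hS
  simp_rw [hrw]
  rw [lintegral_lintegral_swap (f := fun t x => {z : ℝ × α | φ z.2 ≤ z.1}.indicator
      (fun z => ENNReal.ofReal (z.1 ^ (p - 3)) * ENNReal.ofReal (φ z.2) ^ 2) (t, x))
      hG.aemeasurable,
    ← lintegral_const_mul' _ _ ENNReal.ofReal_ne_top]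
  refine lintegral_mono fun x => ?_
  have hsq : ENNReal.ofReal (φ x) ^ 2 ≠ ⊤ := ENNReal.pow_ne_top ENNReal.ofReal_ne_top
  calc _ = ∫⁻ t in Ioi (0 : ℝ), ENNReal.ofReal (φ x) ^ 2 *
        (Ici (φ x)).indicator (fun t => ENNReal.ofReal (t ^ (p - 3))) t := by
        refine lintegral_congr fun t => ?_
        by_cases h : φ x ≤ t
        · rw [indicator_of_mem (show (t, x) ∈ {z : ℝ × α | φ z.2 ≤ z.1} from h),
            indicator_of_mem (show t ∈ Ici (φ x) from h), mul_comm]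
        · rw [indicator_of_notMem (show (t, x) ∉ {z : ℝ × α | φ z.2 ≤ z.1} from h),
            indicator_of_notMem (show t ∉ Ici (φ x) from h), mul_zero]
    _ = ENNReal.ofReal (φ x) ^ 2 * ∫⁻ t in Ioi (0 : ℝ),
        (Ici (φ x)).indicator (fun t => ENNReal.ofReal (t ^ (p - 3))) t :=
        lintegral_const_mul' _ _ hsq
    _ ≤ ENNReal.ofReal (1 / (2 - p)) * ENNReal.ofReal (φ x ^ p) := by
        rcases (hφ0 x).eq_or_lt with h0 | h0
        · simp [← h0]
        calc _ ≤ ENNReal.ofReal (φ x) ^ 2 *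
              ENNReal.ofReal (-φ x ^ (p - 3 + 1) / (p - 3 + 1)) := by
              gcongr
              exact setLIntegral_rpow_ge_le (by linarith) h0
          _ = _ := by
              have h2p : 2 - p ≠ 0 := by linarith
              have h3p : p - 2 ≠ 0 := by linarith
              rw [← ENNReal.ofReal_pow h0.le, ← ENNReal.ofReal_mul (by positivity),
                ← ENNReal.ofReal_mul (by
                  rw [one_div, inv_nonneg]
                  linarith)]
              congr 1
              rw [show p - 3 + 1 = p - (2 : ℕ) by push_cast; ring, Real.rpow_sub_natCast h0.ne']
              push_cast
              rw [show p - 2 = -(2 - p) by ring]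
              field_simp

variable {n : ℕ} {𝕜 : Type*} [RCLike 𝕜]

/-- Cut f at height t. The large part is integrable because |f| ≤ |f|²/t there, so the weak type
estimate applies; the small part is handled by Chebyshev in L². Halving the norm of Tf leaves a
threshold t for each part. -/
theorem volume_superlevel_le [Nontrivial (Rn n)] {δ ε C : ℝ}
    {K : Rn n → Rn n → 𝕜} (hK : KernelBounds δ ε C K)
    {T : Lp 𝕜 2 (volume : Measure (Rn n)) →L[𝕜] Lp 𝕜 2 (volume : Measure (Rn n))}
    (hT : HasKernel K 2 T) {f : Rn n → 𝕜} (hfm : StronglyMeasurable f) (hf : MemLp f 2 volume)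
    {t : ℝ} (ht : 0 < t) :
    volume {y | t < ‖T (hf.toLp f) y‖ / 2}
      ≤ weakConst n δ C ‖T‖ₑ * (ENNReal.ofReal t⁻¹ * ∫⁻ y in {y | t < ‖f y‖}, ‖f y‖ₑ)
        + ‖T‖ₑ ^ 2 * (ENNReal.ofReal (t⁻¹ ^ 2) * ∫⁻ y in {y | ‖f y‖ ≤ t}, ‖f y‖ₑ ^ 2) := by
  set A := {y | t < ‖f y‖} with hA
  have hAm : MeasurableSet A := measurableSet_lt measurable_const hfm.norm.measurable
  have hAc : Aᶜ = {y | ‖f y‖ ≤ t} := by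
    ext y
    simp [hA]
  have ht0 : ENNReal.ofReal t ≠ 0 := by simpa using ht
  have htt : ENNReal.ofReal t ≠ ⊤ := ENNReal.ofReal_ne_top
  have hinv : ENNReal.ofReal t⁻¹ = (ENNReal.ofReal t)⁻¹ := ENNReal.ofReal_inv_of_pos ht
  have hu : MemLp (A.indicator f) 2 volume := hf.indicator hAm
  have hv : MemLp (Aᶜ.indicator f) 2 volume := hf.indicator hAm.compl
  have huI : ∫⁻ y, ‖A.indicator f y‖ₑ = ∫⁻ y in A, ‖f y‖ₑ := by
    simp only [enorm_indicator_eq_indicator_enorm]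
    rw [lintegral_indicator hAm]
  have hvI : ∫⁻ y, ‖Aᶜ.indicator f y‖ₑ ^ 2 = ∫⁻ y in {y | ‖f y‖ ≤ t}, ‖f y‖ₑ ^ 2 := by
    rw [← hAc, ← lintegral_indicator hAm.compl]
    refine lintegral_congr fun y => ?_
    by_cases hy : y ∈ Aᶜ
    · rw [indicator_of_mem hy, indicator_of_mem hy]
    · rw [indicator_of_notMem hy, indicator_of_notMem hy]
      simp
  have hui : Integrable (A.indicator f) := by
    refine ⟨hu.1, ?_⟩
    have h1 : ∫⁻ y, ‖f y‖ₑ ^ 2 < ⊤ := by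
      rw [← eLpNorm_two_sq]
      exact ENNReal.pow_lt_top hf.2
    have h2 : ∫⁻ y, ‖A.indicator f y‖ₑ ≤ (ENNReal.ofReal t)⁻¹ * ∫⁻ y, ‖f y‖ₑ ^ 2 := by
      rw [← lintegral_const_mul' _ _ (ENNReal.inv_ne_top.2 ht0)]
      refine lintegral_mono fun y => ?_
      by_cases hy : y ∈ A
      · rw [indicator_of_mem hy, mul_comm, ← div_eq_mul_inv, ENNReal.le_div_iff_mul_le (.inl ht0) (.inl htt),
          sq]
        gcongr
        rw [← ofReal_norm]
        exact ENNReal.ofReal_le_ofReal (le_of_lt hy)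
      · rw [indicator_of_notMem hy]
        simp
    exact h2.trans_lt (ENNReal.mul_lt_top (ENNReal.inv_lt_top.2 (pos_iff_ne_zero.2 ht0)) h1)
  have hdec : hf.toLp f = hu.toLp _ + hv.toLp _ := by
    rw [← MemLp.toLp_add]
    exact MemLp.toLp_congr _ _ (.of_eq (indicator_self_add_compl A f).symm)
  have hweak := weak_type_one_one hK hT hu hui ht0 htt
  have hch := mul_meas_ge_le_lintegral₀ (μ := volume)
    (f := fun y => ‖T (hv.toLp _) y‖ₑ ^ 2) ((Lp.aestronglyMeasurable _).enorm.pow_const 2)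
    (ENNReal.ofReal t ^ 2)
  have hsub : volume {y | t < ‖T (hf.toLp f) y‖ / 2} ≤ volume
      ({y | ENNReal.ofReal t < ‖T (hu.toLp _) y‖ₑ} ∪
        {y | ENNReal.ofReal t ^ 2 ≤ ‖T (hv.toLp _) y‖ₑ ^ 2}) := by
    refine measure_mono_ae ?_
    rw [hdec, map_add]
    filter_upwards [Lp.coeFn_add (T (hu.toLp _)) (T (hv.toLp _))] with y hy
      (hty : t < ‖(T (hu.toLp _) + T (hv.toLp _) : Lp 𝕜 2 (volume : Measure (Rn n))) y‖ / 2)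
    rw [hy, Pi.add_apply] at hty
    rcases lt_or_ge t ‖T (hu.toLp _) y‖ with h | h
    · left
      change ENNReal.ofReal t < ‖T (hu.toLp _) y‖ₑ
      rw [← ofReal_norm]
      exact (ENNReal.ofReal_lt_ofReal_iff (ht.trans h)).2 h
    · right
      change ENNReal.ofReal t ^ 2 ≤ ‖T (hv.toLp _) y‖ₑ ^ 2
      gcongr
      rw [← ofReal_norm]
      refine ENNReal.ofReal_le_ofReal ?_
      have := norm_add_le (T (hu.toLp _) y) (T (hv.toLp _) y)
      linarith
  refine hsub.trans ((measure_union_le _ _).trans (add_le_add ?_ ?_))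
  · calc _ = (ENNReal.ofReal t)⁻¹ * (ENNReal.ofReal t *
          volume {y | ENNReal.ofReal t < ‖T (hu.toLp _) y‖ₑ}) := by
          rw [← mul_assoc, ENNReal.inv_mul_cancel ht0 htt, one_mul]
      _ ≤ (ENNReal.ofReal t)⁻¹ * (weakConst n δ C ‖T‖ₑ * ∫⁻ y, ‖A.indicator f y‖ₑ) := by gcongr
      _ = _ := by
          rw [huI, hinv]
          ring
  · calc _ = (ENNReal.ofReal t ^ 2)⁻¹ * (ENNReal.ofReal t ^ 2 *
          volume {y | ENNReal.ofReal t ^ 2 ≤ ‖T (hv.toLp _) y‖ₑ ^ 2}) := by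
          rw [← mul_assoc, ENNReal.inv_mul_cancel (pow_ne_zero 2 ht0) (ENNReal.pow_ne_top htt),
            one_mul]
      _ ≤ (ENNReal.ofReal t ^ 2)⁻¹ * (‖T‖ₑ ^ 2 * ∫⁻ y, ‖Aᶜ.indicator f y‖ₑ ^ 2) := by
          exact mul_le_mul_right (hch.trans (lintegral_enorm_apply_sq_le T hv)) _
      _ = _ := by
          rw [hvI, ENNReal.ofReal_pow (by positivity), hinv, ENNReal.inv_pow]
          ring

/-- The constant in the `L^p` estimate obtained by interpolation. -/
noncomputable def interpConst (n : ℕ) (δ C : ℝ) (M : ℝ≥0∞) (p : ℝ) : ℝ≥0∞ :=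
  ENNReal.ofReal (2 ^ p) * (ENNReal.ofReal p *
    (weakConst n δ C M * ENNReal.ofReal (1 / (p - 1)) + M ^ 2 * ENNReal.ofReal (1 / (2 - p))))

/-- Marcinkiewicz's argument: write the p-th power by the layer-cake formula and insert
`volume_superlevel_le`, where the cut moves with t; the two truncation lemmas evaluate the resulting
double integrals. -/
theorem lintegral_apply_rpow_le [Nontrivial (Rn n)] {δ ε C : ℝ}
    {K : Rn n → Rn n → 𝕜} (hK : KernelBounds δ ε C K)
    {T : Lp 𝕜 2 (volume : Measure (Rn n)) →L[𝕜] Lp 𝕜 2 (volume : Measure (Rn n))}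
    (hT : HasKernel K 2 T) {p : ℝ} (hp1 : 1 < p) (hp2 : p < 2) {f : Rn n → 𝕜}
    (hfm : StronglyMeasurable f) (hf : MemLp f 2 volume) :
    ∫⁻ y, ‖T (hf.toLp f) y‖ₑ ^ p ≤ interpConst n δ C ‖T‖ₑ p * ∫⁻ y, ‖f y‖ₑ ^ p := by
  have hp0 : 0 < p := by linarith
  set A := weakConst n δ C ‖T‖ₑ with hA
  have hAt : A ≠ ⊤ := weakConst_ne_top n hK.delta_pos C (by simp)
  have hMt : ‖T‖ₑ ^ 2 ≠ ⊤ := by simp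
  have hpow : ∀ z : 𝕜, ENNReal.ofReal (‖z‖ ^ p) = ‖z‖ₑ ^ p := fun z => by
    rw [← ENNReal.ofReal_rpow_of_nonneg (norm_nonneg _) hp0.le, ofReal_norm]
  have hlayer := lintegral_rpow_eq_lintegral_meas_lt_mul (μ := (volume : Measure (Rn n)))
    (f := fun y => ‖T (hf.toLp f) y‖ / 2) (.of_forall fun y => by positivity)
    ((Lp.aestronglyMeasurable _).norm.aemeasurable.div_const 2) hp0
  have hlhs : ∫⁻ y, ‖T (hf.toLp f) y‖ₑ ^ p = ENNReal.ofReal (2 ^ p) *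
      ∫⁻ y, ENNReal.ofReal ((‖T (hf.toLp f) y‖ / 2) ^ p) := by
    rw [← lintegral_const_mul' _ _ ENNReal.ofReal_ne_top]
    refine lintegral_congr fun y => ?_
    rw [← ENNReal.ofReal_mul (by positivity), Real.div_rpow (norm_nonneg _) zero_le_two,
      mul_div_cancel₀ _ (by positivity), hpow]
  have hlarge := lintegral_truncation_large_le (μ := (volume : Measure (Rn n)))
    hfm.norm.measurable (fun y => norm_nonneg _) hp1
  have hsmall := lintegral_truncation_small_le (μ := (volume : Measure (Rn n)))
    hfm.norm.measurable (fun y => norm_nonneg _) hp2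
  simp only [hpow, ofReal_norm] at hlarge hsmall
  set J := ∫⁻ y, ‖f y‖ₑ ^ p with hJ
  -- Measurability in t comes from monotonicity: the superlevel sets shrink as t grows.
  have hmeasA : AEMeasurable (fun t : ℝ => A * (ENNReal.ofReal (t ^ (p - 2)) *
      ∫⁻ y in {y | t < ‖f y‖}, ‖f y‖ₑ)) (volume.restrict (Ioi 0)) := by
    refine (AEMeasurable.mul (by fun_prop) (Antitone.measurable ?_).aemeasurable).const_mul A
    intro s t hst
    exact lintegral_mono_set fun y (hy : t < ‖f y‖) => hst.trans_lt hy
  rw [hlhs, hlayer, interpConst, mul_assoc, mul_assoc]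
  gcongr
  calc _ ≤ ∫⁻ t in Ioi (0 : ℝ), (A * (ENNReal.ofReal (t ^ (p - 2)) *
          ∫⁻ y in {y | t < ‖f y‖}, ‖f y‖ₑ) + ‖T‖ₑ ^ 2 * (ENNReal.ofReal (t ^ (p - 3)) *
          ∫⁻ y in {y | ‖f y‖ ≤ t}, ‖f y‖ₑ ^ 2)) := by
        refine setLIntegral_mono' measurableSet_Ioi fun t (ht : 0 < t) => ?_
        have e1 : ENNReal.ofReal (t ^ (p - 2))
            = ENNReal.ofReal t⁻¹ * ENNReal.ofReal (t ^ (p - 1)) := by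
          rw [← ENNReal.ofReal_mul (by positivity)]
          congr 1
          rw [show p - 2 = p - 1 - 1 by ring, Real.rpow_sub_one ht.ne']
          field_simp
        have e2 : ENNReal.ofReal (t ^ (p - 3))
            = ENNReal.ofReal (t⁻¹ ^ 2) * ENNReal.ofReal (t ^ (p - 1)) := by
          rw [← ENNReal.ofReal_mul (by positivity)]
          congr 1
          rw [show p - 3 = p - 1 - (2 : ℕ) by push_cast; ring, Real.rpow_sub_natCast ht.ne']
          field_simp
        refine (mul_le_mul_left (volume_superlevel_le hK hT hfm hf ht) _).trans (le_of_eq ?_)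
        rw [e1, e2]
        ring
    _ = A * (∫⁻ t in Ioi (0 : ℝ), (ENNReal.ofReal (t ^ (p - 2)) *
          ∫⁻ y in {y | t < ‖f y‖}, ‖f y‖ₑ)) + ‖T‖ₑ ^ 2 * ∫⁻ t in Ioi (0 : ℝ),
          (ENNReal.ofReal (t ^ (p - 3)) * ∫⁻ y in {y | ‖f y‖ ≤ t}, ‖f y‖ₑ ^ 2) := by
        rw [lintegral_add_left' hmeasA, lintegral_const_mul' _ _ hAt, lintegral_const_mul' _ _ hMt]
    _ ≤ A * (ENNReal.ofReal (1 / (p - 1)) * J) +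
          ‖T‖ₑ ^ 2 * (ENNReal.ofReal (1 / (2 - p)) * J) := by gcongr
    _ = _ := by ring

end Marcinkiewicz

/-! ### Extension to L^p and independence of the exponent. -/

section Extension

variable {n : ℕ} {𝕜 : Type*} [RCLike 𝕜]

theorem eLpNorm_ofReal_rpow {α E : Type*} [MeasurableSpace α] {μ : Measure α}
    [NormedAddCommGroup E] {p : ℝ} (hp : 0 < p) (f : α → E) :
    eLpNorm f (ENNReal.ofReal p) μ ^ p = ∫⁻ x, ‖f x‖ₑ ^ p ∂μ := by
  have h := eLpNorm_nnreal_pow_eq_lintegral (μ := μ) (f := f) (p := p.toNNReal)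
    (by simpa using hp)
  rwa [Real.coe_toNNReal p hp.le] at h

theorem eLpNorm_apply_le [Nontrivial (Rn n)] {δ ε C : ℝ}
    {K : Rn n → Rn n → 𝕜} (hK : KernelBounds δ ε C K)
    {T : Lp 𝕜 2 (volume : Measure (Rn n)) →L[𝕜] Lp 𝕜 2 (volume : Measure (Rn n))}
    (hT : HasKernel K 2 T) {p : ℝ} (hp1 : 1 < p) (hp2 : p < 2)
    (f : Lp 𝕜 2 (volume : Measure (Rn n))) :
    eLpNorm (T f) (ENNReal.ofReal p) volume
      ≤ interpConst n δ C ‖T‖ₑ p ^ (1 / p) * eLpNorm f (ENNReal.ofReal p) volume := by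
  have hp0 : 0 < p := by linarith
  have h := lintegral_apply_rpow_le hK hT hp1 hp2 (Lp.stronglyMeasurable f) (Lp.memLp f)
  rw [Lp.toLp_coeFn, ← eLpNorm_ofReal_rpow hp0, ← eLpNorm_ofReal_rpow hp0] at h
  have h2 := ENNReal.rpow_le_rpow h (z := 1 / p) (by positivity)
  rwa [ENNReal.mul_rpow_of_nonneg _ _ (by positivity), ← ENNReal.rpow_mul, ← ENNReal.rpow_mul,
    mul_one_div_cancel hp0.ne', ENNReal.rpow_one, ENNReal.rpow_one] at h2

theorem interpConst_ne_top (n : ℕ) {δ : ℝ} (hδ : 0 < δ) (C : ℝ) {M : ℝ≥0∞} (hM : M ≠ ⊤) (p : ℝ) :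
    interpConst n δ C M p ≠ ⊤ := by
  have := weakConst_ne_top n hδ C hM
  unfold interpConst
  finiteness

/-- Singular integral operators extend boundedly to `L^p` for `1 < p < 2`. -/
theorem exists_isLpExtension [Nontrivial (Rn n)] {δ ε C : ℝ}
    {K : Rn n → Rn n → 𝕜} (hK : KernelBounds δ ε C K)
    {T : Lp 𝕜 2 (volume : Measure (Rn n)) →L[𝕜] Lp 𝕜 2 (volume : Measure (Rn n))}
    (hT : HasKernel K 2 T) {p : ℝ} (hp1 : 1 < p) (hp2 : p < 2) {q : ℝ≥0∞} [Fact (1 ≤ q)]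
    (hq : q = ENNReal.ofReal p) :
    ∃ Tp : Lp 𝕜 q (volume : Measure (Rn n)) →L[𝕜] Lp 𝕜 q (volume : Measure (Rn n)),
      IsLpExtension T q Tp := by
  have hqt : q ≠ ⊤ := hq ▸ ENNReal.ofReal_ne_top
  set A := interpConst n δ C ‖T‖ₑ p ^ (1 / p) with hA
  have hAt : A ≠ ⊤ := ENNReal.rpow_ne_top_of_nonneg (by positivity)
    (interpConst_ne_top n hK.delta_pos C (by simp) p)
  have hbound : ∀ f : Lp 𝕜 2 (volume : Measure (Rn n)),
      eLpNorm (T f) q volume ≤ A * eLpNorm f q volume := hq ▸ eLpNorm_apply_le hK hT hp1 hp2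
  -- `E` is L² ∩ L^q inside L². Its image under `e` contains the test functions and is therefore
  -- dense in L^q; `F`, which is T on `E`, is bounded for the L^q norm and extends by continuity.
  let E : Submodule 𝕜 (Lp 𝕜 2 (volume : Measure (Rn n))) :=
    { carrier := {f | MemLp f q volume}
      add_mem' := fun {f g} hf hg => (hf.add hg).ae_eq (Lp.coeFn_add f g).symm
      zero_mem' := MemLp.zero.ae_eq (Lp.coeFn_zero 𝕜 2 volume).symm
      smul_mem' := fun c f hf => (MemLp.const_smul hf c).ae_eq (Lp.coeFn_smul c f).symm }
  have hE : ∀ f : E, MemLp (f : Lp 𝕜 2 (volume : Measure (Rn n))) q volume := fun f => f.2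
  have hTE : ∀ f : E, MemLp (T f) q volume := fun f =>
    ⟨Lp.aestronglyMeasurable _, (hbound f).trans_lt
      (ENNReal.mul_lt_top hAt.lt_top (hE f).2)⟩
  let e : E →ₗ[𝕜] Lp 𝕜 q (volume : Measure (Rn n)) :=
    { toFun := fun f => (hE f).toLp _
      map_add' := fun f g => by
        rw [← MemLp.toLp_add]
        exact MemLp.toLp_congr _ _ (Lp.coeFn_add _ _)
      map_smul' := fun c f => by
        rw [RingHom.id_apply, ← MemLp.toLp_const_smul]
        exact MemLp.toLp_congr _ _ (Lp.coeFn_smul _ _) }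
  let F : E →ₗ[𝕜] Lp 𝕜 q (volume : Measure (Rn n)) :=
    { toFun := fun f => (hTE f).toLp _
      map_add' := fun f g => by
        rw [← MemLp.toLp_add]
        refine MemLp.toLp_congr _ _ ?_
        rw [Submodule.coe_add, map_add]
        exact Lp.coeFn_add _ _
      map_smul' := fun c f => by
        rw [RingHom.id_apply, ← MemLp.toLp_const_smul]
        refine MemLp.toLp_congr _ _ ?_
        rw [Submodule.coe_smul, map_smul]
        exact Lp.coeFn_smul _ _ }
  have hdense : DenseRange e := by
    refine (Lp.dense_hasCompactSupport_contDiff (F := 𝕜) (μ := (volume : Measure (Rn n)))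
      (p := q) hqt).mono ?_
    rintro f ⟨g, hfg, hgc, hgd⟩
    have hg2 : MemLp g 2 volume := hgd.continuous.memLp_of_hasCompactSupport hgc
    have hgq : MemLp g q volume := hgd.continuous.memLp_of_hasCompactSupport hgc
    let g' : E := ⟨hg2.toLp g, hgq.ae_eq hg2.coeFn_toLp.symm⟩
    refine ⟨g', Lp.ext ?_⟩
    exact (hE g').coeFn_toLp.trans (hg2.coeFn_toLp.trans hfg.symm)
  have hnorm : ∃ c : ℝ, ∀ f, ‖F f‖ ≤ c * ‖e f‖ := by
    refine ⟨A.toReal, fun f => ?_⟩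
    change ‖(hTE f).toLp _‖ ≤ A.toReal * ‖(hE f).toLp _‖
    rw [Lp.norm_toLp, Lp.norm_toLp, ← ENNReal.toReal_mul]
    exact ENNReal.toReal_mono (ENNReal.mul_ne_top hAt (hE f).2.ne) (hbound f)
  refine ⟨F.extendOfNorm e, fun f h2 hp => ?_⟩
  let f' : E := ⟨h2.toLp f, hp.ae_eq h2.coeFn_toLp.symm⟩
  have h1 : e f' = hp.toLp f := MemLp.toLp_congr (hE f') hp h2.coeFn_toLp
  rw [← h1, LinearMap.extendOfNorm_eq hdense hnorm]
  exact (hTE f').coeFn_toLp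

/-- The simple functions approximating f pointwise do not depend on the exponent, so one sequence
converges in both spaces. A simple function in L^p vanishes off a set of finite measure and so is in
L². -/
theorem exists_approximating_sequence {p q : ℝ≥0∞} (hp : 1 ≤ p) (hpt : p ≠ ⊤) (hqt : q ≠ ⊤)
    {f : Rn n → 𝕜} (hfp : MemLp f p volume) (hfq : MemLp f q volume) :
    ∃ g : ℕ → Rn n → 𝕜, (∀ k, MemLp (g k) 2 volume) ∧ (∀ k, MemLp (g k) p volume) ∧
      (∀ k, MemLp (g k) q volume) ∧
      Tendsto (fun k => eLpNorm (g k - f) p volume) atTop (𝓝 0) ∧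
      Tendsto (fun k => eLpNorm (g k - f) q volume) atTop (𝓝 0) := by
  borelize 𝕜
  set f' := hfp.1.mk f with hf'
  have hae : f =ᵐ[volume] f' := hfp.1.ae_eq_mk
  have hm : Measurable f' := hfp.1.stronglyMeasurable_mk.measurable
  have hp' : MemLp f' p volume := hfp.ae_eq hae
  have hq' : MemLp f' q volume := hfq.ae_eq hae
  refine ⟨fun k => SimpleFunc.approxOn f' hm (range f' ∪ {0}) 0 (by simp) k, fun k => ?_,
    fun k => SimpleFunc.memLp_approxOn_range hm hp' k,
    fun k => SimpleFunc.memLp_approxOn_range hm hq' k, ?_, ?_⟩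
  · exact (SimpleFunc.memLp_iff (by simp) (by simp)).2
      ((SimpleFunc.memLp_iff (one_pos.trans_le hp).ne' hpt).1
        (SimpleFunc.memLp_approxOn_range hm hp' k))
  · refine (SimpleFunc.tendsto_approxOn_range_Lp_eLpNorm hpt hm hp'.2).congr fun k => ?_
    exact eLpNorm_congr_ae ((ae_eq_refl _).sub hae.symm)
  · refine (SimpleFunc.tendsto_approxOn_range_Lp_eLpNorm hqt hm hq'.2).congr fun k => ?_
    exact eLpNorm_congr_ae ((ae_eq_refl _).sub hae.symm)

/-- Extensions to different `L^p` spaces are consistent. -/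
theorem IsLpExtension.ae_eq
    {T : Lp 𝕜 2 (volume : Measure (Rn n)) →L[𝕜] Lp 𝕜 2 (volume : Measure (Rn n))}
    {p q : ℝ≥0∞} [hp : Fact (1 ≤ p)] [Fact (1 ≤ q)] (hpt : p ≠ ⊤) (hqt : q ≠ ⊤)
    {Tp : Lp 𝕜 p (volume : Measure (Rn n)) →L[𝕜] Lp 𝕜 p (volume : Measure (Rn n))}
    {Tq : Lp 𝕜 q (volume : Measure (Rn n)) →L[𝕜] Lp 𝕜 q (volume : Measure (Rn n))}
    (hTp : IsLpExtension T p Tp) (hTq : IsLpExtension T q Tq)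
    {f : Rn n → 𝕜} (hfp : MemLp f p volume) (hfq : MemLp f q volume) :
    Tp (hfp.toLp f) =ᵐ[volume] Tq (hfq.toLp f) := by
  obtain ⟨g, hg2, hgp, hgq, hlp, hlq⟩ := exists_approximating_sequence hp.out hpt hqt hfp hfq
  have h1 : Tendsto (fun k => (hgp k).toLp (g k)) atTop (𝓝 (hfp.toLp f)) :=
    (Lp.tendsto_Lp_iff_tendsto_eLpNorm'' _ hgp f hfp).2 hlp
  have h2 : Tendsto (fun k => (hgq k).toLp (g k)) atTop (𝓝 (hfq.toLp f)) :=
    (Lp.tendsto_Lp_iff_tendsto_eLpNorm'' _ hgq f hfq).2 hlq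
  obtain ⟨φ, hφ, hae⟩ := (tendstoInMeasure_of_tendsto_Lp
    ((Tp.continuous.tendsto _).comp h1)).exists_seq_tendsto_ae
  -- A further subsequence, so that both images converge almost everywhere along the same indices.
  obtain ⟨ψ, hψ, hae2⟩ := (tendstoInMeasure_of_tendsto_Lp
    (((Tq.continuous.tendsto _).comp h2).comp hφ.tendsto_atTop)).exists_seq_tendsto_ae
  have hall : ∀ᵐ y ∂(volume : Measure (Rn n)), ∀ k,
      Tp ((hgp k).toLp (g k)) y = Tq ((hgq k).toLp (g k)) y := ae_all_iff.2 fun k =>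
    (hTp _ (hg2 k) (hgp k)).trans (hTq _ (hg2 k) (hgq k)).symm
  filter_upwards [hae, hae2, hall] with y hy1 hy2 hy
  refine tendsto_nhds_unique (hy1.comp hψ.tendsto_atTop) (hy2.congr fun k => ?_)
  exact (hy _).symm

/-- The commutator is determined almost everywhere. -/
theorem IsCommutator.ae_eq
    {T : Lp 𝕜 2 (volume : Measure (Rn n)) →L[𝕜] Lp 𝕜 2 (volume : Measure (Rn n))}
    {b f h h' : Rn n → 𝕜} (hh : IsCommutator b T f h) (hh' : IsCommutator b T f h') :
    h =ᵐ[volume] h' := by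
  obtain ⟨p, _, Tp, hf, hbf, -, hpt, hTp, he⟩ := hh
  obtain ⟨q, _, Tq, hf', hbf', -, hqt, hTq, he'⟩ := hh'
  filter_upwards [he, he', hTp.ae_eq hpt.ne hqt.ne hTq hbf hbf'] with y h1 h2 h3
  rw [h1, h2, h3]

end Extension

/-! ### The John–Nirenberg inequality. -/

section JohnNirenberg

variable {n : ℕ} {𝕜 : Type*} [RCLike 𝕜]

/-- The average of `b` over a closed ball. -/
noncomputable def ballAvg (b : Rn n → 𝕜) (x : Rn n) (r : ℝ) : 𝕜 := ⨍ y in closedBall x r, b y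

/-- The average of b - c is bounded by the average of its norm, with the volume kept on the left to
avoid division. -/
theorem enorm_ballAvg_sub_mul_le {b : Rn n → 𝕜} (hb : LocallyIntegrable b volume) (x : Rn n)
    {r : ℝ} (hr : 0 < r) (c : 𝕜) :
    ‖ballAvg b x r - c‖ₑ * volume (closedBall x r) ≤ ∫⁻ y in closedBall x r, ‖b y - c‖ₑ := by
  have hv0 : volume (closedBall x r) ≠ 0 := (volume_closedBall_pos x hr).ne'
  have hvt : volume (closedBall x r) ≠ ⊤ := volume_closedBall_ne_top x r
  have hbi : IntegrableOn b (closedBall x r) := hb.integrableOn_isCompact (isCompact_closedBall _ _)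
  have hpos := ENNReal.toReal_pos hv0 hvt
  have h1 : ∫ y in closedBall x r, (b y - c)
      = (volume (closedBall x r)).toReal • (ballAvg b x r - c) := by
    rw [integral_sub hbi (integrableOn_const hvt), setIntegral_const, ballAvg, setAverage_eq,
      Measure.real, smul_sub, smul_smul, mul_inv_cancel₀ hpos.ne', one_smul]
  have h2 := enorm_integral_le_lintegral_enorm (μ := volume.restrict (closedBall x r))
    fun y => b y - c
  rw [h1, enorm_smul, Real.enorm_of_nonneg hpos.le, ENNReal.ofReal_toReal hvt, mul_comm] at h2
  exact h2

/-- The factor by which the height grows in one step of the good-`λ` iteration. -/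
noncomputable def jnFactor (n : ℕ) : ℝ≥0∞ :=
  2 * ENNReal.ofReal (10 ^ n) * ((1 + ENNReal.ofReal (2 ^ n)) * ENNReal.ofReal (2 ^ n))

theorem jnFactor_ne_top (n : ℕ) : jnFactor n ≠ ⊤ := by
  unfold jnFactor
  finiteness

theorem jnFactor_ne_zero (n : ℕ) : jnFactor n ≠ 0 := by
  unfold jnFactor
  positivity

variable {b : Rn n → 𝕜} {M : ℝ≥0∞}

/-- The first bound is the step of the telescoping sum over dyadic dilates. The second gives the
stopping-time argument room around the ball, since stopping balls may stick out of it. -/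
theorem lintegral_double_ball_le (hb : LocallyIntegrable b volume)
    (hM : ∀ (x : Rn n) (r : ℝ), 0 < r → ∫⁻ y in closedBall x r, ‖b y - ballAvg b x r‖ₑ
      ≤ M * volume (closedBall x r)) (x : Rn n) {r : ℝ} (hr : 0 < r) :
    ‖ballAvg b x (2 * r) - ballAvg b x r‖ₑ ≤ ENNReal.ofReal (2 ^ n) * M ∧
    ∫⁻ y in closedBall x (2 * r), ‖b y - ballAvg b x r‖ₑ
      ≤ (1 + ENNReal.ofReal (2 ^ n)) * ENNReal.ofReal (2 ^ n) * M * volume (closedBall x r) := by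
  have hv0 : volume (closedBall x r) ≠ 0 := (volume_closedBall_pos x hr).ne'
  have hvt : volume (closedBall x r) ≠ ⊤ := volume_closedBall_ne_top x r
  have hvol : volume (closedBall x (2 * r)) ≤ ENNReal.ofReal (2 ^ n) * volume (closedBall x r) :=
    volume_closedBall_mul_le _ _ zero_lt_two _
  have h2 := hM x (2 * r) (by positivity)
  have h1 : ‖ballAvg b x (2 * r) - ballAvg b x r‖ₑ ≤ ENNReal.ofReal (2 ^ n) * M := by
    refine (ENNReal.mul_le_mul_iff_left hv0 hvt).1 ?_
    rw [← enorm_neg, neg_sub]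
    calc _ ≤ ∫⁻ y in closedBall x r, ‖b y - ballAvg b x (2 * r)‖ₑ :=
          enorm_ballAvg_sub_mul_le hb x hr _
      _ ≤ ∫⁻ y in closedBall x (2 * r), ‖b y - ballAvg b x (2 * r)‖ₑ :=
          lintegral_mono_set (closedBall_subset_closedBall (by linarith))
      _ ≤ M * (ENNReal.ofReal (2 ^ n) * volume (closedBall x r)) := h2.trans (by gcongr)
      _ = _ := by ring
  refine ⟨h1, ?_⟩
  calc _ ≤ ∫⁻ y in closedBall x (2 * r), (‖b y - ballAvg b x (2 * r)‖ₑ +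
        ‖ballAvg b x (2 * r) - ballAvg b x r‖ₑ) := by
        refine lintegral_mono fun y => ?_
        rw [← sub_add_sub_cancel (b y) (ballAvg b x (2 * r)) (ballAvg b x r)]
        exact enorm_add_le _ _
    _ = (∫⁻ y in closedBall x (2 * r), ‖b y - ballAvg b x (2 * r)‖ₑ) +
        ‖ballAvg b x (2 * r) - ballAvg b x r‖ₑ * volume (closedBall x (2 * r)) := by
        rw [lintegral_add_right _ measurable_const, lintegral_const, Measure.restrict_apply_univ]
    _ ≤ M * (ENNReal.ofReal (2 ^ n) * volume (closedBall x r)) +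
        ENNReal.ofReal (2 ^ n) * M * (ENNReal.ofReal (2 ^ n) * volume (closedBall x r)) := by
        gcongr
        exact h2.trans (by gcongr)
    _ = _ := by ring

/-- Select stopping balls for |b - m| on the double ball at height t = `jnFactor n * M`. Over the
five times larger balls the average of b differs from m by at most t, so a point with |b - m| > s +
t oscillates by more than s there and the hypothesis applies on each such ball. The height is chosen
so that these balls have total volume at most half that of the original. -/
theorem volume_oscillation_step [Nontrivial (Rn n)] (hb : LocallyIntegrable b volume)
    (hM0 : M ≠ 0) (hMt : M ≠ ⊤)
    (hM : ∀ (x : Rn n) (r : ℝ), 0 < r → ∫⁻ y in closedBall x r, ‖b y - ballAvg b x r‖ₑ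
      ≤ M * volume (closedBall x r)) {a s : ℝ≥0∞}
    (h : ∀ (x : Rn n) (r : ℝ), 0 < r →
      volume {y ∈ closedBall x r | s < ‖b y - ballAvg b x r‖ₑ} ≤ a * volume (closedBall x r))
    (x : Rn n) {r : ℝ} (hr : 0 < r) :
    volume {y ∈ closedBall x r | s + jnFactor n * M < ‖b y - ballAvg b x r‖ₑ}
      ≤ a / 2 * volume (closedBall x r) := by
  set t := jnFactor n * M with ht
  have ht0 : t ≠ 0 := mul_ne_zero (jnFactor_ne_zero n) hM0
  have htt : t ≠ ⊤ := ENNReal.mul_ne_top (jnFactor_ne_top n) hMt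
  set V := volume (closedBall x r) with hV
  have hV0 : V ≠ 0 := (volume_closedBall_pos x hr).ne'
  have hVt : V ≠ ⊤ := volume_closedBall_ne_top x r
  set m := ballAvg b x r with hm
  set F : Rn n → ℝ≥0∞ := (closedBall x (2 * r)).indicator fun y => ‖b y - m‖ₑ with hF
  have hFm : AEMeasurable F volume :=
    ((hb.aestronglyMeasurable.sub aestronglyMeasurable_const).enorm).indicator
      measurableSet_closedBall
  -- `jnFactor` is defined to make this an identity once the double-ball bound is inserted.
  have hFint : 2 * ENNReal.ofReal (10 ^ n) * ∫⁻ y, F y ≤ t * V := by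
    rw [hF, lintegral_indicator measurableSet_closedBall]
    refine (mul_le_mul_right (lintegral_double_ball_le hb hM x hr).2 _).trans (le_of_eq ?_)
    rw [ht, jnFactor]
    ring
  have hFt : ∫⁻ y, F y ≠ ⊤ := by
    intro htop
    rw [htop, ENNReal.mul_top (by positivity)] at hFint
    exact (ENNReal.mul_ne_top htt hVt) (top_le_iff.1 hFint)
  obtain ⟨z, ρ, hdisj, havg, havg5, hout⟩ := exists_stopping_balls hFm hFt ht0 htt
  have hsum : 2 * ENNReal.ofReal (10 ^ n) * ∑' i, volume (closedBall (z i) (ρ i)) ≤ V := by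
    refine (ENNReal.mul_le_mul_iff_right ht0 htt).1 ?_
    calc _ = 2 * ENNReal.ofReal (10 ^ n) * ∑' i, t * volume (closedBall (z i) (ρ i)) := by
          rw [ENNReal.tsum_mul_left]
          ring
      _ ≤ 2 * ENNReal.ofReal (10 ^ n) * ∑' i, ∫⁻ y in closedBall (z i) (ρ i), F y := by
          gcongr with i
          exact havg i
      _ = 2 * ENNReal.ofReal (10 ^ n) * ∫⁻ y in ⋃ i, closedBall (z i) (ρ i), F y := by
          rw [lintegral_iUnion (fun i => measurableSet_closedBall) hdisj]
      _ ≤ 2 * ENNReal.ofReal (10 ^ n) * ∫⁻ y, F y := by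
          gcongr
          exact Measure.restrict_le_self
      _ ≤ t * V := hFint
  -- A larger stopping ball would by itself exceed the bound on the total volume. With this, an
  -- enlarged ball meeting the ball of radius r stays within 5ρ + 5ρ + r ≤ 2r of x, where `F` equals
  -- |b - m|.
  have hρ : ∀ i, 10 * ρ i ≤ r := fun i => by
    by_contra! hcon
    have h1 : V ≤ ENNReal.ofReal (10 ^ n) * volume (closedBall (z i) (ρ i)) := by
      refine le_trans ?_ (volume_closedBall_mul_le x (z i) (by norm_num : (0 : ℝ) < 10) (ρ i))
      exact measure_mono (closedBall_subset_closedBall hcon.le)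
    have h2 : 2 * V ≤ V := by
      calc 2 * V ≤ 2 * (ENNReal.ofReal (10 ^ n) * volume (closedBall (z i) (ρ i))) := by gcongr
        _ ≤ 2 * (ENNReal.ofReal (10 ^ n) * ∑' i, volume (closedBall (z i) (ρ i))) := by
          gcongr
          exact ENNReal.le_tsum i
        _ ≤ V := by rwa [← mul_assoc]
    rw [two_mul] at h2
    exact absurd h2 (not_le.2 (ENNReal.lt_add_right hVt hV0))
  have hpiece : ∀ i, volume ({y ∈ closedBall x r | s + t < ‖b y - m‖ₑ} ∩
      closedBall (z i) (5 * ρ i)) ≤ a * volume (closedBall (z i) (5 * ρ i)) := fun i => by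
    rcases le_or_gt (ρ i) 0 with h0 | h0
    · refine (measure_mono inter_subset_right).trans ?_
      rw [volume_closedBall_of_nonpos (z i) (by linarith : 5 * ρ i ≤ 0)]
      exact zero_le
    by_cases hne : ({y ∈ closedBall x r | s + t < ‖b y - m‖ₑ} ∩
      closedBall (z i) (5 * ρ i)).Nonempty
    swap
    · rw [not_nonempty_iff_eq_empty.1 hne, measure_empty]
      exact zero_le
    obtain ⟨w, ⟨hw1, -⟩, hw2⟩ := hne
    have hsub : closedBall (z i) (5 * ρ i) ⊆ closedBall x (2 * r) := fun y hy => by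
      rw [mem_closedBall] at *
      have h1 := dist_triangle4 y (z i) w x
      rw [dist_comm (z i) w] at h1
      linarith [hρ i]
    have h5 : (0 : ℝ) < 5 * ρ i := by positivity
    have hmt : ‖ballAvg b (z i) (5 * ρ i) - m‖ₑ ≤ t := by
      refine (ENNReal.mul_le_mul_iff_left (volume_closedBall_pos (z i) h5).ne'
        (volume_closedBall_ne_top _ _)).1 ?_
      refine (enorm_ballAvg_sub_mul_le hb (z i) h5 m).trans (le_trans (le_of_eq ?_) (havg5 i))
      refine setLIntegral_congr_fun measurableSet_closedBall fun y hy => ?_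
      rw [hF, indicator_of_mem (hsub hy)]
    refine (measure_mono ?_).trans (h (z i) (5 * ρ i) h5)
    rintro y ⟨⟨-, hy1⟩, hy2⟩
    refine ⟨hy2, ?_⟩
    by_contra! hcon
    refine lt_irrefl (s + t) (hy1.trans_le ?_)
    rw [← sub_add_sub_cancel (b y) (ballAvg b (z i) (5 * ρ i)) m]
    exact (enorm_add_le _ _).trans (add_le_add hcon hmt)
  have hcover : volume {y ∈ closedBall x r | s + t < ‖b y - m‖ₑ} ≤ volume
      (⋃ i, ({y ∈ closedBall x r | s + t < ‖b y - m‖ₑ} ∩ closedBall (z i) (5 * ρ i))) := by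
    refine measure_mono_ae ?_
    filter_upwards [hout] with y hy hyS
    obtain ⟨hy1, hy2⟩ := id hyS
    have h2 : y ∈ closedBall x (2 * r) := closedBall_subset_closedBall (by linarith) hy1
    have h3 : y ∈ ⋃ i, closedBall (z i) (5 * ρ i) := by
      by_contra hcon
      have h4 := hy hcon
      rw [hF, indicator_of_mem h2] at h4
      exact absurd (hy2.trans_le h4) (not_lt.2 le_add_self)
    obtain ⟨i, hi⟩ := mem_iUnion.1 h3
    exact mem_iUnion.2 ⟨i, hyS, hi⟩
  calc _ ≤ ∑' i, volume ({y ∈ closedBall x r | s + t < ‖b y - m‖ₑ} ∩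
        closedBall (z i) (5 * ρ i)) := hcover.trans (measure_iUnion_le _)
    _ ≤ ∑' i, a * (ENNReal.ofReal (10 ^ n) * volume (closedBall (z i) (ρ i))) := by
        refine ENNReal.tsum_le_tsum fun i => (hpiece i).trans ?_
        gcongr
        refine (volume_closedBall_mul_le (z i) (z i) (by norm_num) _).trans ?_
        gcongr
        norm_num
    _ = a / 2 * (2 * ENNReal.ofReal (10 ^ n) * ∑' i, volume (closedBall (z i) (ρ i))) := by
        rw [ENNReal.tsum_mul_left, ENNReal.tsum_mul_left]
        have h2 : a = a / 2 * 2 := (ENNReal.div_mul_cancel (by simp) (by simp)).symm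
        conv_lhs => rw [h2]
        ring
    _ ≤ a / 2 * V := by gcongr

/-- Iterating the step halves the proportion each time the height grows by `jnFactor n * M`; this is
the exponential decay of the distribution function. -/
theorem volume_oscillation_le [Nontrivial (Rn n)] (hb : LocallyIntegrable b volume)
    (hM0 : M ≠ 0) (hMt : M ≠ ⊤)
    (hM : ∀ (x : Rn n) (r : ℝ), 0 < r → ∫⁻ y in closedBall x r, ‖b y - ballAvg b x r‖ₑ
      ≤ M * volume (closedBall x r)) (j : ℕ) (x : Rn n) {r : ℝ} (hr : 0 < r) :
    volume {y ∈ closedBall x r | j * (jnFactor n * M) < ‖b y - ballAvg b x r‖ₑ}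
      ≤ 2⁻¹ ^ j * volume (closedBall x r) := by
  induction j generalizing x r with
  | zero =>
    rw [pow_zero, one_mul]
    exact measure_mono fun y hy => hy.1
  | succ j ih =>
    have h := volume_oscillation_step hb hM0 hMt hM (fun x r hr => ih x hr) x hr
    rw [pow_succ, ← div_eq_mul_inv]
    convert h using 6
    push_cast
    ring

theorem exists_nat_mul_lt_le {v t : ℝ≥0∞} (hv0 : v ≠ 0) (hvt : v ≠ ⊤) (ht0 : t ≠ 0)
    (ht : t ≠ ⊤) : ∃ j : ℕ, j * t < v ∧ v ≤ (j + 1) * t := by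
  classical
  have hex : ∃ j : ℕ, v ≤ j * t := by
    obtain ⟨j, hj⟩ := ENNReal.exists_nat_gt (ENNReal.div_ne_top hvt ht0)
    exact ⟨j, (ENNReal.div_le_iff_le_mul (.inl ht0) (.inl ht)).1 hj.le⟩
  obtain ⟨j, hj⟩ : ∃ j, Nat.find hex = j + 1 := Nat.exists_eq_succ_of_ne_zero fun h => by
    have := Nat.find_spec hex
    rw [h] at this
    simp [hv0] at this
  refine ⟨j, not_le.1 (Nat.find_min hex (by omega)), ?_⟩
  have := Nat.find_spec hex
  rw [hj] at this
  exact_mod_cast this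

/-- The constant in the John–Nirenberg inequality for `q`-th powers. -/
noncomputable def jnConst (n q : ℕ) : ℝ≥0∞ :=
  jnFactor n ^ q * (2 * ∑' j : ℕ, (j : ℝ≥0∞) ^ q * 2⁻¹ ^ j)

theorem jnConst_ne_top (n q : ℕ) : jnConst n q ≠ ⊤ := by
  have h1 := jnFactor_ne_top n
  have h2 := tsum_natCast_pow_mul_geometric_ne_top q (ENNReal.inv_lt_one.2 ENNReal.one_lt_two)
  unfold jnConst
  finiteness

/-- John–Nirenberg inequality: self-improvement of the integrability of mean oscillations. -/
theorem lintegral_oscillation_pow_le [Nontrivial (Rn n)] (hb : LocallyIntegrable b volume)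
    (hMt : M ≠ ⊤)
    (hM : ∀ (x : Rn n) (r : ℝ), 0 < r → ∫⁻ y in closedBall x r, ‖b y - ballAvg b x r‖ₑ
      ≤ M * volume (closedBall x r)) {q : ℕ} (hq : q ≠ 0) (x : Rn n) {r : ℝ} (hr : 0 < r) :
    ∫⁻ y in closedBall x r, ‖b y - ballAvg b x r‖ₑ ^ q
      ≤ jnConst n q * M ^ q * volume (closedBall x r) := by
  have hmeas : AEMeasurable (fun y => ‖b y - ballAvg b x r‖ₑ) (volume : Measure (Rn n)) :=
    (hb.aestronglyMeasurable.sub aestronglyMeasurable_const).enorm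
  rcases eq_or_ne M 0 with hM0 | hM0
  · have h0 := hM x r hr
    rw [hM0, zero_mul, nonpos_iff_eq_zero, lintegral_eq_zero_iff' hmeas.restrict] at h0
    rw [lintegral_congr_ae (g := fun _ => 0) (by
      filter_upwards [h0] with y hy
      rw [hy]
      exact zero_pow hq)]
    simp
  set t := jnFactor n * M with ht
  have ht0 : t ≠ 0 := mul_ne_zero (jnFactor_ne_zero n) hM0
  have htt : t ≠ ⊤ := ENNReal.mul_ne_top (jnFactor_ne_top n) hMt
  set S : ℕ → Set (Rn n) := fun j => {y | j * t < ‖b y - ballAvg b x r‖ₑ} with hS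
  have hSm : ∀ j, NullMeasurableSet (S j) volume := fun j =>
    nullMeasurableSet_lt aemeasurable_const hmeas
  -- A nonzero oscillation lies in some layer (jt, (j+1)t], and the j-th summand alone dominates its
  -- q-th power.
  have hpt : ∀ y, ‖b y - ballAvg b x r‖ₑ ^ q
      ≤ ∑' j : ℕ, (S j).indicator (fun _ => (((j : ℝ≥0∞) + 1) * t) ^ q) y := fun y => by
    rcases eq_or_ne ‖b y - ballAvg b x r‖ₑ 0 with h0 | h0
    · rw [h0, zero_pow hq]
      exact zero_le
    · obtain ⟨j, hj1, hj2⟩ := exists_nat_mul_lt_le h0 (by simp) ht0 htt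
      refine le_trans ?_ (ENNReal.le_tsum j)
      rw [indicator_of_mem (show y ∈ S j from hj1)]
      gcongr
  calc _ ≤ ∫⁻ y in closedBall x r,
        ∑' j : ℕ, (S j).indicator (fun _ => (((j : ℝ≥0∞) + 1) * t) ^ q) y := lintegral_mono hpt
    _ = ∑' j : ℕ, ∫⁻ y in closedBall x r, (S j).indicator (fun _ => (((j : ℝ≥0∞) + 1) * t) ^ q) y :=
        lintegral_tsum fun j => aemeasurable_const.indicator₀ ((hSm j).mono_ac
          Measure.absolutelyContinuous_restrict)
    _ ≤ ∑' j : ℕ, (((j : ℝ≥0∞) + 1) * t) ^ q * (2⁻¹ ^ j * volume (closedBall x r)) := by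
        refine ENNReal.tsum_le_tsum fun j => ?_
        rw [lintegral_indicator_const₀ ((hSm j).mono_ac Measure.absolutelyContinuous_restrict),
          Measure.restrict_apply₀' measurableSet_closedBall.nullMeasurableSet]
        gcongr
        refine le_trans (measure_mono ?_) (volume_oscillation_le hb hM0 hMt hM j x hr)
        exact fun y hy => ⟨hy.2, hy.1⟩
    _ = t ^ q * volume (closedBall x r) * (2 * ∑' j : ℕ,
          (((j + 1 : ℕ) : ℝ≥0∞) ^ q * 2⁻¹ ^ (j + 1))) := by
        rw [← ENNReal.tsum_mul_left, ← ENNReal.tsum_mul_left]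
        refine tsum_congr fun j => ?_
        have h2 : (2 : ℝ≥0∞) * 2⁻¹ = 1 := ENNReal.mul_inv_cancel (by simp) (by simp)
        calc _ = t ^ q * volume (closedBall x r) * (((j : ℝ≥0∞) + 1) ^ q * 2⁻¹ ^ j) * 1 := by
              rw [mul_pow]
              ring
          _ = t ^ q * volume (closedBall x r) * (((j : ℝ≥0∞) + 1) ^ q * 2⁻¹ ^ j) * (2 * 2⁻¹) := by
              rw [h2]
          _ = _ := by
              push_cast
              ring
    _ ≤ t ^ q * volume (closedBall x r) * (2 * ∑' j : ℕ, ((j : ℝ≥0∞) ^ q * 2⁻¹ ^ j)) := by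
        refine mul_le_mul_right (mul_le_mul_right ?_ _) _
        exact ENNReal.tsum_comp_le_tsum_of_injective (add_left_injective 1)
          fun j : ℕ => (j : ℝ≥0∞) ^ q * 2⁻¹ ^ j
    _ = _ := by
        rw [jnConst, ht]
        ring

end JohnNirenberg

/-! ### Oscillations of bmo functions about the local constant. -/

section Bmo

variable {n : ℕ} {𝕜 : Type*} [RCLike 𝕜] {b : Rn n → 𝕜}

theorem setLIntegral_sub_ballConst_le [Nontrivial (Rn n)] (b : Rn n → 𝕜) (x : Rn n) {r : ℝ}
    (hr : 0 < r) :
    ∫⁻ y in closedBall x r, ‖b y - ballConst b x r‖ₑ ≤ bmoNorm b * volume (closedBall x r) := by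
  have h : ⨍⁻ y in ball x r, ‖b y - ballConst b x r‖ₑ ∂volume ≤ bmoNorm b :=
    le_iSup_of_le x (le_iSup_of_le r (le_iSup_of_le hr le_rfl))
  rw [setLAverage_eq, ENNReal.div_le_iff (measure_ball_pos _ _ hr).ne' measure_ball_lt_top.ne,
    measure_congr (ball_ae_eq_closedBall x r), setLIntegral_congr (ball_ae_eq_closedBall x r)] at h
  exact h

/-- For r < 1 the two constants agree; for r ≥ 1 this bounds the average of b itself, which is where
bmo is stronger than BMO. -/
theorem enorm_ballAvg_sub_ballConst_le [Nontrivial (Rn n)] (hb : LocallyIntegrable b volume)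
    (x : Rn n) {r : ℝ} (hr : 0 < r) : ‖ballAvg b x r - ballConst b x r‖ₑ ≤ bmoNorm b :=
  (ENNReal.mul_le_mul_iff_left (volume_closedBall_pos x hr).ne' (volume_closedBall_ne_top _ _)).1
    ((enorm_ballAvg_sub_mul_le hb x hr _).trans (setLIntegral_sub_ballConst_le b x hr))

/-- Passing from the local constant to the average costs a factor 2. The John–Nirenberg argument is
then applied with M twice the bmo norm. -/
theorem setLIntegral_sub_ballAvg_le [Nontrivial (Rn n)] (hb : LocallyIntegrable b volume)
    (x : Rn n) {r : ℝ} (hr : 0 < r) :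
    ∫⁻ y in closedBall x r, ‖b y - ballAvg b x r‖ₑ
      ≤ 2 * bmoNorm b * volume (closedBall x r) := by
  calc _ ≤ ∫⁻ y in closedBall x r,
        (‖b y - ballConst b x r‖ₑ + ‖ballAvg b x r - ballConst b x r‖ₑ) := by
        refine lintegral_mono fun y => ?_
        rw [← sub_sub_sub_cancel_right (b y) (ballAvg b x r) (ballConst b x r)]
        exact enorm_sub_le
    _ = (∫⁻ y in closedBall x r, ‖b y - ballConst b x r‖ₑ) +
        ‖ballAvg b x r - ballConst b x r‖ₑ * volume (closedBall x r) := by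
        rw [lintegral_add_right _ measurable_const, lintegral_const, Measure.restrict_apply_univ]
    _ ≤ bmoNorm b * volume (closedBall x r) + bmoNorm b * volume (closedBall x r) := by
        gcongr
        · exact setLIntegral_sub_ballConst_le b x hr
        · exact enorm_ballAvg_sub_ballConst_le hb x hr
    _ = _ := by ring

/-- Telescoping over the dyadic dilates: every doubling costs the same amount, and the final 1
replaces the average by the local constant. -/
theorem enorm_ballAvg_two_pow_sub_le [Nontrivial (Rn n)] (hb : LocallyIntegrable b volume)
    (x : Rn n) {r : ℝ} (hr : 0 < r) (k : ℕ) :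
    ‖ballAvg b x (2 ^ k * r) - ballConst b x r‖ₑ
      ≤ (k * (2 * ENNReal.ofReal (2 ^ n)) + 1) * bmoNorm b := by
  induction k with
  | zero => simpa using enorm_ballAvg_sub_ballConst_le hb x hr
  | succ k ih =>
    have h := (lintegral_double_ball_le hb
      (fun x r hr => setLIntegral_sub_ballAvg_le hb x hr) x
      (by positivity : 0 < 2 ^ k * r)).1
    rw [← mul_assoc, ← pow_succ'] at h
    rw [← sub_add_sub_cancel _ (ballAvg b x (2 ^ k * r)) _]
    refine (enorm_add_le _ _).trans ((add_le_add h ih).trans (le_of_eq ?_))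
    push_cast
    ring

/-- The constant in the growth estimate over dyadic dilates. -/
noncomputable def growthConst (n : ℕ) : ℝ≥0∞ := 2 * ENNReal.ofReal (2 ^ n) + 3

theorem setLIntegral_two_pow_sub_ballConst_le [Nontrivial (Rn n)]
    (hb : LocallyIntegrable b volume) (x : Rn n) {r : ℝ} (hr : 0 < r) (k : ℕ) :
    ∫⁻ y in closedBall x (2 ^ k * r), ‖b y - ballConst b x r‖ₑ
      ≤ ((k : ℝ≥0∞) + 1) * (growthConst n * bmoNorm b) * volume (closedBall x (2 ^ k * r)) := by
  set V := volume (closedBall x (2 ^ k * r)) with hV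
  calc _ ≤ ∫⁻ y in closedBall x (2 ^ k * r), (‖b y - ballAvg b x (2 ^ k * r)‖ₑ +
        ‖ballAvg b x (2 ^ k * r) - ballConst b x r‖ₑ) := by
        refine lintegral_mono fun y => ?_
        rw [← sub_add_sub_cancel (b y) (ballAvg b x (2 ^ k * r)) (ballConst b x r)]
        exact enorm_add_le _ _
    _ = (∫⁻ y in closedBall x (2 ^ k * r), ‖b y - ballAvg b x (2 ^ k * r)‖ₑ) +
        ‖ballAvg b x (2 ^ k * r) - ballConst b x r‖ₑ * V := by
        rw [lintegral_add_right _ measurable_const, lintegral_const, Measure.restrict_apply_univ]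
    _ ≤ 2 * bmoNorm b * V + (k * (2 * ENNReal.ofReal (2 ^ n)) + 1) * bmoNorm b * V := by
        gcongr
        · exact setLIntegral_sub_ballAvg_le hb x (by positivity)
        · exact enorm_ballAvg_two_pow_sub_le hb x hr k
    _ = (2 * ENNReal.ofReal (2 ^ n) * k + 3) * (bmoNorm b * V) := by ring
    _ ≤ (((k : ℝ≥0∞) + 1) * growthConst n) * (bmoNorm b * V) := by
        gcongr
        rw [growthConst]
        calc _ ≤ 2 * ENNReal.ofReal (2 ^ n) * k + 3 + (2 * ENNReal.ofReal (2 ^ n) + 3 * k) :=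
              le_self_add
          _ = _ := by ring
    _ = _ := by ring

/-- The constant in the `q`-th power estimate over the `2 ^ k`-fold dilate of a ball. -/
noncomputable def bmoConst (n q k : ℕ) : ℝ≥0∞ :=
  2 ^ q * (jnConst n q * 2 ^ q + (k * (2 * ENNReal.ofReal (2 ^ n)) + 1) ^ q)

theorem bmoConst_ne_top (n q k : ℕ) : bmoConst n q k ≠ ⊤ := by
  have := jnConst_ne_top n q
  unfold bmoConst
  finiteness

/-- John–Nirenberg on the dilated ball itself, plus the telescoped distance from its average to the
local constant of the small ball. -/
theorem setLIntegral_sub_ballConst_pow_le [Nontrivial (Rn n)] (hb : MemBmo b) (x : Rn n) {r : ℝ}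
    (hr : 0 < r) {q : ℕ} (hq : q ≠ 0) (k : ℕ) :
    ∫⁻ y in closedBall x (2 ^ k * r), ‖b y - ballConst b x r‖ₑ ^ q
      ≤ bmoConst n q k * bmoNorm b ^ q * volume (closedBall x (2 ^ k * r)) := by
  set V := volume (closedBall x (2 ^ k * r)) with hV
  set m := ballAvg b x (2 ^ k * r) with hm
  have hjn := lintegral_oscillation_pow_le hb.1 (ENNReal.mul_ne_top (by simp) hb.2.ne)
    (fun x r hr => setLIntegral_sub_ballAvg_le hb.1 x hr) hq x (by positivity : 0 < 2 ^ k * r)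
  calc _ ≤ ∫⁻ y in closedBall x (2 ^ k * r), 2 ^ q * (‖b y - m‖ₑ ^ q +
        ‖m - ballConst b x r‖ₑ ^ q) := by
        refine lintegral_mono fun y => ?_
        rw [← sub_add_sub_cancel (b y) m (ballConst b x r)]
        calc _ ≤ (‖b y - m‖ₑ + ‖m - ballConst b x r‖ₑ) ^ q := by
              gcongr
              exact enorm_add_le _ _
          _ ≤ (2 * max ‖b y - m‖ₑ ‖m - ballConst b x r‖ₑ) ^ q := by
              gcongr
              rw [two_mul]
              exact add_le_add (le_max_left _ _) (le_max_right _ _)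
          _ ≤ _ := by
              rw [mul_pow]
              gcongr
              rcases max_cases ‖b y - m‖ₑ ‖m - ballConst b x r‖ₑ with h | h
              · rw [h.1]
                exact le_self_add
              · rw [h.1]
                exact le_add_self
    _ = 2 ^ q * ((∫⁻ y in closedBall x (2 ^ k * r), ‖b y - m‖ₑ ^ q) +
        ‖m - ballConst b x r‖ₑ ^ q * V) := by
        rw [lintegral_const_mul' _ _ (by simp), lintegral_add_right _ measurable_const,
          lintegral_const, Measure.restrict_apply_univ]
    _ ≤ 2 ^ q * (jnConst n q * (2 * bmoNorm b) ^ q * V +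
        ((k * (2 * ENNReal.ofReal (2 ^ n)) + 1) * bmoNorm b) ^ q * V) := by
        gcongr
        exact enorm_ballAvg_two_pow_sub_le hb.1 x hr k
    _ = _ := by
        rw [bmoConst, mul_pow _ (bmoNorm b), mul_pow _ (bmoNorm b)]
        ring

theorem eLpNorm_restrict_sub_ballConst_le [Nontrivial (Rn n)] (hb : MemBmo b) (x : Rn n) {r : ℝ}
    (hr : 0 < r) {q : ℕ} (hq : q ≠ 0) (k : ℕ) :
    eLpNorm (fun y => b y - ballConst b x r) q (volume.restrict (closedBall x (2 ^ k * r)))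
      ≤ bmoConst n q k ^ (1 / q : ℝ) * bmoNorm b *
        volume (closedBall x (2 ^ k * r)) ^ (1 / q : ℝ) := by
  have hq0 : (q : ℝ) ≠ 0 := by exact_mod_cast hq
  have h := eLpNorm_nnreal_pow_eq_lintegral (μ := volume.restrict (closedBall x (2 ^ k * r)))
    (f := fun y => b y - ballConst b x r) (p := q) (by exact_mod_cast hq)
  simp only [NNReal.coe_natCast, ENNReal.rpow_natCast, ENNReal.coe_natCast] at h
  have h2 := setLIntegral_sub_ballConst_pow_le hb x hr hq k
  rw [← h] at h2
  have h3 := ENNReal.rpow_le_rpow h2 (z := 1 / q) (by positivity)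
  have h1q : (0 : ℝ) ≤ 1 / q := by positivity
  rw [ENNReal.mul_rpow_of_nonneg _ _ h1q, ENNReal.mul_rpow_of_nonneg _ _ h1q,
    ← ENNReal.rpow_natCast, ← ENNReal.rpow_natCast, ← ENNReal.rpow_mul, ← ENNReal.rpow_mul,
    mul_one_div_cancel hq0, ENNReal.rpow_one, ENNReal.rpow_one] at h3
  exact h3

/-- Converts the right side of the second cancellation condition, stated with the exponent-2 norm,
into the norm of the conclusion. -/
theorem bmoNormP_two_le [Nontrivial (Rn n)] (hb : MemBmo b) :
    bmoNormP 2 b ≤ bmoConst n 2 0 ^ (1 / 2 : ℝ) * bmoNorm b := by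
  have h : (⨆ (x₀ : Rn n) (r : ℝ) (_ : 0 < r),
      ⨍⁻ y in ball x₀ r, ‖b y - ballConst b x₀ r‖ₑ ^ (2 : ℝ) ∂volume)
      ≤ bmoConst n 2 0 * bmoNorm b ^ (2 : ℝ) := by
    refine iSup_le fun x => iSup_le fun r => iSup_le fun hr => ?_
    rw [setLAverage_eq, ENNReal.div_le_iff (measure_ball_pos _ _ hr).ne' measure_ball_lt_top.ne,
      measure_congr (ball_ae_eq_closedBall x r), setLIntegral_congr (ball_ae_eq_closedBall x r)]
    have := setLIntegral_sub_ballConst_pow_le hb x hr two_ne_zero 0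
    simpa using this
  calc bmoNormP 2 b ≤ (bmoConst n 2 0 * bmoNorm b ^ (2 : ℝ)) ^ (1 / 2 : ℝ) :=
        ENNReal.rpow_le_rpow h (by positivity)
    _ = _ := by
        rw [ENNReal.mul_rpow_of_nonneg _ _ (by positivity), ← ENNReal.rpow_mul]
        norm_num

end Bmo

/-! ### Size and moment estimates for atoms. -/

section Atoms

variable {n : ℕ} {𝕜 : Type*} [RCLike 𝕜] {b a : Rn n → 𝕜} {x₀ : Rn n} {r : ℝ}

/-- The defining properties of an approximate atom for a fixed ball. -/
structure IsAtomOn (b a : Rn n → 𝕜) (x₀ : Rn n) (r : ℝ) : Prop where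
  pos : 0 < r
  eq_zero : ∀ᵐ x ∂(volume : Measure (Rn n)), x ∉ closedBall x₀ r → a x = 0
  memLp : MemLp a 2 volume
  norm_le : eLpNorm a 2 volume ≤ volume (closedBall x₀ r) ^ (-(1 / 2 : ℝ))
  integral_le : ‖∫ x, a x‖ ≤ 1 / Real.log (1 + r⁻¹) ^ 2
  cancel : ‖∫ x, a x * (b x - ballConst b x₀ r)‖ₑ
    ≤ bmoNormP 2 b / ENNReal.ofReal (Real.log (1 + r⁻¹))

theorem IsApproxAtom.exists_isAtomOn [Nontrivial (Rn n)] (h : IsApproxAtom b a) :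
    ∃ x₀ r, IsAtomOn b a x₀ r := by
  obtain ⟨x₀, r, hr, h0, h2, hn, hi, hc⟩ := h
  refine ⟨x₀, r, hr, ?_, h2, ?_, hi, hc⟩
  · filter_upwards [h0] with x hx hx2 using hx fun h => hx2 (ball_subset_closedBall h)
  · rwa [← measure_congr (ball_ae_eq_closedBall x₀ r)]

theorem eLpNorm_restrict_of_ae_zero {s : ℝ≥0∞} {f : Rn n → 𝕜}
    (h : ∀ᵐ x ∂(volume : Measure (Rn n)), x ∉ closedBall x₀ r → f x = 0) :
    eLpNorm f s (volume.restrict (closedBall x₀ r)) = eLpNorm f s volume := by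
  rw [← eLpNorm_indicator_eq_eLpNorm_restrict measurableSet_closedBall]
  refine eLpNorm_congr_ae ?_
  filter_upwards [h] with x hx
  by_cases hx2 : x ∈ closedBall x₀ r
  · rw [indicator_of_mem hx2]
  · rw [indicator_of_notMem hx2, hx hx2]

/-- Hölder's inequality for the product of the oscillation of `b` with an atom. -/
theorem IsAtomOn.eLpNorm_mul_le [Nontrivial (Rn n)] (ha : IsAtomOn b a x₀ r) (hb : MemBmo b)
    {q : ℕ} (hq : q ≠ 0) {p : ℝ≥0∞} [ENNReal.HolderTriple q 2 p] :
    eLpNorm (fun x => (b x - ballConst b x₀ r) * a x) p volume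
      ≤ bmoConst n q 0 ^ (1 / q : ℝ) * bmoNorm b *
        (volume (closedBall x₀ r) ^ (1 / q : ℝ) * volume (closedBall x₀ r) ^ (-(1 / 2 : ℝ))) := by
  have hb1 : AEStronglyMeasurable (fun x => b x - ballConst b x₀ r)
      (volume : Measure (Rn n)) := hb.1.aestronglyMeasurable.sub aestronglyMeasurable_const
  have hosc := eLpNorm_restrict_sub_ballConst_le hb x₀ ha.pos hq 0
  rw [pow_zero, one_mul] at hosc
  rw [← eLpNorm_restrict_of_ae_zero (x₀ := x₀) (r := r) (by
    filter_upwards [ha.eq_zero] with x hx hx2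
    rw [hx hx2, mul_zero])]
  refine (eLpNorm_smul_le_mul_eLpNorm (p := q) (q := 2) (φ := fun x => b x - ballConst b x₀ r)
    (f := a) ha.memLp.1.restrict hb1.restrict).trans ?_
  calc _ ≤ (bmoConst n q 0 ^ (1 / q : ℝ) * bmoNorm b * volume (closedBall x₀ r) ^ (1 / q : ℝ)) *
        volume (closedBall x₀ r) ^ (-(1 / 2 : ℝ)) := by
        gcongr
        exact (eLpNorm_mono_measure _ Measure.restrict_le_self).trans ha.norm_le
    _ = _ := by ring

theorem IsAtomOn.lintegral_enorm_le [Nontrivial (Rn n)] (ha : IsAtomOn b a x₀ r) :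
    ∫⁻ x, ‖a x‖ₑ ≤ 1 := by
  have hV0 := (volume_closedBall_pos x₀ ha.pos).ne'
  have hVt := volume_closedBall_ne_top x₀ r
  rw [← eLpNorm_one_eq_lintegral_enorm, ← eLpNorm_restrict_of_ae_zero ha.eq_zero]
  refine (eLpNorm_le_eLpNorm_mul_rpow_measure_univ one_le_two ha.memLp.1.restrict).trans ?_
  rw [eLpNorm_restrict_of_ae_zero ha.eq_zero, Measure.restrict_apply_univ]
  calc _ ≤ volume (closedBall x₀ r) ^ (-(1 / 2 : ℝ)) * volume (closedBall x₀ r) ^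
        (1 / (1 : ℝ≥0∞).toReal - 1 / (2 : ℝ≥0∞).toReal) := by
        gcongr
        exact ha.norm_le
    _ = 1 := by
        rw [← ENNReal.rpow_add _ _ hV0 hVt]
        norm_num

theorem IsAtomOn.lintegral_mul_le [Nontrivial (Rn n)] (ha : IsAtomOn b a x₀ r) (hb : MemBmo b) :
    ∫⁻ x, ‖(b x - ballConst b x₀ r) * a x‖ₑ ≤ bmoConst n 2 0 ^ (1 / 2 : ℝ) * bmoNorm b := by
  have hV0 := (volume_closedBall_pos x₀ ha.pos).ne'
  have hVt := volume_closedBall_ne_top x₀ r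
  have : ENNReal.HolderTriple ((2 : ℕ) : ℝ≥0∞) 2 1 := by
    rw [Nat.cast_ofNat]
    infer_instance
  have h := ha.eLpNorm_mul_le hb two_ne_zero (p := 1)
  rw [eLpNorm_one_eq_lintegral_enorm, ← ENNReal.rpow_add _ _ hV0 hVt] at h
  simpa using h

theorem IsAtomOn.log_pos (ha : IsAtomOn b a x₀ r) : 0 < Real.log (1 + r⁻¹) :=
  Real.log_pos (by simpa using ha.pos)

/-- For large r the logarithm L is small and the cancellation condition says little, but the mean is
at most 1 anyway. Treating L ≤ 1 and L > 1 separately permits 1 + L in place of L, at the cost of a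
factor 4. -/
theorem IsAtomOn.enorm_integral_mul_log_sq_le [Nontrivial (Rn n)] (ha : IsAtomOn b a x₀ r) :
    ‖∫ x, a x‖ₑ * ENNReal.ofReal (1 + Real.log (1 + r⁻¹)) ^ 2 ≤ 4 := by
  have hL := ha.log_pos
  have hI := ha.integral_le
  have hI1 : ‖∫ x, a x‖ ≤ 1 := by
    have h := (enorm_integral_le_lintegral_enorm a).trans ha.lintegral_enorm_le
    rw [← ofReal_norm] at h
    exact ENNReal.ofReal_le_one.1 h
  set L := Real.log (1 + r⁻¹) with hLdef
  rw [← ofReal_norm, ← ENNReal.ofReal_pow (by positivity), ← ENNReal.ofReal_mul (norm_nonneg _)]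
  refine ENNReal.ofReal_le_of_le_toReal ?_
  rw [ENNReal.toReal_ofNat]
  rcases le_or_gt L 1 with h1 | h1
  · calc _ ≤ 1 * (1 + L) ^ 2 := by gcongr
      _ ≤ 4 := by nlinarith
  · calc _ ≤ 1 / L ^ 2 * (1 + L) ^ 2 := by gcongr
      _ ≤ 4 := by
        rw [div_mul_eq_mul_div, one_mul, div_le_iff₀ (by positivity)]
        nlinarith

/-- In 1 + L the summand 1 is covered by Hölder's inequality and the summand L by the cancellation
condition, hence the factor 2. -/
theorem IsAtomOn.enorm_integral_mul_mul_log_le [Nontrivial (Rn n)] (ha : IsAtomOn b a x₀ r)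
    (hb : MemBmo b) :
    ‖∫ x, (b x - ballConst b x₀ r) * a x‖ₑ * ENNReal.ofReal (1 + Real.log (1 + r⁻¹))
      ≤ 2 * (bmoConst n 2 0 ^ (1 / 2 : ℝ) * bmoNorm b) := by
  have hL := ha.log_pos
  have h1 := (enorm_integral_le_lintegral_enorm _).trans (ha.lintegral_mul_le hb)
  have h2 := ha.cancel
  simp only [mul_comm (a _)] at h2
  rw [ENNReal.ofReal_add zero_le_one hL.le, ENNReal.ofReal_one, mul_add, mul_one, two_mul]
  refine add_le_add h1 ?_
  calc _ ≤ bmoNormP 2 b / ENNReal.ofReal (Real.log (1 + r⁻¹)) *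
        ENNReal.ofReal (Real.log (1 + r⁻¹)) := by gcongr
    _ = bmoNormP 2 b := ENNReal.div_mul_cancel (by simpa using hL) ENNReal.ofReal_ne_top
    _ ≤ _ := bmoNormP_two_le hb

end Atoms

/-! ### The commutator away from the ball. -/

section Commutator

variable {n : ℕ} {𝕜 : Type*} [RCLike 𝕜] {b a : Rn n → 𝕜} {x₀ : Rn n} {r : ℝ}
  {δ ε C : ℝ} {K : Rn n → Rn n → 𝕜}
  {T : Lp 𝕜 2 (volume : Measure (Rn n)) →L[𝕜] Lp 𝕜 2 (volume : Measure (Rn n))}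
  {p : ℝ≥0∞} [Fact (1 ≤ p)]
  {Tp : Lp 𝕜 p (volume : Measure (Rn n)) →L[𝕜] Lp 𝕜 p (volume : Measure (Rn n))}

theorem KernelBounds.enorm_le (hK : KernelBounds δ ε C K) {x y : Rn n} (hxy : x ≠ y) :
    ‖K x y‖ₑ ≤ ENNReal.ofReal C *
      ENNReal.ofReal (min (‖x - y‖ ^ (-(n : ℝ))) (‖x - y‖ ^ (-(n : ℝ) - ε))) := by
  rw [← ENNReal.ofReal_mul hK.const_nonneg, mul_min_of_nonneg _ _ hK.const_nonneg, ← ofReal_norm]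
  exact ENNReal.ofReal_le_ofReal (le_min (hK.size x y hxy) (hK.decay x y hxy))

/-- The constant in the estimate of the commutator away from the ball of the atom. -/
noncomputable def farConst (n : ℕ) (δ ε C : ℝ) : ℝ≥0∞ :=
  ENNReal.ofReal C * (annulusConst n δ * (3 * growthConst n + bmoConst n 2 0 ^ (1 / 2 : ℝ)) +
    annulusConst n ε * (12 * growthConst n + 2 * bmoConst n 2 0 ^ (1 / 2 : ℝ)))

set_option maxHeartbeats 1000000 in
-- Freezing the kernel at x₀ in both operators leaves two error terms, controlled by smoothness
-- alone, and two main terms, in which the logarithms lost to the size of K are repaid by the moment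
-- conditions on the atom.
theorem IsAtomOn.lintegral_far_le [Nontrivial (Rn n)] (ha : IsAtomOn b a x₀ r) (hb : MemBmo b)
    (hK : KernelBounds δ ε C K) (hT : HasKernel K 2 T) (hTp : HasKernel K p Tp) (hpt : p ≠ ⊤)
    (hu : MemLp (fun x => (b x - ballConst b x₀ r) * a x) p volume) :
    ∫⁻ x in {x | 4 * r ≤ ‖x - x₀‖}, ‖(b x - ballConst b x₀ r) * T (ha.memLp.toLp a) x
        - Tp (hu.toLp (fun x => (b x - ballConst b x₀ r) * a x)) x‖ₑ
      ≤ farConst n δ ε C * bmoNorm b := by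
  have hr := ha.pos
  have h4r : 0 < 4 * r := by positivity
  set g : Rn n → 𝕜 := fun x => b x - ballConst b x₀ r with hg
  set N := bmoNorm b with hN
  set A := bmoConst n 2 0 ^ (1 / 2 : ℝ) with hA
  set Ia := ∫ x, a x with hIa
  set Iu := ∫ x, g x * a x with hIu
  set ℓ := ENNReal.ofReal (1 + Real.log (1 + (4 * r)⁻¹)) with hℓ
  have hℓr : ℓ ≤ ENNReal.ofReal (1 + Real.log (1 + r⁻¹)) := by
    refine ENNReal.ofReal_le_ofReal ?_
    gcongr
    linarith
  have hgm : AEMeasurable (fun x => ‖g x‖ₑ) ((volume : Measure (Rn n)).restrict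
      {x | 4 * r ≤ ‖x - x₀‖}) :=
    (hb.1.aestronglyMeasurable.sub aestronglyMeasurable_const).enorm.restrict
  set E : Rn n → ℝ≥0∞ := fun x =>
    ENNReal.ofReal (C * (2 * r) ^ δ * ‖x - x₀‖ ^ (-(n : ℝ) - δ)) with hE
  set m : Rn n → ℝ≥0∞ := fun x =>
    ENNReal.ofReal (min (‖x - x₀‖ ^ (-(n : ℝ))) (‖x - x₀‖ ^ (-(n : ℝ) - ε))) with hm
  have hEm : Measurable E := by fun_prop
  have hmm : Measurable m := by fun_prop
  have hgmm : AEMeasurable (fun x => ‖g x‖ₑ * m x) ((volume : Measure (Rn n)).restrict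
      {x | 4 * r ≤ ‖x - x₀‖}) := hgm.mul hmm.aemeasurable
  -- Since 4r = 2²r, the growth estimate is used at k + 2, and k + 3 ≤ 3(k + 1) restores the linear
  -- form.
  have hgrow : ∀ k : ℕ, ∫⁻ x in closedBall x₀ (2 ^ k * (4 * r)), ‖g x‖ₑ
      ≤ ((k : ℝ≥0∞) + 1) * (3 * growthConst n * N) *
        volume (closedBall x₀ (2 ^ k * (4 * r))) := fun k => by
    have h := setLIntegral_two_pow_sub_ballConst_le hb.1 x₀ hr (k + 2)
    rw [show (2 : ℝ) ^ (k + 2) * r = 2 ^ k * (4 * r) by ring] at h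
    refine h.trans ?_
    have h3 : (((k + 2 : ℕ) : ℝ≥0∞) + 1) ≤ (k + 1) * 3 := by
      have : k + 2 + 1 ≤ (k + 1) * 3 := by omega
      exact_mod_cast this
    calc _ ≤ ((k : ℝ≥0∞) + 1) * 3 * (growthConst n * N) * _ := by gcongr
      _ = _ := by ring
  have hone : ∀ k : ℕ, ∫⁻ x in closedBall x₀ (2 ^ k * (4 * r)), (1 : ℝ≥0∞)
      ≤ 1 * volume (closedBall x₀ (2 ^ k * (4 * r))) := fun k => by
    rw [setLIntegral_one, one_mul]
  have b1 := setLIntegral_mul_offDiagonal_le hK.delta_pos hK.const_nonneg hr hgrow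
  have b2 := setLIntegral_mul_min_le_of_linear hK.eps_pos h4r hgrow
  have b3 := setLIntegral_mul_offDiagonal_le hK.delta_pos hK.const_nonneg hr
    (fun k => (hone k).trans (mul_le_mul_left (le_mul_of_one_le_left' le_add_self) _))
  have b4 := setLIntegral_mul_min_le hK.eps_pos h4r hone
  simp only [one_mul, mul_one] at b3 b4
  have hIaE : ‖Ia‖ₑ * ℓ ^ 2 ≤ 4 := le_trans (by gcongr) ha.enorm_integral_mul_log_sq_le
  have hIuE : ‖Iu‖ₑ * ℓ ≤ 2 * (A * N) := le_trans (by gcongr) (ha.enorm_integral_mul_mul_log_le hb)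
  have husupp : ∀ᵐ x ∂(volume : Measure (Rn n)), x ∉ closedBall x₀ r → g x * a x = 0 := by
    filter_upwards [ha.eq_zero] with x hx hx2
    rw [hx hx2, mul_zero]
  calc _ ≤ ∫⁻ x in {x | 4 * r ≤ ‖x - x₀‖}, (‖g x‖ₑ * E x +
        (ENNReal.ofReal C * ‖Ia‖ₑ) * (‖g x‖ₑ * m x) + (A * N) * E x +
          (ENNReal.ofReal C * ‖Iu‖ₑ) * m x) := by
        refine lintegral_mono_ae ?_
        filter_upwards [ae_restrict_mem (measurableSet_far x₀ (4 * r)), ae_restrict_of_ae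
          (hT.enorm_sub_le hK (by simp) ha.memLp hr ha.eq_zero), ae_restrict_of_ae
          (hTp.enorm_sub_le hK hpt hu hr husupp)] with x hx hxa hxu
        have hxx : x ≠ x₀ := by
          rintro rfl
          have : 4 * r ≤ 0 := by simpa using hx
          linarith
        have hKx := hK.enorm_le hxx
        have h1 := (hxa hx).trans (mul_le_mul_right ha.lintegral_enorm_le _)
        have h2 := (hxu hx).trans (mul_le_mul_right (ha.lintegral_mul_le hb) _)
        rw [mul_one] at h1
        -- In order: error of T(a), main term of T(a), error of T(g·a), main term of T(g·a).
        have hsplit : g x * T (ha.memLp.toLp a) x - Tp (hu.toLp (fun x => g x * a x)) x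
            = g x * (T (ha.memLp.toLp a) x - K x x₀ * Ia) + g x * (K x x₀ * Ia) -
              (Tp (hu.toLp (fun x => g x * a x)) x - K x x₀ * Iu) - K x x₀ * Iu := by ring
        rw [hsplit]
        refine enorm_sub_le.trans (add_le_add (enorm_sub_le.trans (add_le_add
          ((enorm_add_le _ _).trans (add_le_add ?_ ?_)) ?_)) ?_)
        · rw [enorm_mul]
          gcongr
        · rw [enorm_mul, enorm_mul]
          calc _ ≤ ‖g x‖ₑ * ((ENNReal.ofReal C * m x) * ‖Ia‖ₑ) := by gcongr
            _ = _ := by ring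
        · rw [mul_comm (A * N)]
          exact h2
        · rw [enorm_mul]
          calc _ ≤ (ENNReal.ofReal C * m x) * ‖Iu‖ₑ := by gcongr
            _ = _ := by ring
    _ = (∫⁻ x in {x | 4 * r ≤ ‖x - x₀‖}, ‖g x‖ₑ * E x) +
        (ENNReal.ofReal C * ‖Ia‖ₑ) * (∫⁻ x in {x | 4 * r ≤ ‖x - x₀‖}, ‖g x‖ₑ * m x) +
        (A * N) * (∫⁻ x in {x | 4 * r ≤ ‖x - x₀‖}, E x) +
        (ENNReal.ofReal C * ‖Iu‖ₑ) * ∫⁻ x in {x | 4 * r ≤ ‖x - x₀‖}, m x := by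
        rw [lintegral_add_right _ (hmm.const_mul _), lintegral_add_right _ (hEm.const_mul _),
          lintegral_add_right' _ (hgmm.const_mul _),
          lintegral_const_mul _ hmm, lintegral_const_mul _ hEm,
          lintegral_const_mul'' _ hgmm]
    _ ≤ ENNReal.ofReal C * annulusConst n δ * (3 * growthConst n * N) +
        (ENNReal.ofReal C * ‖Ia‖ₑ) * (annulusConst n ε * ℓ ^ 2 * (3 * growthConst n * N)) +
        (A * N) * (ENNReal.ofReal C * annulusConst n δ) +
        (ENNReal.ofReal C * ‖Iu‖ₑ) * (annulusConst n ε * ℓ) := by gcongr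
    -- Regrouped so that ℓ² stands next to the mean of the atom and ℓ next to that of g·a, ready for
    -- `hIaE` and `hIuE`.
    _ = ENNReal.ofReal C * annulusConst n δ * (3 * growthConst n * N) +
        (‖Ia‖ₑ * ℓ ^ 2) * (ENNReal.ofReal C * annulusConst n ε * (3 * growthConst n * N)) +
        (A * N) * (ENNReal.ofReal C * annulusConst n δ) +
        (‖Iu‖ₑ * ℓ) * (ENNReal.ofReal C * annulusConst n ε) := by ring
    _ ≤ ENNReal.ofReal C * annulusConst n δ * (3 * growthConst n * N) +
        4 * (ENNReal.ofReal C * annulusConst n ε * (3 * growthConst n * N)) +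
        (A * N) * (ENNReal.ofReal C * annulusConst n δ) +
        (2 * (A * N)) * (ENNReal.ofReal C * annulusConst n ε) := by gcongr
    _ = _ := by
        rw [farConst]
        ring

end Commutator

/-! ### The commutator near the ball. -/

section Near

variable {n : ℕ} {𝕜 : Type*} [RCLike 𝕜] {b a : Rn n → 𝕜} {x₀ : Rn n} {r : ℝ}
  {T : Lp 𝕜 2 (volume : Measure (Rn n)) →L[𝕜] Lp 𝕜 2 (volume : Measure (Rn n))}
  {p : ℝ≥0∞} [Fact (1 ≤ p)]
  {Tp : Lp 𝕜 p (volume : Measure (Rn n)) →L[𝕜] Lp 𝕜 p (volume : Measure (Rn n))}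

theorem volume_closedBall_rpow_le (x : Rn n) (r : ℝ) {s : ℝ} (hs : 0 ≤ s) :
    volume (closedBall x (4 * r)) ^ s
      ≤ ENNReal.ofReal (4 ^ n) ^ s * volume (closedBall x r) ^ s := by
  rw [← ENNReal.mul_rpow_of_nonneg _ _ hs]
  exact ENNReal.rpow_le_rpow (volume_closedBall_mul_le x x (by norm_num) r) hs

/-- The constant in the estimate of `(b - c) T a` near the ball of the atom. -/
noncomputable def nearConst (n : ℕ) : ℝ≥0∞ :=
  bmoConst n 2 2 ^ (1 / 2 : ℝ) * ENNReal.ofReal (4 ^ n) ^ (1 / 2 : ℝ)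

theorem nearConst_ne_top (n : ℕ) : nearConst n ≠ ⊤ := by
  have := bmoConst_ne_top n 2 2
  unfold nearConst
  finiteness

/-- Cauchy–Schwarz: the L² norm of the oscillation over the ball of radius 4r (two doublings) is of
order |B|^{1/2}, that of T(a) of order |B|^{-1/2}. -/
theorem IsAtomOn.lintegral_near_mul_apply_le [Nontrivial (Rn n)] (ha : IsAtomOn b a x₀ r)
    (hb : MemBmo b) :
    ∫⁻ x in closedBall x₀ (4 * r), ‖(b x - ballConst b x₀ r) * T (ha.memLp.toLp a) x‖ₑ
      ≤ nearConst n * ‖T‖ₑ * bmoNorm b := by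
  have hV0 := (volume_closedBall_pos x₀ ha.pos).ne'
  have hVt := volume_closedBall_ne_top x₀ r
  have hb1 : AEStronglyMeasurable (fun x => b x - ballConst b x₀ r)
      (volume : Measure (Rn n)) := hb.1.aestronglyMeasurable.sub aestronglyMeasurable_const
  have hosc := eLpNorm_restrict_sub_ballConst_le hb x₀ ha.pos two_ne_zero 2
  rw [show (2 : ℝ) ^ 2 * r = 4 * r by norm_num] at hosc
  simp only [Nat.cast_ofNat] at hosc
  rw [← eLpNorm_one_eq_lintegral_enorm]
  refine (eLpNorm_smul_le_mul_eLpNorm (p := 2) (q := 2) (r := 1)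
    (φ := fun x => b x - ballConst b x₀ r) (f := T (ha.memLp.toLp a))
    (Lp.aestronglyMeasurable _).restrict hb1.restrict).trans ?_
  set V := volume (closedBall x₀ r)
  calc _ ≤ (bmoConst n 2 2 ^ (1 / 2 : ℝ) * bmoNorm b *
        (ENNReal.ofReal (4 ^ n) ^ (1 / 2 : ℝ) * V ^ (1 / 2 : ℝ))) *
        (‖T‖ₑ * V ^ (-(1 / 2 : ℝ))) := by
        refine mul_le_mul' (hosc.trans ?_) ?_
        · gcongr
          exact volume_closedBall_rpow_le x₀ r (by norm_num)
        · exact (eLpNorm_mono_measure _ Measure.restrict_le_self).trans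
            ((eLpNorm_apply_toLp_le T ha.memLp).trans (by gcongr; exact ha.norm_le))
    _ = nearConst n * ‖T‖ₑ * bmoNorm b * (V ^ (1 / 2 : ℝ) * V ^ (-(1 / 2 : ℝ))) := by
        rw [nearConst]
        ring
    _ = _ := by
        rw [← ENNReal.rpow_add _ _ hV0 hVt]
        simp

/-- The product of an L⁴ oscillation and an L² atom lies in L^{4/3}. This exponent is in the
interpolation range (1,2), and 4 is an integer, as the power form of John–Nirenberg requires. -/
instance holderTriple_four_two :
    ENNReal.HolderTriple ((4 : ℕ) : ℝ≥0∞) 2 (ENNReal.ofReal (4 / 3)) where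
  inv_add_inv_eq_inv := by
    rw [← ENNReal.ofReal_inv_of_pos (by norm_num), ← ENNReal.toReal_eq_toReal_iff' (by simp) (by simp),
      ENNReal.toReal_add (by simp) (by simp), ENNReal.toReal_ofReal (by norm_num)]
    norm_num

instance fact_one_le_four_thirds : Fact (1 ≤ ENNReal.ofReal (4 / 3)) :=
  ⟨by rw [ENNReal.one_le_ofReal]; norm_num⟩

/-- The constant in the estimate of `T ((b - c) a)` near the ball of the atom. -/
noncomputable def nearApplyConst (n : ℕ) : ℝ≥0∞ :=
  bmoConst n 4 0 ^ (1 / 4 : ℝ) * ENNReal.ofReal (4 ^ n) ^ (1 / 4 : ℝ)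

theorem nearApplyConst_ne_top (n : ℕ) : nearApplyConst n ≠ ⊤ := by
  have := bmoConst_ne_top n 4 0
  unfold nearApplyConst
  finiteness

theorem IsAtomOn.memLp_mul [Nontrivial (Rn n)] (ha : IsAtomOn b a x₀ r) (hb : MemBmo b) :
    MemLp (fun x => (b x - ballConst b x₀ r) * a x) (ENNReal.ofReal (4 / 3)) volume := by
  refine ⟨(hb.1.aestronglyMeasurable.sub aestronglyMeasurable_const).mul ha.memLp.1,
    (ha.eLpNorm_mul_le hb (q := 4) (by norm_num)).trans_lt ?_⟩
  have hV0 := (volume_closedBall_pos x₀ ha.pos).ne'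
  have hVt := volume_closedBall_ne_top x₀ r
  have := bmoConst_ne_top n 4 0
  have := hb.2.ne
  rw [← ENNReal.rpow_add _ _ hV0 hVt]
  have := ENNReal.rpow_ne_top_of_ne_zero hV0 hVt (y := 1 / (4 : ℕ) + -(1 / 2))
  finiteness

/-- L^{4/3} boundedness followed by Hölder on the ball of radius 4r; the powers of |B| are 1/4 - 1/2
+ 1/4 = 0. -/
theorem IsAtomOn.lintegral_near_apply_mul_le [Nontrivial (Rn n)] (ha : IsAtomOn b a x₀ r)
    (hb : MemBmo b)
    (S : Lp 𝕜 (ENNReal.ofReal (4 / 3)) (volume : Measure (Rn n)) →L[𝕜]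
      Lp 𝕜 (ENNReal.ofReal (4 / 3)) (volume : Measure (Rn n))) :
    ∫⁻ x in closedBall x₀ (4 * r),
        ‖S ((ha.memLp_mul hb).toLp (fun x => (b x - ballConst b x₀ r) * a x)) x‖ₑ
      ≤ nearApplyConst n * ‖S‖ₑ * bmoNorm b := by
  have hV0 := (volume_closedBall_pos x₀ ha.pos).ne'
  have hVt := volume_closedBall_ne_top x₀ r
  have h := ha.eLpNorm_mul_le hb (q := 4) (p := ENNReal.ofReal (4 / 3)) (by norm_num)
  rw [← eLpNorm_one_eq_lintegral_enorm]
  refine (eLpNorm_le_eLpNorm_mul_rpow_measure_univ fact_one_le_four_thirds.out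
    (Lp.aestronglyMeasurable _).restrict).trans ?_
  rw [Measure.restrict_apply_univ, ENNReal.toReal_one, ENNReal.toReal_ofReal (by norm_num),
    show (1 / 1 - 1 / (4 / 3) : ℝ) = 1 / 4 by norm_num]
  simp only [Nat.cast_ofNat] at h
  set V := volume (closedBall x₀ r)
  calc _ ≤ (‖S‖ₑ * (bmoConst n 4 0 ^ (1 / 4 : ℝ) * bmoNorm b *
        (V ^ (1 / 4 : ℝ) * V ^ (-(1 / 2 : ℝ))))) *
        (ENNReal.ofReal (4 ^ n) ^ (1 / 4 : ℝ) * V ^ (1 / 4 : ℝ)) := by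
        refine mul_le_mul' ?_ (volume_closedBall_rpow_le x₀ r (by norm_num))
        exact (eLpNorm_mono_measure _ Measure.restrict_le_self).trans
          ((eLpNorm_apply_toLp_le S (ha.memLp_mul hb)).trans (by gcongr))
    _ = nearApplyConst n * ‖S‖ₑ * bmoNorm b *
        (V ^ (1 / 4 : ℝ) * V ^ (-(1 / 2 : ℝ)) * V ^ (1 / 4 : ℝ)) := by
        rw [nearApplyConst]
        ring
    _ = _ := by
        rw [← ENNReal.rpow_add _ _ hV0 hVt, ← ENNReal.rpow_add _ _ hV0 hVt]
        norm_num

end Near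

/-! ### Assembly and linearity of the commutator. -/

section Main

variable {n : ℕ} {𝕜 : Type*} [RCLike 𝕜] {b a f : Rn n → 𝕜} {x₀ : Rn n} {r : ℝ}
  {T : Lp 𝕜 2 (volume : Measure (Rn n)) →L[𝕜] Lp 𝕜 2 (volume : Measure (Rn n))}
  {S : Lp 𝕜 (ENNReal.ofReal (4 / 3)) (volume : Measure (Rn n)) →L[𝕜]
    Lp 𝕜 (ENNReal.ofReal (4 / 3)) (volume : Measure (Rn n))}

theorem farConst_ne_top (n : ℕ) {δ ε : ℝ} (hδ : 0 < δ) (hε : 0 < ε) (C : ℝ) :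
    farConst n δ ε C ≠ ⊤ := by
  have := annulusConst_ne_top n hδ
  have := annulusConst_ne_top n hε
  have := bmoConst_ne_top n 2 0
  have : growthConst n ≠ ⊤ := by
    unfold growthConst
    finiteness
  unfold farConst
  finiteness

theorem IsAtomOn.lintegral_commutator_le [Nontrivial (Rn n)] {δ ε C : ℝ} {K : Rn n → Rn n → 𝕜}
    (ha : IsAtomOn b a x₀ r) (hb : MemBmo b)
    (hK : KernelBounds δ ε C K) (hT : HasKernel K 2 T) (hS : IsLpExtension T _ S) :
    ∫⁻ x, ‖(b x - ballConst b x₀ r) * T (ha.memLp.toLp a) x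
        - S ((ha.memLp_mul hb).toLp (fun x => (b x - ballConst b x₀ r) * a x)) x‖ₑ
      ≤ (nearConst n * ‖T‖ₑ + nearApplyConst n * ‖S‖ₑ + farConst n δ ε C) * bmoNorm b := by
  have hfar := ha.lintegral_far_le hb hK hT (hT.of_extension hS) ENNReal.ofReal_ne_top
    (ha.memLp_mul hb)
  have hnear : ∫⁻ x in closedBall x₀ (4 * r), ‖(b x - ballConst b x₀ r) * T (ha.memLp.toLp a) x
      - S ((ha.memLp_mul hb).toLp (fun x => (b x - ballConst b x₀ r) * a x)) x‖ₑ
      ≤ nearConst n * ‖T‖ₑ * bmoNorm b + nearApplyConst n * ‖S‖ₑ * bmoNorm b := by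
    refine (lintegral_mono fun x => enorm_sub_le).trans ?_
    rw [lintegral_add_right' _ (Lp.aestronglyMeasurable _).enorm.restrict]
    exact add_le_add (ha.lintegral_near_mul_apply_le hb) (ha.lintegral_near_apply_mul_le hb S)
  have hcover : (univ : Set (Rn n)) ⊆ closedBall x₀ (4 * r) ∪ {x | 4 * r ≤ ‖x - x₀‖} := by
    intro x _
    rcases le_total ‖x - x₀‖ (4 * r) with h | h
    · exact Or.inl (mem_closedBall_iff_norm.2 h)
    · exact Or.inr h
  rw [← setLIntegral_univ]
  refine (lintegral_mono_set hcover).trans ((lintegral_union_le _ _ _).trans ?_)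
  calc _ ≤ _ := add_le_add hnear hfar
    _ = _ := by ring

/-- The commutator, for an extension of the operator to a fixed Lebesgue space, is defined at `f`
and integrable. -/
def HasIntegrableCommutator (b : Rn n → 𝕜)
    (T : Lp 𝕜 2 (volume : Measure (Rn n)) →L[𝕜] Lp 𝕜 2 (volume : Measure (Rn n)))
    (S : Lp 𝕜 (ENNReal.ofReal (4 / 3)) (volume : Measure (Rn n)) →L[𝕜]
      Lp 𝕜 (ENNReal.ofReal (4 / 3)) (volume : Measure (Rn n))) (f : Rn n → 𝕜) : Prop :=
  ∃ (hf : MemLp f 2 volume)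
    (hbf : MemLp (fun x => b x * f x) (ENNReal.ofReal (4 / 3)) volume),
    MemLp (fun x => b x * T (hf.toLp f) x - S (hbf.toLp (fun x => b x * f x)) x) 1 volume

theorem HasIntegrableCommutator.exists_isCommutator (h : HasIntegrableCommutator b T S f)
    (hS : IsLpExtension T _ S) : ∃ g, IsCommutator b T f g ∧ MemLp g 1 volume := by
  obtain ⟨hf, hbf, h1⟩ := h
  refine ⟨_, ⟨_, _, S, hf, hbf, ?_, ENNReal.ofReal_lt_top, hS, ae_eq_rfl⟩, h1⟩
  rw [ENNReal.one_lt_ofReal]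
  norm_num

theorem HasIntegrableCommutator.zero : HasIntegrableCommutator b T S 0 := by
  have h0 : MemLp (0 : Rn n → 𝕜) 2 volume := MemLp.zero
  have h1 : MemLp (fun x => b x * (0 : Rn n → 𝕜) x) (ENNReal.ofReal (4 / 3)) volume := by
    simp
  refine ⟨h0, h1, MemLp.ae_eq (f := 0) ?_ MemLp.zero⟩
  have e1 : h0.toLp 0 = 0 := MemLp.toLp_zero h0
  have e2 : h1.toLp (fun x => b x * (0 : Rn n → 𝕜) x) = 0 := by
    rw [Lp.ext_iff]
    filter_upwards [h1.coeFn_toLp, Lp.coeFn_zero 𝕜 (ENNReal.ofReal (4 / 3)) (volume : Measure (Rn n))]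
      with x h h'
    rw [h, h', Pi.zero_apply, mul_zero]
  rw [e1, e2, map_zero, map_zero]
  filter_upwards [Lp.coeFn_zero 𝕜 2 (volume : Measure (Rn n)),
    Lp.coeFn_zero 𝕜 (ENNReal.ofReal (4 / 3)) (volume : Measure (Rn n))] with x h h'
  rw [h, h']
  simp

/-- With the extension `S` fixed the commutator is linear in the function; this and its companions
for zero and scalars are the cases of the induction over the span of the atoms. -/
theorem HasIntegrableCommutator.add {f g : Rn n → 𝕜} (hf : HasIntegrableCommutator b T S f)
    (hg : HasIntegrableCommutator b T S g) : HasIntegrableCommutator b T S (f + g) := by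
  obtain ⟨hf, hbf, h1⟩ := hf
  obtain ⟨hg, hbg, h2⟩ := hg
  have hb : (fun x => b x * (f + g) x) = (fun x => b x * f x) + fun x => b x * g x := by
    ext x
    simp [mul_add]
  have hbfg : MemLp (fun x => b x * (f + g) x) (ENNReal.ofReal (4 / 3)) volume :=
    hb ▸ hbf.add hbg
  refine ⟨hf.add hg, hbfg, (h1.add h2).ae_eq ?_⟩
  have e : hbfg.toLp (fun x => b x * (f + g) x) = hbf.toLp _ + hbg.toLp _ := by
    rw [← MemLp.toLp_add]
    exact MemLp.toLp_congr _ _ (Eventually.of_forall fun x => congrFun hb x)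
  rw [e, MemLp.toLp_add hf hg, map_add, map_add]
  filter_upwards [Lp.coeFn_add (T (hf.toLp f)) (T (hg.toLp g)),
    Lp.coeFn_add (S (hbf.toLp _)) (S (hbg.toLp _))] with x h h'
  simp only [h, h', Pi.add_apply]
  ring

theorem HasIntegrableCommutator.smul (c : 𝕜) (hf : HasIntegrableCommutator b T S f) :
    HasIntegrableCommutator b T S (c • f) := by
  obtain ⟨hf, hbf, h1⟩ := hf
  have hb : (fun x => b x * (c • f) x) = c • fun x => b x * f x := by
    ext x
    simp [mul_left_comm]
  have hbc : MemLp (fun x => b x * (c • f) x) (ENNReal.ofReal (4 / 3)) volume :=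
    hb ▸ hbf.const_smul c
  refine ⟨hf.const_smul c, hbc, (h1.const_smul c).ae_eq ?_⟩
  have e : hbc.toLp (fun x => b x * (c • f) x) = c • hbf.toLp _ := by
    rw [← MemLp.toLp_const_smul]
    exact MemLp.toLp_congr _ _ (Eventually.of_forall fun x => congrFun hb x)
  rw [e, MemLp.toLp_const_smul c hf, map_smul, map_smul]
  filter_upwards [Lp.coeFn_smul c (T (hf.toLp f)), Lp.coeFn_smul c (S (hbf.toLp _))] with x h h'
  simp only [h, h', Pi.smul_apply, smul_eq_mul]
  ring

theorem IsAtomOn.memLp_of_le_two [Nontrivial (Rn n)] (ha : IsAtomOn b a x₀ r) {p : ℝ≥0∞}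
    (hp : p ≤ 2) : MemLp a p volume := by
  refine ⟨ha.memLp.1, ?_⟩
  rw [← eLpNorm_restrict_of_ae_zero ha.eq_zero]
  have : IsFiniteMeasure ((volume : Measure (Rn n)).restrict (closedBall x₀ r)) :=
    ⟨by simpa using (volume_closedBall_ne_top x₀ r).lt_top⟩
  exact (ha.memLp.restrict _).mono_exponent hp |>.2

/-- The commutator does not see the constant c: the extension agrees with T on a, so subtracting c
from b changes both terms by c·T(a), and the estimate for b - c applies. -/
theorem IsAtomOn.exists_commutator [Nontrivial (Rn n)] {δ ε C : ℝ} {K : Rn n → Rn n → 𝕜}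
    (ha : IsAtomOn b a x₀ r) (hb : MemBmo b)
    (hK : KernelBounds δ ε C K) (hT : HasKernel K 2 T) (hS : IsLpExtension T _ S) :
    ∃ (hf : MemLp a 2 volume)
      (hbf : MemLp (fun x => b x * a x) (ENNReal.ofReal (4 / 3)) volume),
      eLpNorm (fun x => b x * T (hf.toLp a) x - S (hbf.toLp (fun x => b x * a x)) x) 1 volume
        ≤ (nearConst n * ‖T‖ₑ + nearApplyConst n * ‖S‖ₑ + farConst n δ ε C) * bmoNorm b := by
  set c := ballConst b x₀ r with hc
  have hap : MemLp a (ENNReal.ofReal (4 / 3)) volume := ha.memLp_of_le_two (by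
    rw [← ENNReal.ofReal_ofNat]
    exact ENNReal.ofReal_le_ofReal (by norm_num))
  have hu : MemLp (fun x => (b x - c) * a x) (ENNReal.ofReal (4 / 3)) volume := ha.memLp_mul hb
  have hb' : (fun x => b x * a x) = (fun x => (b x - c) * a x) + c • a := by
    ext x
    simp [sub_mul]
  have hbf : MemLp (fun x => b x * a x) (ENNReal.ofReal (4 / 3)) volume :=
    hb' ▸ hu.add (hap.const_smul c)
  have e : hbf.toLp (fun x => b x * a x) = hu.toLp _ + c • hap.toLp a := by
    rw [← MemLp.toLp_const_smul, ← MemLp.toLp_add]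
    exact MemLp.toLp_congr _ _ (Eventually.of_forall fun x => congrFun hb' x)
  refine ⟨ha.memLp, hbf, ?_⟩
  refine (eLpNorm_congr_ae ?_).trans_le (eLpNorm_one_eq_lintegral_enorm.trans_le
    (ha.lintegral_commutator_le hb hK hT hS))
  rw [e, map_add, map_smul]
  filter_upwards [Lp.coeFn_add (S (hu.toLp _)) (c • S (hap.toLp a)),
    Lp.coeFn_smul c (S (hap.toLp a)), hS a ha.memLp hap] with x h1 h2 h3
  rw [h1, Pi.add_apply, h2, Pi.smul_apply, h3, smul_eq_mul]
  ring

theorem IsAtomOn.hasIntegrableCommutator [Nontrivial (Rn n)] {δ ε C : ℝ} {K : Rn n → Rn n → 𝕜}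
    (ha : IsAtomOn b a x₀ r) (hb : MemBmo b)
    (hK : KernelBounds δ ε C K) (hT : HasKernel K 2 T) (hS : IsLpExtension T _ S) :
    HasIntegrableCommutator b T S a := by
  obtain ⟨hf, hbf, h⟩ := ha.exists_commutator hb hK hT hS
  refine ⟨hf, hbf, (hb.1.aestronglyMeasurable.mul (Lp.aestronglyMeasurable _)).sub
    (Lp.aestronglyMeasurable _), h.trans_lt ?_⟩
  have := nearConst_ne_top n
  have := nearApplyConst_ne_top n
  have := farConst_ne_top n hK.delta_pos hK.eps_pos C
  have := hb.2.ne
  finiteness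

end Main

end LocalHardy

/-! ### The main theorem. -/

theorem theorem5p1 {𝕜 : Type*} [RCLike 𝕜] (n : ℕ) (hn : 1 ≤ n)
    (T : Lp 𝕜 2 (volume : Measure (LocalHardy.Rn n)) →L[𝕜]
      Lp 𝕜 2 (volume : Measure (LocalHardy.Rn n)))
    (hT : LocalHardy.IsInhomogeneousSIO T) :
    ∃ C : ℝ≥0, ∀ b : LocalHardy.Rn n → 𝕜, LocalHardy.MemBmo b →
      (∀ a : LocalHardy.Rn n → 𝕜, LocalHardy.IsApproxAtom b a →
        (∃ h, LocalHardy.IsCommutator b T a h) ∧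
        ∀ h, LocalHardy.IsCommutator b T a h →
          MemLp h 1 volume ∧ eLpNorm h 1 volume ≤ C * LocalHardy.bmoNorm b) ∧
      (∀ f ∈ LocalHardy.finiteAtomic b,
        (∃ h, LocalHardy.IsCommutator b T f h) ∧
        ∀ h, LocalHardy.IsCommutator b T f h → MemLp h 1 volume) := by
  have : Nonempty (Fin n) := ⟨⟨0, hn⟩⟩
  have : Nontrivial (LocalHardy.Rn n) := inferInstance
  obtain ⟨δ, K, hδ, -, hK, hTK⟩ := hT
  obtain ⟨ε, A, hKb⟩ := hK.exists_kernelBounds hδ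
  have hT2 : LocalHardy.HasKernel K 2 T := hTK
  -- The extension is fixed before b and the atom are given, so its norm may enter the constant.
  obtain ⟨S, hS⟩ := LocalHardy.exists_isLpExtension hKb hT2 (p := 4 / 3) (by norm_num)
    (by norm_num) rfl
  have hC : LocalHardy.nearConst n * ‖T‖ₑ + LocalHardy.nearApplyConst n * ‖S‖ₑ +
      LocalHardy.farConst n δ ε A ≠ ⊤ := by
    have := LocalHardy.nearConst_ne_top n
    have := LocalHardy.nearApplyConst_ne_top n
    have := LocalHardy.farConst_ne_top n hKb.delta_pos hKb.eps_pos A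
    finiteness
  have hatom : ∀ b : LocalHardy.Rn n → 𝕜, LocalHardy.MemBmo b →
      ∀ f ∈ LocalHardy.finiteAtomic b, LocalHardy.HasIntegrableCommutator b T S f := by
    intro b hb f hf
    induction hf using Submodule.span_induction with
    | mem a ha =>
      obtain ⟨x₀, r, ha⟩ := LocalHardy.IsApproxAtom.exists_isAtomOn ha
      exact ha.hasIntegrableCommutator hb hKb hT2 hS
    | zero => exact .zero
    | add f g _ _ hf hg => exact hf.add hg
    | smul c f _ hf => exact hf.smul c
  have hfin : ∀ b : LocalHardy.Rn n → 𝕜, LocalHardy.MemBmo b →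
      ∀ f ∈ LocalHardy.finiteAtomic b, (∃ h, LocalHardy.IsCommutator b T f h) ∧
        ∀ h, LocalHardy.IsCommutator b T f h → MemLp h 1 volume := by
    intro b hb f hf
    obtain ⟨g, hg, hg1⟩ := (hatom b hb f hf).exists_isCommutator hS
    exact ⟨⟨g, hg⟩, fun h hh => hg1.ae_eq (hg.ae_eq hh)⟩
  refine ⟨(LocalHardy.nearConst n * ‖T‖ₑ + LocalHardy.nearApplyConst n * ‖S‖ₑ +
    LocalHardy.farConst n δ ε A).toNNReal, fun b hb => ⟨fun a ha => ?_, hfin b hb⟩⟩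
  obtain ⟨hex, hmem⟩ := hfin b hb a (Submodule.subset_span ha)
  refine ⟨hex, fun h hh => ⟨hmem h hh, ?_⟩⟩
  obtain ⟨x₀, r, ha⟩ := ha.exists_isAtomOn
  obtain ⟨hf, hbf, hle⟩ := ha.exists_commutator hb hKb hT2 hS
  rw [ENNReal.coe_toNNReal hC]
  -- `h` may come from an extension to another exponent; consistency identifies it almost everywhere
  -- with the function built from `S`.
  refine (eLpNorm_congr_ae (hh.ae_eq ⟨_, _, S, hf, hbf, ?_, ENNReal.ofReal_lt_top, hS,
    ae_eq_rfl⟩)).trans_le hle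
  rw [ENNReal.one_lt_ofReal]
  norm_num
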